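/- **Setting.** Let $H^1_{\mathrm{even}}$ be the space of even functions in the Sobolev space $H^1$ of the unit circle $\mathbb S^1\subset\mathbb R^2$, with the bilinear form $\mathbf A(h,k)=\frac1{2\pi}\int_0^{2\pi}(hk-h'k')\,d\theta$ (derivatives in the angle $\theta$), let $\mathbf 1$ be the constant function one, and let $$\mathbb H^\infty=\Big\{h\in H^1_{\mathrm{even}} : \mathbf A(h,h)=1,\ \tfrac1{2\pi}\int_0^{2\pi}h>0\Big\},\qquad d(h,k)=\cosh^{-1}\mathbf A(h,k).$$ An $n$-dimensional hyperbolic subspace is a non-empty intersection of $\mathbb H^\infty$ with an $(n+1)$-dimensional linear subspace; the hyperbolic span of a finite set is the intersection of all finite-dimensional hyperbolic subspaces containing it. The boundary $\partial_\infty\mathbb H^\infty$ is the set of isotropic lines of $\mathbf A$, with the visual distance $D_{\mathbf 1}(\zeta,\eta)=\sin\big(\tfrac12\angle_{\mathbf 1}(\zeta,\eta)\big)$, where $\angle_{\mathbf 1}$ is the angle at $\mathbf 1$ between the geodesic rays towards $\zeta$ and $\eta$. For a compact convex set $K\subset\mathbb R^2$ let $\mathrm{supp}(K)(x)=\sup_{k\in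 K}\langle x,k\rangle$, $x\in\mathbb S^1$. Let $D$ be the closed unit disc and $\mathbb H^2$ the upper half-plane; for $g\in SL_2(\mathbb R)$ put $\iota(g\cdot i)=\mathrm{supp}(gD)$. Let $\Gamma\subset\partial_\infty\mathbb H^\infty$ be the set of lines spanned by the functions $\mathrm{supp}([-v,v])$, $v\in\mathbb R^2\setminus\{0\}$. Let $C_{\mathcal K}$ be the set of support functions of the convex bodies $K=-K\subset\mathbb R^2$ of area $\pi$, with the distance $d$, and let $PSL_2(\mathbb R)$ act on even functions by $\rho(g)(h)(x)=|g^{\mathsf T}x|\,h\big(g^{\mathsf T}x/|g^{\mathsf T}x|\big)$. An ellipse is an image of $D$ under an invertible affine map. **Theorem 1.2.** The map $\iota\colon\mathbb H^2\to\mathbb H^\infty$ is well defined, and the following hold. * (T4) For every $n\ge0$, any $n+1$ distinct points of $\iota(\mathbb H^2)$ have an $n$-dimensional hyperbolic subspace of $\mathbb H^\infty$ as their hyperbolic span. Moreover, for $n\ge2$, the Minkowski sum of $n$ pairwise non-homothetic ellipses is never an ellipse. * (T5) For every $v\neq0$ there is exactly one point of $\partial_\infty\mathbb H^\infty$ whose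 line contains $\mathrm{supp}([-v,v])$. The set $\Gamma$ is the limit set of $\iota(\mathbb H^2)$, i.e. the set of isotropic lines in the closure (for the topology of the $H^1$ norm on lines) of the set of lines spanned by the points of $\iota(\mathbb H^2)$. If $\zeta,\eta\in\Gamma$ are given by segments with directions $v$ and $w$, then $$D_{\mathbf 1}(\zeta,\eta)=\frac{\sqrt\pi}{2}\sqrt{\sin\angle(v,w)}.$$ The Hausdorff dimension of $\Gamma$ with respect to $D_{\mathbf 1}$ is $2$. * (T6) The support function of every convex body $K=-K\subset\mathbb R^2$ of area $\pi$ lies in $\mathbb H^\infty$, the set $C_{\mathcal K}$ is invariant under $\rho(PSL_2(\mathbb R))$, and the quotient $C_{\mathcal K}/PSL_2(\mathbb R)$ is homeomorphic to the 2-dimensional oriented Banach–Mazur compactum, i.e. the quotient of the space of convex bodies $K=-K\subset\mathbb R^2$ with non-empty interior (with the Hausdorff distance) by the orientation preserving linear automorphisms of $\mathbb R^2$. -/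

import Mathlib

open MeasureTheory Set
open scoped Real Pointwise MatrixGroups

noncomputable section

namespace ConvexHyp

/-! ### The circle and the even Sobolev space -/

/-- The Euclidean plane. -/
abbrev Plane : Type := EuclideanSpace ℝ (Fin 2)

/-- The unit circle of the plane. -/
abbrev S1 : Type := Metric.sphere (0 : Plane) 1

/-- The parametrisation `θ ↦ (cos θ, sin θ)` of the circle. -/
def circ (θ : ℝ) : S1 :=
  ⟨!₂[Real.cos θ, Real.sin θ], by simp [EuclideanSpace.norm_eq]⟩

/-- A function on the circle, written in the angle. -/
def ang (h : S1 → ℝ) (θ : ℝ) : ℝ := h (circ θ)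

lemma circ_add_pi (θ : ℝ) : circ (θ + π) = -circ θ := by
  apply Subtype.ext
  ext i
  fin_cases i <;> simp [circ]

lemma circ_surj (x : S1) : ∃ θ ∈ Ioc (-π) π, circ θ = x := by
  obtain ⟨x, hx⟩ := x
  have h1 : x 0 ^ 2 + x 1 ^ 2 = 1 := by
    have := hx
    simp only [mem_sphere_iff_norm, sub_zero, EuclideanSpace.norm_eq, Fin.sum_univ_two,
      Real.norm_eq_abs, sq_abs, Real.sqrt_eq_one] at this
    exact this
  have hn : ‖(⟨x 0, x 1⟩ : ℂ)‖ = 1 := by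
    rw [Complex.norm_def, Complex.normSq_mk, Real.sqrt_eq_one]
    nlinarith
  have hz : (⟨x 0, x 1⟩ : ℂ) ≠ 0 := by
    intro h
    rw [h] at hn
    simp at hn
  refine ⟨Complex.arg ⟨x 0, x 1⟩, Complex.arg_mem_Ioc _, ?_⟩
  apply Subtype.ext
  ext i
  fin_cases i
  · simp [circ, Complex.cos_arg hz, hn]
  · simp [circ, Complex.sin_arg, hn]

lemma ang_add (h k : S1 → ℝ) : ang (h + k) = fun θ => ang h θ + ang k θ := rfl

lemma ang_smul (c : ℝ) (h : S1 → ℝ) : ang (c • h) = fun θ => c * ang h θ := rfl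

lemma deriv_ang_add {h k : S1 → ℝ}
    (hh : AbsolutelyContinuousOnInterval (ang h) 0 (2 * π))
    (hk : AbsolutelyContinuousOnInterval (ang k) 0 (2 * π)) :
    ∀ᵐ θ ∂(volume.restrict (Ioc 0 (2 * π))),
      deriv (ang (h + k)) θ = deriv (ang h) θ + deriv (ang k) θ := by
  rw [ae_restrict_iff' measurableSet_Ioc]
  filter_upwards [hh.ae_differentiableAt, hk.ae_differentiableAt] with θ h1 h2 h3
  have h4 : θ ∈ uIcc 0 (2 * π) := by
    rw [uIcc_of_le (by positivity)]; exact ⟨h3.1.le, h3.2⟩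
  rw [ang_add]
  exact deriv_fun_add (h1 h4) (h2 h4)

lemma deriv_ang_smul (c : ℝ) (h : S1 → ℝ) (θ : ℝ) :
    deriv (ang (c • h)) θ = c * deriv (ang h) θ := by
  rw [ang_smul]
  exact deriv_const_mul_field c

/-- The space of even functions in the Sobolev space `H¹` of the circle: each class is given by
its continuous representative, so these are the even functions that are absolutely continuous in
the angle, with square integrable derivative. -/
def H1even : Submodule ℝ (S1 → ℝ) where
  carrier := {h | (∀ x, h (-x) = h x) ∧
    AbsolutelyContinuousOnInterval (ang h) 0 (2 * π) ∧
    MemLp (deriv (ang h)) 2 (volume.restrict (Ioc 0 (2 * π)))}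
  zero_mem' := by
    have h0 : ang (0 : S1 → ℝ) = fun _ => 0 := rfl
    refine ⟨fun _ => rfl, ?_, ?_⟩
    · rw [h0]
      exact (contDiff_const.contDiffOn).absolutelyContinuousOnInterval
    · rw [h0, deriv_const']
      exact MemLp.zero'
  add_mem' := by
    rintro h k ⟨h1, h2, h3⟩ ⟨k1, k2, k3⟩
    refine ⟨fun x => by simp [h1, k1], h2.add k2, ?_⟩
    refine (h3.add k3).ae_eq ?_
    filter_upwards [deriv_ang_add h2 k2] with θ hθ
    rw [hθ]; rfl
  smul_mem' := by
    rintro c h ⟨h1, h2, h3⟩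
    refine ⟨fun x => by simp [h1], h2.const_smul c, ?_⟩
    refine (h3.const_smul c).ae_eq (Filter.Eventually.of_forall fun θ => ?_)
    rw [deriv_ang_smul]; rfl

/-- The constant function equal to one. -/
def one : H1even :=
  ⟨fun _ => 1, fun _ => rfl,
    (contDiff_const.contDiffOn).absolutelyContinuousOnInterval, by
      have h0 : ang (fun _ : S1 => (1 : ℝ)) = fun _ => 1 := rfl
      rw [h0, deriv_const']
      exact MemLp.zero'⟩

/-- The integrand of the bilinear form. -/
def dens (h k : S1 → ℝ) (θ : ℝ) : ℝ := ang h θ * ang k θ - deriv (ang h) θ * deriv (ang k) θ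

lemma int_ang_mul (h k : H1even) : IntervalIntegrable (fun θ => ang h.1 θ * ang k.1 θ)
    volume 0 (2 * π) :=
  (h.2.2.1.continuousOn.mul k.2.2.1.continuousOn).intervalIntegrable

lemma int_deriv_mul (h k : H1even) :
    IntervalIntegrable (fun θ => deriv (ang h.1) θ * deriv (ang k.1) θ) volume 0 (2 * π) := by
  rw [intervalIntegrable_iff_integrableOn_Ioc_of_le (by positivity)]
  exact h.2.2.2.integrable_mul k.2.2.2

lemma int_dens (h k : H1even) : IntervalIntegrable (dens h.1 k.1) volume 0 (2 * π) :=
  (int_ang_mul h k).sub (int_deriv_mul h k)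

lemma dens_add (h h' k : H1even) : ∫ θ in (0)..(2 * π), dens (h.1 + h'.1) k.1 θ =
    (∫ θ in (0)..(2 * π), dens h.1 k.1 θ) + ∫ θ in (0)..(2 * π), dens h'.1 k.1 θ := by
  rw [← intervalIntegral.integral_add (int_dens h k) (int_dens h' k)]
  have hpi : (0 : ℝ) ≤ 2 * π := by positivity
  rw [intervalIntegral.integral_of_le hpi, intervalIntegral.integral_of_le hpi]
  apply integral_congr_ae
  filter_upwards [deriv_ang_add h.2.2.1 h'.2.2.1] with θ hθ
  simp only [dens, hθ]
  rw [ang_add]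
  ring

lemma dens_smul (c : ℝ) (h k : H1even) : ∫ θ in (0)..(2 * π), dens (c • h.1) k.1 θ =
    c * ∫ θ in (0)..(2 * π), dens h.1 k.1 θ := by
  rw [← intervalIntegral.integral_const_mul]
  congr 1
  ext θ
  simp only [dens, deriv_ang_smul]
  rw [ang_smul]
  ring

lemma dens_comm (h k : S1 → ℝ) : dens h k = dens k h := by
  ext θ; simp only [dens]; ring

/-- The Lorentzian form `A(h, k) = (1 / 2π) ∫₀^{2π} (h k - h' k') dθ`. -/
def A : LinearMap.BilinForm ℝ H1even :=
  LinearMap.mk₂ ℝ (fun h k => 1 / (2 * π) * ∫ θ in (0)..(2 * π), dens h.1 k.1 θ)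
    (fun h h' k => by
      rw [Submodule.coe_add, dens_add]; ring)
    (fun c h k => by
      rw [Submodule.coe_smul, dens_smul, smul_eq_mul]; ring)
    (fun h k k' => by
      rw [dens_comm, Submodule.coe_add, dens_add, dens_comm k.1, dens_comm k'.1]; ring)
    (fun c h k => by
      rw [dens_comm, Submodule.coe_smul, dens_smul, dens_comm k.1, smul_eq_mul]; ring)

lemma A_apply (h k : H1even) :
    A h k = 1 / (2 * π) * ∫ θ in (0)..(2 * π),
      (ang h.1 θ * ang k.1 θ - deriv (ang h.1) θ * deriv (ang k.1) θ) := rfl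

lemma A_comm (h k : H1even) : A h k = A k h := by
  change 1 / (2 * π) * (∫ θ in (0)..(2 * π), dens h.1 k.1 θ) =
    1 / (2 * π) * ∫ θ in (0)..(2 * π), dens k.1 h.1 θ
  rw [dens_comm]

/-- The mean value of a function on the circle. -/
def mean (h : H1even) : ℝ := 1 / (2 * π) * ∫ θ in (0)..(2 * π), ang h.1 θ

/-- The `H¹` norm. -/
def normH1 (h : H1even) : ℝ :=
  √((∫ θ in (0)..(2 * π), ang h.1 θ ^ 2) + ∫ θ in (0)..(2 * π), deriv (ang h.1) θ ^ 2)

lemma A_one (h : H1even) : A one h = mean h := by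
  rw [A_apply, mean]
  have h0 : ang one.1 = fun _ => 1 := rfl
  simp [h0]

lemma A_one_one : A one one = 1 := by
  rw [A_one, mean]
  have h0 : ang one.1 = fun _ => 1 := rfl
  have : π ≠ 0 := Real.pi_ne_zero
  simp only [h0, intervalIntegral.integral_const, smul_eq_mul]
  field_simp
  ring

lemma ang_periodic (h : H1even) : Function.Periodic (ang h.1) π := by
  intro θ
  simp only [ang, circ_add_pi]
  exact h.2.1 _

/-- Pointwise bound for functions of mean zero. -/
lemma sq_le_of_mean_zero (h : H1even) (h0 : mean h = 0) {x : ℝ} (hx : x ∈ Icc 0 π) :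
    ang h.1 x ^ 2 ≤ π / 24 * ∫ θ in (0)..(2 * π), deriv (ang h.1) θ ^ 2 := by
  have hpi := Real.pi_pos
  set f := ang h.1 with hf
  have hper : Function.Periodic f π := ang_periodic h
  have hdper : Function.Periodic (deriv f) π := by
    intro θ
    rw [← deriv_comp_add_const]
    congr 1
    exact funext hper
  have hsub : uIcc x (x + π) ⊆ uIcc 0 (2 * π) := by
    rw [uIcc_of_le (by linarith), uIcc_of_le (by linarith)]
    exact Icc_subset_Icc hx.1 (by linarith [hx.2])
  have hac : AbsolutelyContinuousOnInterval f x (x + π) := h.2.2.1.mono hsub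
  have hfi0 : IntervalIntegrable f volume 0 (2 * π) := h.2.2.1.continuousOn.intervalIntegrable
  have hd2 : IntervalIntegrable (fun θ => deriv f θ * deriv f θ) volume x (x + π) :=
    (int_deriv_mul h h).mono_set hsub
  have hd : IntervalIntegrable (deriv f) volume x (x + π) := hac.intervalIntegrable_deriv
  let g : ℝ → ℝ := fun t => (t - x) / π - 1 / 2
  have hgd : ∀ t, HasDerivAt g (1 / π) t := fun t =>
    (((hasDerivAt_id t).sub_const x).div_const π).sub_const (1 / 2)
  have hgac : AbsolutelyContinuousOnInterval g x (x + π) := by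
    apply ContDiffOn.absolutelyContinuousOnInterval
    exact ContDiff.contDiffOn (by fun_prop)
  have hgc : Continuous g := by fun_prop
  have hzero : ∫ t in x..(x + π), f t = 0 := by
    have e1 : ∫ t in (0)..(2 * π), f t = 0 := by
      have : 1 / (2 * π) * ∫ θ in (0)..(2 * π), f θ = 0 := h0
      rcases mul_eq_zero.mp this with h | h
      · exfalso; have : (0 : ℝ) < 1 / (2 * π) := by positivity
        linarith
      · exact h
    have e2 := hper.intervalIntegral_add_eq 0 π
    have e3 := hper.intervalIntegral_add_eq 0 x
    have hsplit := intervalIntegral.integral_add_adjacent_intervals (a := 0) (b := π)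
      (c := 2 * π) (μ := volume) (f := f)
      (hfi0.mono_set (by
        rw [uIcc_of_le (by linarith), uIcc_of_le (by linarith)]
        exact Icc_subset_Icc le_rfl (by linarith)))
      (hfi0.mono_set (by
        rw [uIcc_of_le (by linarith), uIcc_of_le (by linarith)]
        exact Icc_subset_Icc (by linarith) le_rfl))
    rw [show π + π = 2 * π by ring, zero_add] at e2
    rw [zero_add] at e3
    linarith
  have hE : ∫ t in x..(x + π), deriv f t ^ 2 = 1 / 2 * ∫ t in (0)..(2 * π), deriv f t ^ 2 := by
    have hp2 : Function.Periodic (fun t => deriv f t ^ 2) π := fun t => by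
      simp only [hdper t]
    have hi : IntervalIntegrable (fun t => deriv f t ^ 2) volume 0 (2 * π) := by
      simpa [pow_two] using int_deriv_mul h h
    have e2 := hp2.intervalIntegral_add_eq 0 π
    have e3 := hp2.intervalIntegral_add_eq 0 x
    have hsplit := intervalIntegral.integral_add_adjacent_intervals (a := 0) (b := π)
      (c := 2 * π) (μ := volume) (f := fun t => deriv f t ^ 2)
      (hi.mono_set (by
        rw [uIcc_of_le (by linarith), uIcc_of_le (by linarith)]
        exact Icc_subset_Icc le_rfl (by linarith)))
      (hi.mono_set (by
        rw [uIcc_of_le (by linarith), uIcc_of_le (by linarith)]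
        exact Icc_subset_Icc (by linarith) le_rfl))
    rw [show π + π = 2 * π by ring, zero_add] at e2
    rw [zero_add] at e3
    linarith
  have hparts : ∫ t in x..(x + π), g t * deriv f t = f x := by
    rw [hgac.integral_mul_deriv_eq_deriv_mul hac]
    have : ∀ t, deriv g t * f t = 1 / π * f t := fun t => by rw [(hgd t).deriv]
    simp only [this, intervalIntegral.integral_const_mul, hzero, hper x, g]
    field_simp
    ring
  have hgg : ∫ t in x..(x + π), g t ^ 2 = π / 12 := by
    have hF : ∀ t ∈ uIcc x (x + π), HasDerivAt (fun t => π / 3 * g t ^ 3) (g t ^ 2) t := by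
      intro t _
      have := ((hgd t).pow 3).const_mul (π / 3)
      refine this.congr_deriv ?_
      field_simp
      ring
    rw [intervalIntegral.integral_eq_sub_of_hasDerivAt hF (by
      exact (hgc.pow 2).intervalIntegrable _ _)]
    simp only [g]
    field_simp
    ring
  set s : ℝ := 12 * f x / π with hs
  have hnn : 0 ≤ ∫ t in x..(x + π), (deriv f t - s * g t) ^ 2 :=
    intervalIntegral.integral_nonneg (by linarith) fun t _ => sq_nonneg _
  have hexp : ∫ t in x..(x + π), (deriv f t - s * g t) ^ 2 =
      (∫ t in x..(x + π), deriv f t ^ 2) - 2 * s * f x + s ^ 2 * (π / 12) := by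
    have hi1 : IntervalIntegrable (fun t => deriv f t ^ 2) volume x (x + π) := by
      simpa [pow_two] using hd2
    have hi2 : IntervalIntegrable (fun t => g t * deriv f t) volume x (x + π) :=
      hd.continuousOn_mul hgc.continuousOn
    have hi3 : IntervalIntegrable (fun t => g t ^ 2) volume x (x + π) :=
      (hgc.pow 2).intervalIntegrable _ _
    rw [← hgg, ← hparts, ← intervalIntegral.integral_const_mul,
      ← intervalIntegral.integral_const_mul, ← intervalIntegral.integral_sub hi1
      (hi2.const_mul _), ← intervalIntegral.integral_add (hi1.sub (hi2.const_mul _))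
      (hi3.const_mul _)]
    congr 1
    ext t
    ring
  rw [hexp, hE, hs] at hnn
  have : 1 / 2 * (∫ t in (0)..(2 * π), deriv f t ^ 2) - 2 * (12 * f x / π) * f x
      + (12 * f x / π) ^ 2 * (π / 12) =
      1 / 2 * (∫ t in (0)..(2 * π), deriv f t ^ 2) - 12 * f x ^ 2 / π := by
    field_simp
    ring
  rw [this] at hnn
  have h2 : 12 * f x ^ 2 / π * π = 12 * f x ^ 2 := by field_simp
  nlinarith

lemma ang_mem (h : H1even) (x : S1) : ∃ θ ∈ Icc 0 π, h.1 x = ang h.1 θ := by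
  obtain ⟨θ, hθ, rfl⟩ := circ_surj x
  rcases le_total 0 θ with h0 | h0
  · exact ⟨θ, ⟨h0, hθ.2⟩, rfl⟩
  · exact ⟨θ + π, ⟨by linarith [hθ.1], by linarith⟩, (ang_periodic h θ).symm⟩

/-- The form `A` is negative definite on the functions of mean zero. -/
lemma A_neg (h : H1even) (h0 : A one h = 0) (hne : h ≠ 0) : A h h < 0 := by
  rw [A_one] at h0
  have hpi := Real.pi_pos
  set E := ∫ θ in (0)..(2 * π), deriv (ang h.1) θ ^ 2 with hE
  have hb : ∀ x, ang h.1 x ^ 2 ≤ π / 24 * E := by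
    intro x
    obtain ⟨θ, hθ, e⟩ := ang_mem h (circ x)
    change h.1 (circ x) ^ 2 ≤ _
    rw [e]
    exact sq_le_of_mean_zero h h0 hθ
  have hEpos : 0 < E := by
    rcases lt_or_ge 0 E with hp | hp
    · exact hp
    exfalso
    apply hne
    apply Subtype.ext
    funext x
    obtain ⟨θ, hθ, e⟩ := ang_mem h x
    rw [e]
    have h1 := hb θ
    have : ang h.1 θ ^ 2 ≤ 0 := h1.trans (mul_nonpos_of_nonneg_of_nonpos (by positivity) hp)
    exact pow_eq_zero_iff (two_ne_zero) |>.mp (le_antisymm this (sq_nonneg _))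
  have hi1 : IntervalIntegrable (fun t => ang h.1 t ^ 2) volume 0 (2 * π) := by
    simpa [pow_two] using int_ang_mul h h
  have hi2 : IntervalIntegrable (fun t => deriv (ang h.1) t ^ 2) volume 0 (2 * π) := by
    simpa [pow_two] using int_deriv_mul h h
  have hL : ∫ θ in (0)..(2 * π), ang h.1 θ ^ 2 ≤ 2 * π * (π / 24 * E) := by
    have := intervalIntegral.integral_mono_on (μ := volume) (a := 0) (b := 2 * π)
      (f := fun t => ang h.1 t ^ 2) (g := fun _ => π / 24 * E) (by positivity) hi1
      intervalIntegrable_const (fun x _ => hb x)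
    rw [intervalIntegral.integral_const, smul_eq_mul, sub_zero] at this
    exact this
  have hA : A h h = 1 / (2 * π) * ((∫ θ in (0)..(2 * π), ang h.1 θ ^ 2) - E) := by
    rw [A_apply, hE, ← intervalIntegral.integral_sub hi1 hi2]
    simp only [pow_two]
  rw [hA]
  apply mul_neg_of_pos_of_neg (by positivity)
  have h10 : π ^ 2 < 12 := by nlinarith [Real.pi_lt_d2, Real.pi_gt_three]
  nlinarith

/-! ### The infinite-dimensional hyperbolic space -/

lemma A_nonpos {u : H1even} (hu : A one u = 0) : A u u ≤ 0 := by
  rcases eq_or_ne u 0 with rfl | hne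
  · simp
  · exact (A_neg u hu hne).le

/-- The square of a positive vector controls its orthogonal complement. -/
lemma A_orth {y u : H1even} (hy : A y y = 1) (hu : A y u = 0) :
    A u u ≤ 0 ∧ (A u u = 0 → u = 0) := by
  have hy0 : A one y ≠ 0 := fun h => by
    have := A_nonpos h
    linarith
  set c := A one u / A one y with hc
  have hp : A one (u - c • y) = 0 := by
    simp only [map_sub, map_smul, smul_eq_mul, hc]
    field_simp
    ring
  have he : A (u - c • y) (u - c • y) = A u u + c ^ 2 := by
    simp only [map_sub, map_smul, smul_eq_mul, LinearMap.sub_apply, LinearMap.smul_apply, hy, hu,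
      A_comm u y]
    ring
  have hle := A_nonpos hp
  rw [he] at hle
  refine ⟨by nlinarith [sq_nonneg c], fun h0 => ?_⟩
  have hc0 : c = 0 := by
    have : c ^ 2 ≤ 0 := by linarith
    exact pow_eq_zero_iff two_ne_zero |>.mp (le_antisymm this (sq_nonneg c))
  rw [hc0, zero_smul, sub_zero] at hp
  by_contra hne
  exact absurd (A_neg u hp hne) (by linarith)

lemma A_cs {y u w : H1even} (hy : A y y = 1) (hu : A y u = 0) (hw : A y w = 0) :
    (A u w) ^ 2 ≤ A u u * A w w := by
  have key : ∀ s : ℝ, A u u + 2 * s * A u w + s ^ 2 * A w w ≤ 0 := by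
    intro s
    have h := (A_orth (u := u + s • w) hy (by simp [hu, hw])).1
    have : A (u + s • w) (u + s • w) = A u u + 2 * s * A u w + s ^ 2 * A w w := by
      simp only [map_add, map_smul, smul_eq_mul, LinearMap.add_apply, LinearMap.smul_apply,
        A_comm w u]
      ring
    linarith
  have := discrim_le_zero_of_nonpos (a := A w w) (b := 2 * A u w) (c := A u u) (fun s => by
    have := key s
    nlinarith)
  rw [discrim] at this
  nlinarith

/-- The hyperbolic space, as the upper sheet of the hyperboloid of the form `A`. -/
def HInf : Type := {h : H1even // A h h = 1 ∧ 0 < mean h}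

namespace HInf

/-- The underlying vector of a point. -/
def vec (x : HInf) : H1even := x.1

/-- The underlying function on the circle. -/
def fn (x : HInf) : S1 → ℝ := x.1.1

lemma one_le (x y : HInf) : 1 ≤ A x.vec y.vec := by
  have hx : A x.vec x.vec = 1 := x.2.1
  have hy : A y.vec y.vec = 1 := y.2.1
  have mx : 0 < A one x.vec := by rw [A_one]; exact x.2.2
  have my : 0 < A one y.vec := by rw [A_one]; exact y.2.2
  have hu : A one (x.vec - A one x.vec • one) = 0 := by simp [A_one_one]
  have hw : A one (y.vec - A one y.vec • one) = 0 := by simp [A_one_one]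
  have hcs := A_cs A_one_one hu hw
  simp only [map_sub, map_smul, smul_eq_mul, LinearMap.sub_apply, LinearMap.smul_apply, hx, hy,
    A_comm x.vec one, A_comm y.vec one, A_one_one] at hcs
  set a := A one x.vec
  set b := A one y.vec
  set c := A x.vec y.vec
  have h1 : (c - a * b) ^ 2 ≤ (1 - a ^ 2) * (1 - b ^ 2) := by nlinarith
  have hpos : 0 < a * b := mul_pos mx my
  -- the point `y - c x` is orthogonal to `x`
  have ho := (A_orth (y := x.vec) (u := y.vec - c • x.vec) hx (by simp [hx, c])).1
  have hc2 : 1 ≤ c ^ 2 := by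
    simp only [map_sub, map_smul, smul_eq_mul, LinearMap.sub_apply, LinearMap.smul_apply, hx, hy,
      A_comm y.vec x.vec] at ho
    change 1 - c * c - c * (c - c * 1) ≤ 0 at ho
    nlinarith
  have ha : 1 ≤ a ^ 2 := by
    have := (A_orth (y := x.vec) (u := one - a • x.vec) hx (by
      simp [hx, a, A_comm x.vec one])).1
    simp only [map_sub, map_smul, smul_eq_mul, LinearMap.sub_apply, LinearMap.smul_apply, hx,
      A_comm x.vec one, A_one_one] at this
    change 1 - a * a - a * (a - a * 1) ≤ 0 at this
    nlinarith
  have hb : 1 ≤ b ^ 2 := by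
    have := (A_orth (y := y.vec) (u := one - b • y.vec) hy (by
      simp [hy, b, A_comm y.vec one])).1
    simp only [map_sub, map_smul, smul_eq_mul, LinearMap.sub_apply, LinearMap.smul_apply, hy,
      A_comm y.vec one, A_one_one] at this
    change 1 - b * b - b * (b - b * 1) ≤ 0 at this
    nlinarith
  have hcpos : 0 < c := by
    by_contra hc
    push Not at hc
    nlinarith [mul_nonneg (neg_nonneg.mpr hc) hpos.le, sq_nonneg c]
  nlinarith

lemma dist_triangle_aux (x y z : HInf) :
    Real.arcosh (A x.vec z.vec) ≤
      Real.arcosh (A x.vec y.vec) + Real.arcosh (A y.vec z.vec) := by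
  have h1 := one_le x y
  have h2 := one_le y z
  have h3 := one_le x z
  set a := A x.vec y.vec with ha
  set b := A y.vec z.vec with hb
  have hx : A x.vec x.vec = 1 := x.2.1
  have hy : A y.vec y.vec = 1 := y.2.1
  have hz : A z.vec z.vec = 1 := z.2.1
  have hu : A y.vec (x.vec - a • y.vec) = 0 := by simp [hy, ha, A_comm x.vec y.vec]
  have hw : A y.vec (z.vec - b • y.vec) = 0 := by simp [hy, hb]
  have hcs := A_cs hy hu hw
  have e1 : A (x.vec - a • y.vec) (z.vec - b • y.vec) = A x.vec z.vec - a * b := by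
    simp only [map_sub, map_smul, smul_eq_mul, LinearMap.sub_apply, LinearMap.smul_apply, hy,
      ← ha, ← hb]
    ring
  have e2 : A (x.vec - a • y.vec) (x.vec - a • y.vec) = 1 - a ^ 2 := by
    simp only [map_sub, map_smul, smul_eq_mul, LinearMap.sub_apply, LinearMap.smul_apply, hy, hx,
      A_comm y.vec x.vec, ← ha]
    ring
  have e3 : A (z.vec - b • y.vec) (z.vec - b • y.vec) = 1 - b ^ 2 := by
    simp only [map_sub, map_smul, smul_eq_mul, LinearMap.sub_apply, LinearMap.smul_apply, hy, hz,
      A_comm z.vec y.vec, ← hb]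
    ring
  rw [e1, e2, e3] at hcs
  have hle : A x.vec z.vec ≤ Real.cosh (Real.arcosh a + Real.arcosh b) := by
    rw [Real.cosh_add, Real.cosh_arcosh h1, Real.cosh_arcosh h2, Real.sinh_arcosh h1,
      Real.sinh_arcosh h2, ← Real.sqrt_mul (by nlinarith)]
    have : A x.vec z.vec - a * b ≤ √((a ^ 2 - 1) * (b ^ 2 - 1)) :=
      Real.le_sqrt_of_sq_le (by nlinarith)
    linarith
  have hnn : 0 ≤ Real.arcosh a + Real.arcosh b :=
    add_nonneg (Real.arcosh_nonneg h1) (Real.arcosh_nonneg h2)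
  calc Real.arcosh (A x.vec z.vec)
      ≤ Real.arcosh (Real.cosh (Real.arcosh a + Real.arcosh b)) :=
        (Real.arcosh_le_arcosh (by linarith) (Real.cosh_pos _)).mpr hle
    _ = _ := Real.arcosh_cosh hnn

/-- The hyperbolic distance `d(x, y) = arcosh A(x, y)`. -/
instance : MetricSpace HInf where
  dist x y := Real.arcosh (A x.vec y.vec)
  dist_self x := by
    rw [show A x.vec x.vec = 1 from x.2.1, Real.arcosh_zero]
  dist_comm x y := by
    rw [A_comm]
  dist_triangle := dist_triangle_aux
  eq_of_dist_eq_zero := by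
    intro x y h
    have h1 : A x.vec y.vec = 1 := (Real.arcosh_eq_zero_iff (one_le x y)).mp h
    have hx : A x.vec x.vec = 1 := x.2.1
    have hy : A y.vec y.vec = 1 := y.2.1
    have := (A_orth (y := y.vec) (u := x.vec - y.vec) hy (by
      simp [hy, A_comm y.vec x.vec, h1])).2 (by
      simp [hx, hy, A_comm y.vec x.vec, h1])
    exact Subtype.ext (sub_eq_zero.mp this)

end HInf

/-- The `n`-dimensional hyperbolic subspaces: the nonempty intersections of the hyperboloid with
linear subspaces of dimension `n + 1`. -/
def IsHyperbolicSubspace (n : ℕ) (X : Set HInf) : Prop :=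
  X.Nonempty ∧ ∃ W : Submodule ℝ H1even,
    FiniteDimensional ℝ W ∧ Module.finrank ℝ W = n + 1 ∧ X = {x | x.vec ∈ W}

/-- The hyperbolic span of a (finite) set: the intersection of all finite-dimensional hyperbolic
subspaces that contain it. -/
def hyperbolicSpan (P : Set HInf) : Set HInf :=
  ⋂₀ {X | P ⊆ X ∧ ∃ n, IsHyperbolicSubspace n X}

/-! ### The boundary at infinity and its visual distance -/

/-- The boundary at infinity: the isotropic lines of the form `A`. -/
def Boundary : Type := {ζ : Projectivization ℝ H1even // A ζ.rep ζ.rep = 0}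

namespace Boundary

/-- The isotropic line of a boundary point. -/
def line (ζ : Boundary) : Submodule ℝ H1even := ζ.1.submodule

lemma mean_rep_ne (ζ : Boundary) : A one ζ.1.rep ≠ 0 := fun h => by
  have := A_neg _ h ζ.1.rep_nonzero
  linarith [ζ.2]

/-- The vector of mean one on an isotropic line. -/
def unitRep (ζ : Boundary) : H1even := (mean ζ.1.rep)⁻¹ • ζ.1.rep

lemma A_one_unitRep (ζ : Boundary) : A one ζ.unitRep = 1 := by
  have := ζ.mean_rep_ne
  rw [A_one] at this
  rw [unitRep, map_smul, A_one, smul_eq_mul, inv_mul_cancel₀ this]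

lemma A_unitRep (ζ : Boundary) : A ζ.unitRep ζ.unitRep = 0 := by
  simp [unitRep, ζ.2]

/-- The initial velocity, in the tangent space at `one` (the orthogonal of `one`), of the unit speed
geodesic ray from `one` to `ζ`. -/
def velocity (ζ : Boundary) : H1even := ζ.unitRep - one

lemma A_one_velocity (ζ : Boundary) : A one ζ.velocity = 0 := by
  simp [velocity, A_one_unitRep, A_one_one]

lemma A_velocity (ζ : Boundary) : A ζ.velocity ζ.velocity = -1 := by
  simp [velocity, A_one_unitRep, A_one_one, A_unitRep, A_comm ζ.unitRep one]

/-- The geodesic ray `t ↦ cosh t • one + sinh t • velocity` from `one` to `ζ`; it is also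
`t ↦ (exp t / 2) • unitRep + exp (-t) • (one - unitRep / 2)`. -/
def ray (ζ : Boundary) (t : ℝ) : HInf :=
  ⟨Real.cosh t • one + Real.sinh t • ζ.velocity, by
    simp only [map_add, map_smul, smul_eq_mul, LinearMap.add_apply, LinearMap.smul_apply,
      A_one_one, A_one_velocity, A_velocity, A_comm ζ.velocity one]
    nlinarith [Real.cosh_sq t], by
    rw [← A_one]
    simp [A_one_one, A_one_velocity, Real.cosh_pos]⟩

lemma dist_ray (ζ : Boundary) (s t : ℝ) : dist (ζ.ray s) (ζ.ray t) = |s - t| := by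
  change Real.arcosh (A (Real.cosh s • one + Real.sinh s • ζ.velocity)
    (Real.cosh t • one + Real.sinh t • ζ.velocity)) = _
  rw [← Real.arcosh_cosh (abs_nonneg (s - t)), Real.cosh_abs, Real.cosh_sub]
  congr 1
  simp only [map_add, map_smul, smul_eq_mul, LinearMap.add_apply, LinearMap.smul_apply,
    A_one_one, A_one_velocity, A_velocity, A_comm ζ.velocity one]
  ring

/-- The angle at `one` between the geodesic rays towards two boundary points: the angle of their
initial velocities for the Riemannian metric `-A` of the tangent space at `one`. -/
def angle (ζ η : Boundary) : ℝ :=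
  Real.arccos (-A ζ.velocity η.velocity /
    (√(-A ζ.velocity ζ.velocity) * √(-A η.velocity η.velocity)))

/-- The visual distance based at `one`: the sine of half of the angle. -/
def visualDist (ζ η : Boundary) : ℝ := Real.sin (angle ζ η / 2)

lemma visualDist_eq (ζ η : Boundary) :
    visualDist ζ η = √(-A (ζ.velocity - η.velocity) (ζ.velocity - η.velocity)) / 2 := by
  have hcs := A_cs A_one_one ζ.A_one_velocity η.A_one_velocity
  rw [A_velocity, A_velocity] at hcs
  have hb : |A ζ.velocity η.velocity| ≤ 1 := by
    rw [← sq_le_one_iff_abs_le_one]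
    linarith
  have hang : angle ζ η = Real.arccos (-A ζ.velocity η.velocity) := by
    simp [angle, A_velocity]
  have h0 := Real.arccos_nonneg (-A ζ.velocity η.velocity)
  have h1 := Real.arccos_le_pi (-A ζ.velocity η.velocity)
  rw [visualDist, hang, Real.sin_half_eq_sqrt h0 (by linarith [Real.pi_pos]),
    Real.cos_arccos (by linarith [(abs_le.mp hb).2]) (by linarith [(abs_le.mp hb).1])]
  have e : -A (ζ.velocity - η.velocity) (ζ.velocity - η.velocity) =
      2 ^ 2 * ((1 - -A ζ.velocity η.velocity) / 2) := by
    simp only [map_sub, LinearMap.sub_apply, A_velocity, A_comm η.velocity ζ.velocity]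
    ring
  rw [e, Real.sqrt_mul (by norm_num), Real.sqrt_sq (by norm_num)]
  ring

lemma sqrt_triangle {u w : H1even} (hu : A one u = 0) (hw : A one w = 0) :
    √(-A (u + w) (u + w)) ≤ √(-A u u) + √(-A w w) := by
  have hcs := A_cs A_one_one hu hw
  have h1 := A_nonpos hu
  have h2 := A_nonpos hw
  rw [Real.sqrt_le_left (by positivity), add_sq, Real.sq_sqrt (by linarith),
    Real.sq_sqrt (by linarith)]
  have e : A (u + w) (u + w) = A u u + 2 * A u w + A w w := by
    simp only [map_add, LinearMap.add_apply, A_comm w u]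
    ring
  have h3 : -A u w ≤ √(-A u u) * √(-A w w) := by
    rw [← Real.sqrt_mul (by linarith)]
    exact Real.le_sqrt_of_sq_le (by nlinarith)
  rw [e]
  linarith

instance : MetricSpace Boundary where
  dist := visualDist
  dist_self ζ := by
    simp [visualDist_eq]
  dist_comm ζ η := by
    simp only [visualDist, angle, A_comm η.velocity ζ.velocity]
    ring_nf
  dist_triangle ζ η ξ := by
    simp only [visualDist_eq]
    have := sqrt_triangle (u := ζ.velocity - η.velocity) (w := η.velocity - ξ.velocity)
      (by simp [A_one_velocity]) (by simp [A_one_velocity])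
    rw [sub_add_sub_cancel] at this
    linarith
  eq_of_dist_eq_zero := by
    intro ζ η h
    change visualDist ζ η = 0 at h
    rw [visualDist_eq] at h
    have h0 : A one (ζ.velocity - η.velocity) = 0 := by simp [A_one_velocity]
    have h1 := A_nonpos h0
    have h2 : √(-A (ζ.velocity - η.velocity) (ζ.velocity - η.velocity)) = 0 := by linarith
    rw [Real.sqrt_eq_zero (by linarith)] at h2
    have h3 := (A_orth A_one_one h0).2 (by linarith)
    have h4 : ζ.unitRep = η.unitRep := by
      have := sub_eq_zero.mp h3
      simpa [velocity] using this
    apply Subtype.ext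
    rw [← ζ.1.mk_rep, ← η.1.mk_rep, Projectivization.mk_eq_mk_iff']
    have n1 : mean ζ.1.rep ≠ 0 := by rw [← A_one]; exact ζ.mean_rep_ne
    refine ⟨mean ζ.1.rep * (mean η.1.rep)⁻¹, ?_⟩
    rw [mul_smul]
    change mean ζ.1.rep • η.unitRep = _
    rw [← h4, unitRep, smul_smul, mul_inv_cancel₀ n1, one_smul]

end Boundary

/-- The limit set at infinity of a set of points: the isotropic lines in the closure, for the `H¹`
topology on the projective space, of the lines spanned by the points. -/
def limitSet (X : Set HInf) : Set Boundary :=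
  {ζ | ∃ v ∈ ζ.line, v ≠ 0 ∧
    ∀ ε > 0, ∃ x ∈ X, ∃ c : ℝ, normH1 (c • x.vec - v) < ε}

/-! ### Convex bodies -/

/-- The support function, restricted to the unit circle. -/
def supp (K : Set Plane) (x : S1) : ℝ := sSup ((fun k => inner ℝ (x : Plane) k) '' K)

/-- The linear map of the plane with a given matrix. -/
def act (M : Matrix (Fin 2) (Fin 2) ℝ) : Plane →ₗ[ℝ] Plane := Matrix.toEuclideanLin M

lemma act_one (x : Plane) : act 1 x = x := by
  simp [act, Matrix.toEuclideanLin]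

lemma act_mul (M N : Matrix (Fin 2) (Fin 2) ℝ) (x : Plane) :
    act (M * N) x = act M (act N x) := by
  ext i
  simp [act, Matrix.toEuclideanLin, Matrix.toLpLin_apply]

/-- The closed unit disc. -/
def disc : Set Plane := Metric.closedBall 0 1

/-- Ellipses: the invertible affine images of the disc. -/
def IsEllipse (E : Set Plane) : Prop :=
  ∃ (M : GL (Fin 2) ℝ) (c : Plane), E = (fun x => act (M : Matrix (Fin 2) (Fin 2) ℝ) x + c) '' disc

/-- `F` is the image of `E` under a dilation with positive factor, followed by a translation. -/
def Homothetic (E F : Set Plane) : Prop :=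
  ∃ (r : ℝ) (c : Plane), 0 < r ∧ F = (fun x => r • x + c) '' E

/-- Symmetric convex bodies with nonempty interior, with the Hausdorff distance. -/
abbrev SymBody : Type :=
  {K : ConvexBody Plane // (∀ x ∈ K, -x ∈ K) ∧ (interior (K : Set Plane)).Nonempty}

/-- The set of points of a body. -/
def SymBody.set (K : SymBody) : Set Plane := (K.1 : Set Plane)

/-- The set `C_K` of the support functions of the symmetric convex bodies of area `π`. -/
def CK : Set HInf :=
  {h | ∃ K : SymBody, volume K.set = ENNReal.ofReal π ∧ h.fn = supp K.set}

/-- The symmetric segment with endpoints `-v` and `v`. -/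
def symSegment (v : Plane) : Set Plane := segment ℝ (-v) v

/-- The boundary point `ζ` is the line of the support function of the symmetric segments of
direction `v`. -/
def IsDirection (ζ : Boundary) (v : Plane) : Prop :=
  v ≠ 0 ∧ ∃ h ∈ ζ.line, (h : S1 → ℝ) = supp (symSegment v)

/-- The set of the boundary points given by the symmetric segments of positive length. -/
def Gam : Set Boundary := {ζ | ∃ v, IsDirection ζ v}

/-! ### The action of `PSL₂(ℝ)` -/

/-- The even functions on the circle. -/
def EvenFun : Submodule ℝ (S1 → ℝ) where
  carrier := {h | ∀ x, h (-x) = h x}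
  zero_mem' := fun _ => rfl
  add_mem' := fun {h k} hh hk x => by simp only [Pi.add_apply, hh x, hk x]
  smul_mem' := fun c {h} hh x => by simp only [Pi.smul_apply, hh x]

lemma act_transpose_ne (g : SL(2, ℝ)) {x : Plane} (hx : x ≠ 0) :
    act (g : Matrix (Fin 2) (Fin 2) ℝ).transpose x ≠ 0 := by
  intro h
  apply hx
  have h1 : (↑(g⁻¹) : Matrix (Fin 2) (Fin 2) ℝ).transpose * (g : Matrix (Fin 2) (Fin 2) ℝ).transpose
      = 1 := by
    rw [← Matrix.transpose_mul, ← Matrix.SpecialLinearGroup.coe_mul, mul_inv_cancel,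
      Matrix.SpecialLinearGroup.coe_one, Matrix.transpose_one]
  rw [← act_one x, ← h1, act_mul, h, map_zero]

lemma S1.ne_zero (x : S1) : (x : Plane) ≠ 0 := by
  intro h
  have := x.2
  rw [h] at this
  simp at this

/-- The action `x ↦ gᵀ x / |gᵀ x|` on the circle. -/
def circAct (g : SL(2, ℝ)) (x : S1) : S1 :=
  ⟨‖act (g : Matrix (Fin 2) (Fin 2) ℝ).transpose x‖⁻¹ •
      act (g : Matrix (Fin 2) (Fin 2) ℝ).transpose x, by
    have := norm_ne_zero_iff.mpr (act_transpose_ne g (S1.ne_zero x))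
    rw [mem_sphere_iff_norm, sub_zero, norm_smul, norm_inv, norm_norm, inv_mul_cancel₀ this]⟩

/-- The formula `ρ(g)(h)(x) = |gᵀ x| h(gᵀ x / |gᵀ x|)`. -/
def rhoFun (g : SL(2, ℝ)) (h : S1 → ℝ) (x : S1) : ℝ :=
  ‖act (g : Matrix (Fin 2) (Fin 2) ℝ).transpose x‖ * h (circAct g x)

lemma circAct_neg (g : SL(2, ℝ)) (x : S1) : circAct g (-x) = -circAct g x := by
  apply Subtype.ext
  simp [circAct]

lemma rhoFun_one (h : S1 → ℝ) : rhoFun 1 h = h := by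
  funext x
  have hx : ‖(x : Plane)‖ = 1 := by simp
  have e : circAct 1 x = x := by
    apply Subtype.ext
    simp [circAct, act_one]
  simp [rhoFun, e, act_one]

lemma rhoFun_mul (g g' : SL(2, ℝ)) (h : S1 → ℝ) : rhoFun (g * g') h = rhoFun g (rhoFun g' h) := by
  funext x
  have hne := norm_ne_zero_iff.mpr (act_transpose_ne g (S1.ne_zero x))
  have hpos : 0 < ‖act (g : Matrix (Fin 2) (Fin 2) ℝ).transpose x‖ := norm_pos_iff.mpr
    (act_transpose_ne g (S1.ne_zero x))
  have e : circAct (g * g') x = circAct g' (circAct g x) := by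
    apply Subtype.ext
    simp only [circAct, Matrix.SpecialLinearGroup.coe_mul, Matrix.transpose_mul, act_mul,
      map_smul, norm_smul, norm_inv, norm_norm, smul_smul]
    congr 1
    field_simp
  simp only [rhoFun, e]
  simp only [circAct, Matrix.SpecialLinearGroup.coe_mul, Matrix.transpose_mul, act_mul,
      map_smul, norm_smul, norm_inv, norm_norm]
  field_simp

/-- The linear action of `SL₂(ℝ)` on even functions. -/
def rhoSL : SL(2, ℝ) →* Module.End ℝ EvenFun where
  toFun g :=
    { toFun := fun h => ⟨rhoFun g h.1, fun x => by
        simp only [rhoFun, circAct_neg, h.2 (circAct g x), Metric.sphere, coe_neg_sphere, map_neg,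
          norm_neg]⟩
      map_add' := fun h k => by
        apply Subtype.ext; funext x
        simp only [rhoFun, Submodule.coe_add, Pi.add_apply]
        ring
      map_smul' := fun c h => by
        apply Subtype.ext; funext x
        simp only [rhoFun, Submodule.coe_smul, Pi.smul_apply, smul_eq_mul, RingHom.id_apply]
        ring }
  map_one' := by
    apply LinearMap.ext; intro h
    exact Subtype.ext (rhoFun_one h.1)
  map_mul' g g' := by
    apply LinearMap.ext; intro h
    exact Subtype.ext (rhoFun_mul g g' h.1)

/-- The group `PSL₂(ℝ)`. -/
abbrev PSL2 : Type := Matrix.ProjectiveSpecialLinearGroup (Fin 2) ℝ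

lemma rhoSL_center (g : SL(2, ℝ)) (hg : g ∈ Subgroup.center SL(2, ℝ)) : rhoSL g = 1 := by
  obtain ⟨r, hr, hg⟩ := Matrix.SpecialLinearGroup.mem_center_iff.mp hg
  have ht : (g : Matrix (Fin 2) (Fin 2) ℝ).transpose = r • 1 := by
    rw [← hg]
    ext i j
    fin_cases i <;> fin_cases j <;> simp
  have hr2 : r ^ 2 = 1 := by simpa using hr
  apply LinearMap.ext
  intro h
  apply Subtype.ext
  funext x
  have hx : ‖(x : Plane)‖ = 1 := by simp
  have hact : act (g : Matrix (Fin 2) (Fin 2) ℝ).transpose x = r • (x : Plane) := by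
    have := act_one (x : Plane)
    rw [ht]
    simp only [act, map_smul, LinearMap.smul_apply] at this ⊢
    rw [this]
  change ‖act (g : Matrix (Fin 2) (Fin 2) ℝ).transpose x‖ * h.1 (circAct g x) = h.1 x
  rcases (sq_eq_sq_iff_eq_or_eq_neg.mp (hr2.trans (one_pow 2).symm)) with h1 | h1
  · have e : circAct g x = x := by
      apply Subtype.ext
      simp [circAct, hact, h1]
    rw [e, hact, h1]
    simp
  · have e : circAct g x = -x := by
      apply Subtype.ext
      simp [circAct, hact, h1]
    rw [e, hact, h1, h.2 x]
    simp

/-- The linear action `ρ` of `PSL₂(ℝ)` on even functions. -/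
def rho : PSL2 →* Module.End ℝ EvenFun :=
  QuotientGroup.lift (Subgroup.center SL(2, ℝ)) rhoSL rhoSL_center

/-- A point of the hyperbolic space as an even function. -/
def HInf.even (x : HInf) : EvenFun := ⟨x.fn, x.1.2.1⟩

/-- Two elements of `C_K` are equivalent if they are in the same orbit of `PSL₂(ℝ)`. -/
def ckSetoid : Setoid CK where
  r h k := ∃ g : PSL2, rho g h.1.even = k.1.even
  iseqv :=
    ⟨fun h => ⟨1, by simp⟩,
     fun {h k} ⟨g, hg⟩ => ⟨g⁻¹, by
      rw [← hg, ← Module.End.mul_apply, ← map_mul, inv_mul_cancel, map_one, Module.End.one_apply]⟩,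
     fun {h k l} ⟨g, hg⟩ ⟨g', hg'⟩ => ⟨g' * g, by
      rw [map_mul, Module.End.mul_apply, hg, hg']⟩⟩

/-- The quotient `C_K / PSL₂(ℝ)`, with the quotient topology. -/
abbrev CKQuotient : Type := Quotient ckSetoid

/-- Two symmetric convex bodies are equivalent if an orientation preserving linear automorphism of the
plane maps the first to the second. -/
def bmSetoid : Setoid SymBody where
  r K L := ∃ g : GL(2, ℝ)⁺,
    L.set = act ((g : GL (Fin 2) ℝ) : Matrix (Fin 2) (Fin 2) ℝ) '' K.set
  iseqv := by
    refine ⟨fun K => ⟨1, ?_⟩, ?_, ?_⟩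
    · ext x; simp [act_one]
    · rintro K L ⟨g, hg⟩
      refine ⟨g⁻¹, ?_⟩
      rw [hg, image_image]
      have h1 : (((g⁻¹ : GL(2, ℝ)⁺) : GL (Fin 2) ℝ) : Matrix (Fin 2) (Fin 2) ℝ) *
          ((g : GL (Fin 2) ℝ) : Matrix (Fin 2) (Fin 2) ℝ) = 1 := by
        rw [← Units.val_mul, ← Subgroup.coe_mul, inv_mul_cancel]
        rfl
      simp only [← act_mul, h1, act_one, image_id']
    · rintro K L M ⟨g, hg⟩ ⟨g', hg'⟩
      refine ⟨g' * g, ?_⟩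
      rw [hg', hg, image_image]
      simp [act_mul]

/-- The 2-dimensional oriented Banach-Mazur compactum: symmetric convex bodies of the plane with
nonempty interior, up to orientation preserving linear automorphisms, with the quotient of the
topology of the Hausdorff distance. -/
abbrev OrientedBanachMazur : Type := Quotient bmSetoid

end ConvexHyp

end

open ConvexHyp

/-!
The proof rests on the area formula `SymBody.volume_eq`: for a symmetric convex body `K` with support
function `h`, the area of `K` is `π A(h, h)`. It is obtained without second derivatives of `h`. The
part of a large disc outside `K` is swept out exactly once by the half-tangents of `K` of one
orientation, the map `(θ, s) ↦ h(θ) e(θ) + s e'(θ)` has Jacobian `s - h'(θ)` there, and the change of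
variables leaves the integral of `(√(R² - h²) - h')² / 2`, in which the mixed term is a total
derivative (`volume_ball_diff`, `volume_eq_integral_dens`). Hence the bodies of area `π` give points of
the hyperbolic space, and monotonicity of the area becomes an inequality for `A` (`SymBody.A_mono`).

*Independence.* The ellipses of area `π` have the support functions `√q` for the positive definite
quadratic forms `q` of determinant one. Square roots of pairwise nonproportional quadratic polynomials
`qᵢ` are linearly independent, even over the polynomials (`polynomial_sqrt_indep`). Differentiation of
a relation `∑ pᵢ √qᵢ = 0` gives a second one, and the two are proportional by induction on the number
of terms; so all `pᵢ √qᵢ` have the same logarithmic derivative, and `p₁² q₁` and `p₂² q₂` have the same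
zeros with multiplicities. At the nonreal root of `q₁` one of these multiplicities is odd and the other
one is even. This gives the dimensions of the hyperbolic spans. For a Minkowski sum of ellipses one
passes first to the even parts of the support functions, which removes the centres.

*The boundary.* The support function `k` of a symmetric segment is `|cos|` up to scale and rotation, so
`k + k''` is a sum of two point masses and `A(h, k)` is a multiple of the value of `h` in the direction
normal to the segment (`A_segH`). This yields isotropy and the formula for the visual distance, which
is comparable to the square root of the angle between the directions. The parametrisation by the angle
and its inverse are thus Hölder of exponents `1 / 2` and `2`, and the dimension is `2`. For the limit
set, convergence in `H¹` implies pointwise convergence. The square of a limit of multiples of `√qₙ` is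
therefore a semidefinite quadratic form. If it is definite, the limit is not isotropic. If it is the
square of a linear form, the limit is the support function of a segment up to sign
(`limitSet_ellipsePoint`).

*The quotients.* The topology of the hyperbolic distance on the bodies of area `π` is that of the
Hausdorff distance. In one direction, the form `A` is negative definite on the orthogonal complement of
a point of the hyperbolic space and controls the values of the functions there (`abs_le_of_orth`). In
the other one, if `h_L ≤ h_K + ε`, then `K + L` lies in the sum of `K` and its parallel body at distance
`ε`, and comparing areas bounds `A(h_K, h_L)`, which is the hyperbolic cosine of the distance, from
above (`SymBody.mixed_le`). Scaling to area `π` then identifies the two quotients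
(`quotientHomeomorph`).
-/

open MeasureTheory Set
open scoped Real Pointwise MatrixGroups

noncomputable section

namespace ConvexHyp

/-! ### Linear independence of square roots of quadratic polynomials -/

open Polynomial in
/-- If `u v' = u' v` for two nonzero polynomials over a field of characteristic zero, then every
point is a root of `u` and `v` to the same order. -/
lemma rootMultiplicity_eq_of_mul_derivative_eq {K : Type*} [Field K] [CharZero K] {u v : K[X]}
    (hu : u ≠ 0) (hv : v ≠ 0) (h : u * derivative v = derivative u * v) (w : K) :
    rootMultiplicity w u = rootMultiplicity w v := by
  obtain ⟨U, hU, hU'⟩ := exists_eq_pow_rootMultiplicity_mul_and_not_dvd u hu w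
  obtain ⟨V, hV, hV'⟩ := exists_eq_pow_rootMultiplicity_mul_and_not_dvd v hv w
  set a := rootMultiplicity w u
  set b := rootMultiplicity w v
  rw [dvd_iff_isRoot, IsRoot.def] at hU' hV'
  have hX : (X - C w) ≠ 0 := X_sub_C_ne_zero w
  -- multiplied by `X - w`, both derivatives keep their order of vanishing
  have e1 : (X - C w) * derivative u
      = (X - C w) ^ a * (C (a : K) * U + (X - C w) * derivative U) := by
    rw [hU]
    rcases Nat.eq_zero_or_pos a with h0 | h0
    · simp [h0]
    · obtain ⟨m, hm⟩ := Nat.exists_eq_succ_of_ne_zero h0.ne'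
      simp only [hm, derivative_mul, derivative_X_sub_C_pow, Nat.succ_eq_add_one,
        Nat.add_sub_cancel]
      ring
  have e2 : (X - C w) * derivative v
      = (X - C w) ^ b * (C (b : K) * V + (X - C w) * derivative V) := by
    rw [hV]
    rcases Nat.eq_zero_or_pos b with h0 | h0
    · simp [h0]
    · obtain ⟨m, hm⟩ := Nat.exists_eq_succ_of_ne_zero h0.ne'
      simp only [hm, derivative_mul, derivative_X_sub_C_pow, Nat.succ_eq_add_one,
        Nat.add_sub_cancel]
      ring
  have e3 : (X - C w) ^ (a + b) * (U * (C (b : K) * V + (X - C w) * derivative V)) =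
      (X - C w) ^ (a + b) * (V * (C (a : K) * U + (X - C w) * derivative U)) := by
    calc _ = ((X - C w) ^ a * U) * ((X - C w) * derivative v) := by rw [e2]; ring
      _ = (X - C w) * (u * derivative v) := by rw [← hU]; ring
      _ = ((X - C w) * derivative u) * v := by rw [h]; ring
      _ = _ := by rw [e1]; nth_rewrite 1 [hV]; ring
  have e4 := congrArg (eval w) (mul_left_cancel₀ (pow_ne_zero _ hX) e3)
  simp only [eval_mul, eval_add, eval_C, eval_sub, eval_X, sub_self, zero_mul, add_zero] at e4
  have e5 : ((a : K) - b) * (eval w U * eval w V) = 0 := by linear_combination -e4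
  rcases mul_eq_zero.mp e5 with h0 | h0
  · exact_mod_cast sub_eq_zero.mp h0
  · exact absurd h0 (mul_ne_zero hU' hV')

/-- The quadratic polynomial `a + 2 b X + c X²`. -/
def quadPoly (a b c : ℝ) : Polynomial ℝ :=
  Polynomial.C a + Polynomial.C (2 * b) * Polynomial.X + Polynomial.C c * Polynomial.X ^ 2

lemma quadPoly_eval (a b c t : ℝ) : (quadPoly a b c).eval t = a + 2 * b * t + c * t ^ 2 := by
  simp [quadPoly]

lemma quad_pos {a b c : ℝ} (ha : 0 < a) (hd : 0 < a * c - b ^ 2) (t : ℝ) :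
    0 < a + 2 * b * t + c * t ^ 2 := by
  have : a * (a + 2 * b * t + c * t ^ 2) = (a + b * t) ^ 2 + (a * c - b ^ 2) * t ^ 2 := by ring
  by_contra hneg
  have h1 : (a + b * t) ^ 2 + (a * c - b ^ 2) * t ^ 2 ≤ 0 := by
    rw [← this]; exact mul_nonpos_of_nonneg_of_nonpos ha.le (not_lt.mp hneg)
  have h2 : t = 0 := by
    by_contra ht
    have : 0 < t ^ 2 := by positivity
    nlinarith [sq_nonneg (a + b * t), mul_pos hd this]
  subst h2
  simp at hneg
  linarith

/-- The root in the upper half-plane of a definite quadratic polynomial, and its conjugate. -/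
lemma quadPoly_map_factor {a b c : ℝ} (hc : c ≠ 0) (hd : 0 < a * c - b ^ 2) :
    ∃ w : ℂ, 0 < w.im ∧ w.re = - b / c ∧ w.im = √(a * c - b ^ 2) / |c| ∧
      (quadPoly a b c).map (algebraMap ℝ ℂ) = Polynomial.C (c : ℂ) *
        ((Polynomial.X - Polynomial.C w) * (Polynomial.X - Polynomial.C (starRingEnd ℂ w))) := by
  have hs : 0 < √(a * c - b ^ 2) := Real.sqrt_pos.mpr hd
  have hc' : 0 < |c| := abs_pos.mpr hc
  refine ⟨⟨- b / c, √(a * c - b ^ 2) / |c|⟩, by positivity, rfl, rfl, ?_⟩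
  have e : (Polynomial.X - Polynomial.C (⟨- b / c, √(a * c - b ^ 2) / |c|⟩ : ℂ)) *
      (Polynomial.X - Polynomial.C (starRingEnd ℂ ⟨- b / c, √(a * c - b ^ 2) / |c|⟩)) =
      Polynomial.C ((a / c : ℝ) : ℂ) + Polynomial.C ((2 * b / c : ℝ) : ℂ) * Polynomial.X +
        Polynomial.X ^ 2 := by
    have h1 : (⟨- b / c, √(a * c - b ^ 2) / |c|⟩ : ℂ) +
        starRingEnd ℂ ⟨- b / c, √(a * c - b ^ 2) / |c|⟩ = ((-(2 * b / c) : ℝ) : ℂ) := by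
      rw [Complex.add_conj]; push_cast; ring
    have h2 : (⟨- b / c, √(a * c - b ^ 2) / |c|⟩ : ℂ) *
        starRingEnd ℂ ⟨- b / c, √(a * c - b ^ 2) / |c|⟩ = ((a / c : ℝ) : ℂ) := by
      rw [Complex.mul_conj, Complex.normSq_mk]
      congr 1
      have : √(a * c - b ^ 2) / |c| * (√(a * c - b ^ 2) / |c|) = (a * c - b ^ 2) / c ^ 2 := by
        rw [div_mul_div_comm, Real.mul_self_sqrt hd.le, abs_mul_abs_self, ← pow_two c]
      rw [this]
      field_simp
      ring
    rw [← h2, show (((2 * b / c : ℝ)) : ℂ) = -((-(2 * b / c) : ℝ) : ℂ) by push_cast; ring, ← h1]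
    simp only [map_mul, map_neg, map_add]
    ring
  rw [e, quadPoly]
  simp only [Polynomial.map_add, Polynomial.map_mul, Polynomial.map_pow, Polynomial.map_C,
    Polynomial.map_X, Complex.coe_algebraMap, mul_add, ← mul_assoc, ← Polynomial.C_mul,
    ← Complex.ofReal_mul, mul_div_cancel₀ _ hc]

open Polynomial in
lemma rootMultiplicity_quadPoly {a b c : ℝ} (hc : c ≠ 0) {w : ℂ} (hw : 0 < w.im)
    (hf : (quadPoly a b c).map (algebraMap ℝ ℂ) = C (c : ℂ) *
        ((X - C w) * (X - C (starRingEnd ℂ w)))) {z : ℂ} (hz : 0 < z.im) :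
    rootMultiplicity z ((quadPoly a b c).map (algebraMap ℝ ℂ)) = if z = w then 1 else 0 := by
  have hc' : (c : ℂ) ≠ 0 := by exact_mod_cast hc
  have n1 : C (c : ℂ) * ((X - C w) * (X - C (starRingEnd ℂ w))) ≠ 0 :=
    mul_ne_zero (C_ne_zero.mpr hc') (mul_ne_zero (X_sub_C_ne_zero _) (X_sub_C_ne_zero _))
  have hzw : z ≠ starRingEnd ℂ w := fun h => by
    have := congrArg Complex.im h
    rw [Complex.conj_im] at this
    linarith
  rw [hf, rootMultiplicity_mul n1, rootMultiplicity_mul (right_ne_zero_of_mul n1),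
    rootMultiplicity_C, rootMultiplicity_X_sub_C, rootMultiplicity_X_sub_C, if_neg hzw, zero_add,
    add_zero]

open Polynomial in
/-- If `p` and `r` are polynomials and `q₁`, `q₂` are definite quadratic polynomials that are not
proportional, then `p √q₁` and `r √q₂` have the same logarithmic derivative only if `p` or `r`
vanishes: otherwise `p² q₁` and `r² q₂` would vanish to the same order at the nonreal root of `q₁`,
but one of these orders is odd and the other one is even. -/
lemma eq_zero_of_logDeriv_eq {a₁ b₁ c₁ a₂ b₂ c₂ : ℝ} (ha₁ : 0 < a₁) (ha₂ : 0 < a₂)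
    (hd₁ : 0 < a₁ * c₁ - b₁ ^ 2)
    (hd₂ : 0 < a₂ * c₂ - b₂ ^ 2)
    (hne : ¬ ∃ r : ℝ, a₁ = r * a₂ ∧ b₁ = r * b₂ ∧ c₁ = r * c₂) {p r : ℝ[X]} (hp : p ≠ 0)
    (h : (p * quadPoly a₁ b₁ c₁) *
        (2 * derivative r * quadPoly a₂ b₂ c₂ + r * derivative (quadPoly a₂ b₂ c₂)) =
      (r * quadPoly a₂ b₂ c₂) *
        (2 * derivative p * quadPoly a₁ b₁ c₁ + p * derivative (quadPoly a₁ b₁ c₁))) :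
    r = 0 := by
  by_contra hr
  have hc₁ : 0 < c₁ := by
    by_contra hneg
    nlinarith [sq_nonneg b₁, mul_nonneg ha₁.le (neg_nonneg.mpr (not_lt.mp hneg))]
  have hc₂ : 0 < c₂ := by
    by_contra hneg
    nlinarith [sq_nonneg b₂, mul_nonneg ha₂.le (neg_nonneg.mpr (not_lt.mp hneg))]
  obtain ⟨w₁, hw₁, re₁, im₁, hf₁⟩ := quadPoly_map_factor hc₁.ne' hd₁
  obtain ⟨w₂, hw₂, re₂, im₂, hf₂⟩ := quadPoly_map_factor hc₂.ne' hd₂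
  have hw : w₁ ≠ w₂ := by
    intro e
    apply hne
    have e1 : b₁ / c₁ = b₂ / c₂ := by
      have := re₁.symm.trans ((congrArg Complex.re e).trans re₂)
      rw [neg_div, neg_div] at this
      linarith
    have e2 : (a₁ * c₁ - b₁ ^ 2) / c₁ ^ 2 = (a₂ * c₂ - b₂ ^ 2) / c₂ ^ 2 := by
      have := im₁.symm.trans ((congrArg Complex.im e).trans im₂)
      have h2 := congrArg (· ^ 2) this
      simpa only [div_pow, Real.sq_sqrt hd₁.le, Real.sq_sqrt hd₂.le, sq_abs] using h2
    have e3 : a₁ / c₁ = a₂ / c₂ := by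
      have h1 : (a₁ * c₁ - b₁ ^ 2) / c₁ ^ 2 = a₁ / c₁ - (b₁ / c₁) ^ 2 := by
        field_simp
      have h2 : (a₂ * c₂ - b₂ ^ 2) / c₂ ^ 2 = a₂ / c₂ - (b₂ / c₂) ^ 2 := by
        field_simp
      rw [h1, h2, e1] at e2
      linarith
    refine ⟨c₁ / c₂, ?_, ?_, ?_⟩
    · field_simp at e3 ⊢; linarith
    · field_simp at e1 ⊢; linarith
    · field_simp
  set Q₁ := (quadPoly a₁ b₁ c₁).map (algebraMap ℝ ℂ) with hQ₁
  set Q₂ := (quadPoly a₂ b₂ c₂).map (algebraMap ℝ ℂ) with hQ₂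
  have q₁0 : Q₁ ≠ 0 := by
    rw [hf₁]
    exact mul_ne_zero (C_ne_zero.mpr (by exact_mod_cast hc₁.ne'))
      (mul_ne_zero (X_sub_C_ne_zero _) (X_sub_C_ne_zero _))
  have q₂0 : Q₂ ≠ 0 := by
    rw [hf₂]
    exact mul_ne_zero (C_ne_zero.mpr (by exact_mod_cast hc₂.ne'))
      (mul_ne_zero (X_sub_C_ne_zero _) (X_sub_C_ne_zero _))
  set P := p.map (algebraMap ℝ ℂ) with hP
  set R := r.map (algebraMap ℝ ℂ) with hR
  have P0 : P ≠ 0 := (Polynomial.map_ne_zero_iff (algebraMap ℝ ℂ).injective).mpr hp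
  have R0 : R ≠ 0 := (Polynomial.map_ne_zero_iff (algebraMap ℝ ℂ).injective).mpr hr
  have hm := congrArg (Polynomial.map (algebraMap ℝ ℂ)) h
  simp only [Polynomial.map_mul, Polynomial.map_add, ← derivative_map, Polynomial.map_ofNat,
    ← hQ₁, ← hQ₂, ← hP, ← hR] at hm
  have key := rootMultiplicity_eq_of_mul_derivative_eq (u := P ^ 2 * Q₁) (v := R ^ 2 * Q₂)
    (mul_ne_zero (pow_ne_zero 2 P0) q₁0) (mul_ne_zero (pow_ne_zero 2 R0) q₂0) (by
      simp only [derivative_mul, derivative_pow, Nat.cast_ofNat, pow_one, Nat.reduceSub, map_ofNat]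
      linear_combination (P * R) * hm) w₁
  rw [rootMultiplicity_mul (mul_ne_zero (pow_ne_zero 2 P0) q₁0),
    rootMultiplicity_mul (mul_ne_zero (pow_ne_zero 2 R0) q₂0), pow_two, pow_two,
    rootMultiplicity_mul (mul_ne_zero P0 P0), rootMultiplicity_mul (mul_ne_zero R0 R0),
    rootMultiplicity_quadPoly hc₁.ne' hw₁ hf₁ hw₁, rootMultiplicity_quadPoly hc₂.ne' hw₂ hf₂ hw₁,
    if_pos rfl, if_neg hw] at key
  omega

open Polynomial in
/-- Square roots of pairwise nonproportional definite quadratic polynomials are linearly independent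
over the polynomials. -/
lemma polynomial_sqrt_indep {ι : Type*} (a b c : ι → ℝ) (ha : ∀ i, 0 < a i)
    (hd : ∀ i, 0 < a i * c i - b i ^ 2)
    (hne : ∀ i j, i ≠ j → ¬ ∃ r : ℝ, a i = r * a j ∧ b i = r * b j ∧ c i = r * c j)
    (s : Finset ι) : ∀ p : ι → ℝ[X],
    (∀ t : ℝ, ∑ i ∈ s, (p i).eval t * √(a i + 2 * b i * t + c i * t ^ 2) = 0) →
    ∀ i ∈ s, p i = 0 := by
  classical
  induction s using Finset.induction_on with
  | empty => simp
  | insert i s hi ih =>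
    intro p hp
    set q : ι → ℝ[X] := fun j => quadPoly (a j) (b j) (c j) with hq
    have hqe : ∀ j t, (q j).eval t = a j + 2 * b j * t + c j * t ^ 2 := fun j t =>
      quadPoly_eval _ _ _ _
    have hqp : ∀ j t, 0 < (q j).eval t := fun j t => by
      rw [hqe]; exact quad_pos (ha j) (hd j) t
    have hp' : ∀ t : ℝ, ∑ j ∈ insert i s, (p j).eval t * √((q j).eval t) = 0 := by
      simpa only [hqe] using hp
    have ih' : ∀ r : ι → ℝ[X], (∀ t : ℝ, ∑ j ∈ s, (r j).eval t * √((q j).eval t) = 0) →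
        ∀ j ∈ s, r j = 0 := by
      simpa only [hqe] using ih
    -- `e j` is a common multiple of the logarithmic derivatives of the terms
    set e : ι → ℝ[X] := fun j => (2 * derivative (p j) * q j + p j * derivative (q j)) *
      ∏ k ∈ (insert i s).erase j, q k with he
    have hder : ∀ t : ℝ, ∑ j ∈ insert i s, (e j).eval t * √((q j).eval t) = 0 := by
      intro t
      have h1 : HasDerivAt (fun t => ∑ j ∈ insert i s, (p j).eval t * √((q j).eval t))
          (∑ j ∈ insert i s, ((derivative (p j)).eval t * √((q j).eval t) +
            (p j).eval t * ((derivative (q j)).eval t / (2 * √((q j).eval t))))) t :=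
        HasDerivAt.fun_sum fun j _ =>
          ((p j).hasDerivAt t).mul (((q j).hasDerivAt t).sqrt (hqp j t).ne')
      have h2 : ∑ j ∈ insert i s, ((derivative (p j)).eval t * √((q j).eval t) +
            (p j).eval t * ((derivative (q j)).eval t / (2 * √((q j).eval t)))) = 0 := by
        refine h1.unique ?_
        rw [show (fun t => ∑ j ∈ insert i s, (p j).eval t * √((q j).eval t)) = fun _ => 0 from
          funext hp']
        exact hasDerivAt_const t 0
      have h3 : ∑ j ∈ insert i s, (e j).eval t * √((q j).eval t) =
          2 * (∏ k ∈ insert i s, (q k).eval t) *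
          ∑ j ∈ insert i s, ((derivative (p j)).eval t * √((q j).eval t) +
            (p j).eval t * ((derivative (q j)).eval t / (2 * √((q j).eval t)))) := by
        rw [Finset.mul_sum]
        refine Finset.sum_congr rfl fun j hj => ?_
        rw [← Finset.mul_prod_erase _ _ hj]
        simp only [he, eval_mul, eval_add, eval_prod, eval_ofNat]
        have hs := Real.sqrt_pos.mpr (hqp j t)
        have hs2 := Real.sq_sqrt (hqp j t).le
        set S := √((q j).eval t)
        rw [← hs2]
        field_simp
      rw [h3, h2, mul_zero]
    have hpi : p i = 0 := by
      by_contra hpi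
      have h4 := ih' (fun j => p i * e j - e i * p j) (by
        intro t
        have h1 := hp' t
        have h2 := hder t
        rw [Finset.sum_insert hi] at h1 h2
        have h5 : ∑ j ∈ s, (p i * e j - e i * p j).eval t * √((q j).eval t) =
            (p i).eval t * (∑ j ∈ s, (e j).eval t * √((q j).eval t)) -
            (e i).eval t * ∑ j ∈ s, (p j).eval t * √((q j).eval t) := by
          rw [Finset.mul_sum, Finset.mul_sum, ← Finset.sum_sub_distrib]
          refine Finset.sum_congr rfl fun j _ => ?_
          simp only [eval_sub, eval_mul]
          ring
        rw [h5]
        linear_combination (p i).eval t * h2 - (e i).eval t * h1)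
      have h6 : ∀ j ∈ s, p j = 0 := by
        intro j hj
        have hij : i ≠ j := fun h => hi (h ▸ hj)
        refine eq_zero_of_logDeriv_eq (ha i) (ha j) (hd i) (hd j) (hne i j hij) hpi ?_
        have h7 := h4 j hj
        have hqn : ∀ k, q k ≠ 0 := fun k h => by
          have := hqp k 0
          rw [h, eval_zero] at this
          exact lt_irrefl _ this
        have hji : j ∈ (insert i s).erase i :=
          Finset.mem_erase.mpr ⟨hij.symm, Finset.mem_insert_of_mem hj⟩
        have hii : i ∈ (insert i s).erase j :=
          Finset.mem_erase.mpr ⟨hij, Finset.mem_insert_self _ _⟩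
        have hT : ∏ k ∈ ((insert i s).erase i).erase j, q k ≠ 0 :=
          Finset.prod_ne_zero_iff.mpr fun k _ => hqn k
        apply mul_right_cancel₀ hT
        simp only [he] at h7
        rw [← Finset.mul_prod_erase _ _ hji, ← Finset.mul_prod_erase _ _ hii,
          Finset.erase_right_comm (a := j)] at h7
        linear_combination h7
      have h8 : ∀ t, (p i).eval t = 0 := by
        intro t
        have h1 := hp' t
        rw [Finset.sum_insert hi, Finset.sum_eq_zero (fun j hj => by rw [h6 j hj]; simp),
          add_zero] at h1
        exact (mul_eq_zero.mp h1).resolve_right (Real.sqrt_pos.mpr (hqp i t)).ne'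
      exact hpi (Polynomial.funext fun t => by rw [h8, eval_zero])
    intro j hj
    rcases Finset.mem_insert.mp hj with rfl | hj
    · exact hpi
    · refine ih' p (fun t => ?_) j hj
      have h1 := hp' t
      rwa [Finset.sum_insert hi, hpi, eval_zero, zero_mul, zero_add] at h1

/-- Square roots of pairwise nonproportional definite quadratic polynomials are linearly
independent. -/
lemma sqrt_quad_indep {ι : Type*} [Fintype ι] (a b c : ι → ℝ) (ha : ∀ i, 0 < a i)
    (hd : ∀ i, 0 < a i * c i - b i ^ 2)
    (hne : ∀ i j, i ≠ j → ¬ ∃ r : ℝ, a i = r * a j ∧ b i = r * b j ∧ c i = r * c j) (m : ι → ℝ)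
    (h : ∀ t : ℝ, ∑ i, m i * √(a i + 2 * b i * t + c i * t ^ 2) = 0) (i : ι) : m i = 0 := by
  have := polynomial_sqrt_indep a b c ha hd hne Finset.univ (fun i => Polynomial.C (m i))
    (by simpa using h) i (Finset.mem_univ i)
  simpa using this

/-! ### Support functions -/

lemma norm_circ (θ : ℝ) : ‖(circ θ : Plane)‖ = 1 := by simp

lemma inner_plane (x y : Plane) : inner ℝ x y = x 0 * y 0 + x 1 * y 1 := by
  simp [PiLp.inner_apply, Fin.sum_univ_two]
  ring

lemma norm_sq_plane (x : Plane) : ‖x‖ ^ 2 = x 0 ^ 2 + x 1 ^ 2 := by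
  rw [EuclideanSpace.norm_sq_eq]
  simp [Fin.sum_univ_two]

lemma circ_zero_apply (θ : ℝ) : (circ θ : Plane) 0 = Real.cos θ := by simp [circ]

lemma circ_one_apply (θ : ℝ) : (circ θ : Plane) 1 = Real.sin θ := by simp [circ]

lemma inner_circ (θ : ℝ) (p : Plane) :
    inner ℝ (circ θ : Plane) p = Real.cos θ * p 0 + Real.sin θ * p 1 := by
  rw [inner_plane, circ_zero_apply, circ_one_apply]

lemma circ_periodic : Function.Periodic circ (2 * π) := by
  intro θ
  rw [two_mul, ← add_assoc, circ_add_pi, circ_add_pi, neg_neg]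

lemma norm_circ_sub_le (s t : ℝ) : ‖(circ s : Plane) - circ t‖ ≤ |s - t| := by
  apply abs_le_of_sq_le_sq' _ (abs_nonneg _) |>.2
  rw [norm_sq_plane, sq_abs]
  simp only [PiLp.sub_apply, circ_zero_apply, circ_one_apply]
  have h1 := Real.one_sub_sq_div_two_le_cos (x := s - t)
  rw [Real.cos_sub] at h1
  nlinarith [Real.sin_sq_add_cos_sq s, Real.sin_sq_add_cos_sq t]

/-- Even Lipschitz functions belong to the Sobolev space. -/
lemma mem_H1even_of_lipschitz {h : S1 → ℝ} (he : ∀ x, h (-x) = h x) {C : NNReal}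
    (hl : LipschitzWith C (ang h)) : h ∈ H1even := by
  refine ⟨he, (hl.lipschitzOnWith (s := uIcc 0 (2 * π))).absolutelyContinuousOnInterval, ?_⟩
  refine MemLp.of_bound (measurable_deriv _).aestronglyMeasurable C
    (Filter.Eventually.of_forall fun θ => ?_)
  exact norm_deriv_le_of_lipschitz hl

section Supp

variable {K L : Set Plane}

lemma bddAbove_inner (hb : Bornology.IsBounded K) (x : Plane) :
    BddAbove ((fun k => inner ℝ x k) '' K) := by
  obtain ⟨R, hR⟩ := hb.exists_norm_le
  refine ⟨‖x‖ * R, ?_⟩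
  rintro _ ⟨k, hk, rfl⟩
  exact (real_inner_le_norm x k).trans (mul_le_mul_of_nonneg_left (hR k hk) (norm_nonneg x))

lemma inner_le_supp (hb : Bornology.IsBounded K) {k : Plane} (hk : k ∈ K) (x : S1) :
    inner ℝ (x : Plane) k ≤ supp K x :=
  le_csSup (bddAbove_inner hb x) ⟨k, hk, rfl⟩

lemma supp_le (hn : K.Nonempty) {x : S1} {c : ℝ} (h : ∀ k ∈ K, inner ℝ (x : Plane) k ≤ c) :
    supp K x ≤ c := by
  apply csSup_le (hn.image _)
  rintro _ ⟨k, hk, rfl⟩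
  exact h k hk

lemma exists_inner_eq_supp (hc : IsCompact K) (hn : K.Nonempty) (x : S1) :
    ∃ k ∈ K, inner ℝ (x : Plane) k = supp K x := by
  obtain ⟨k, hk, e, -⟩ := hc.exists_sSup_image_eq_and_ge hn
    (f := fun k => inner ℝ (x : Plane) k) (by fun_prop)
  exact ⟨k, hk, e.symm⟩

lemma supp_neg (hs : ∀ k ∈ K, -k ∈ K) (x : S1) : supp K (-x) = supp K x := by
  unfold supp
  congr 1
  ext r
  constructor
  · rintro ⟨k, hk, rfl⟩
    exact ⟨-k, hs k hk, by simp⟩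
  · rintro ⟨k, hk, rfl⟩
    exact ⟨-k, hs k hk, by simp⟩

lemma supp_mono (hb : Bornology.IsBounded L) (hn : K.Nonempty) (h : K ⊆ L) (x : S1) :
    supp K x ≤ supp L x :=
  supp_le hn fun _ hk => inner_le_supp hb (h hk) x

lemma lipschitz_supp (hn : K.Nonempty) {R : NNReal} (hR : ∀ k ∈ K, ‖k‖ ≤ R) :
    LipschitzWith R (ang (supp K)) := by
  have hb : Bornology.IsBounded K := isBounded_iff_forall_norm_le.mpr ⟨R, hR⟩
  apply LipschitzWith.of_le_add_mul
  intro s t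
  refine supp_le hn fun k hk => ?_
  have h1 := inner_le_supp hb hk (circ t)
  have h2 : inner ℝ ((circ s : Plane) - circ t) k ≤ R * dist s t := by
    refine (real_inner_le_norm _ _).trans ?_
    rw [mul_comm, Real.dist_eq]
    exact mul_le_mul (hR k hk) (norm_circ_sub_le s t) (norm_nonneg _) R.2
  rw [inner_sub_left] at h2
  change _ ≤ supp K (circ t) + _
  linarith

lemma exists_lipschitz_supp (hb : Bornology.IsBounded K) (hn : K.Nonempty) :
    ∃ R : NNReal, LipschitzWith R (ang (supp K)) := by
  obtain ⟨R, hR⟩ := hb.exists_norm_le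
  exact ⟨⟨max R 0, le_max_right _ _⟩, lipschitz_supp hn fun k hk =>
    (hR k hk).trans (le_max_left _ _)⟩

/-- The support function of a nonempty bounded symmetric set, as an element of the Sobolev space. -/
def suppH1 (K : Set Plane) (hb : Bornology.IsBounded K) (hn : K.Nonempty)
    (hs : ∀ k ∈ K, -k ∈ K) : H1even :=
  ⟨supp K, mem_H1even_of_lipschitz (supp_neg hs) (exists_lipschitz_supp hb hn).choose_spec⟩

lemma supp_add (hbK : Bornology.IsBounded K) (hnK : K.Nonempty) (hbL : Bornology.IsBounded L)
    (hnL : L.Nonempty) : supp (K + L) = supp K + supp L := by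
  funext x
  simp only [Pi.add_apply, supp]
  rw [← csSup_add (hnK.image _) (bddAbove_inner hbK x) (hnL.image _) (bddAbove_inner hbL x)]
  congr 1
  ext r
  constructor
  · rintro ⟨_, ⟨k, hk, l, hl, rfl⟩, rfl⟩
    exact ⟨_, ⟨k, hk, rfl⟩, _, ⟨l, hl, rfl⟩, (inner_add_right _ _ _).symm⟩
  · rintro ⟨_, ⟨k, hk, rfl⟩, _, ⟨l, hl, rfl⟩, rfl⟩
    exact ⟨k + l, ⟨k, hk, l, hl, rfl⟩, inner_add_right _ _ _⟩

lemma supp_sum {ι : Type*} (s : Finset ι) (E : ι → Set Plane)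
    (hb : ∀ i, Bornology.IsBounded (E i)) (hn : ∀ i, (E i).Nonempty) :
    supp (∑ i ∈ s, E i) = ∑ i ∈ s, supp (E i) := by
  classical
  have key : Bornology.IsBounded (∑ i ∈ s, E i) ∧ (∑ i ∈ s, E i).Nonempty ∧
      supp (∑ i ∈ s, E i) = ∑ i ∈ s, supp (E i) := by
    induction s using Finset.induction_on with
    | empty =>
      rw [Finset.sum_empty]
      refine ⟨Bornology.isBounded_singleton, singleton_nonempty _, ?_⟩
      funext x
      simp [supp]
    | insert i s hi ih =>
      rw [Finset.sum_insert hi, Finset.sum_insert hi]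
      exact ⟨(hb i).add ih.1, (hn i).add ih.2.1,
        by rw [supp_add (hb i) (hn i) ih.1 ih.2.1, ih.2.2]⟩
  exact key.2.2

lemma supp_smul {c : ℝ} (hc : 0 ≤ c) (x : S1) : supp (c • K) x = c * supp K x := by
  unfold supp
  rw [← smul_eq_mul, ← Real.sSup_smul_of_nonneg hc]
  congr 1
  ext r
  constructor
  · rintro ⟨_, ⟨k, hk, rfl⟩, rfl⟩
    exact ⟨_, ⟨k, hk, rfl⟩, (inner_smul_right _ _ _).symm⟩
  · rintro ⟨_, ⟨k, hk, rfl⟩, rfl⟩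
    exact ⟨c • k, ⟨k, hk, rfl⟩, inner_smul_right _ _ _⟩

lemma isGreatest_inner_disc (y : Plane) : IsGreatest ((fun k => inner ℝ y k) '' disc) ‖y‖ := by
  constructor
  · refine ⟨‖y‖⁻¹ • y, ?_, ?_⟩
    · rw [disc, mem_closedBall_zero_iff, norm_smul, norm_inv, norm_norm]
      exact inv_mul_le_one
    · change inner ℝ y (‖y‖⁻¹ • y) = ‖y‖
      rw [inner_smul_right, real_inner_self_eq_norm_sq]
      rcases eq_or_ne ‖y‖ 0 with h | h
      · simp [h]
      · field_simp
  · rintro _ ⟨k, hk, rfl⟩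
    rw [disc, mem_closedBall_zero_iff] at hk
    exact (real_inner_le_norm y k).trans (mul_le_of_le_one_right (norm_nonneg y) hk)

lemma supp_disc (x : S1) : supp disc x = 1 := by
  rw [supp, (isGreatest_inner_disc x).csSup_eq]
  simp

lemma inner_act (M : Matrix (Fin 2) (Fin 2) ℝ) (x y : Plane) :
    inner ℝ x (act M y) = inner ℝ (act M.transpose x) y := by
  simp only [inner_plane, act, Matrix.toLpLin_apply, Matrix.mulVec, dotProduct,
    Fin.sum_univ_two, Matrix.transpose_apply]
  ring

lemma act_apply_zero (M : Matrix (Fin 2) (Fin 2) ℝ) (x : Plane) :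
    act M x 0 = M 0 0 * x 0 + M 0 1 * x 1 := by
  simp [act, Matrix.toLpLin_apply]

lemma act_apply_one (M : Matrix (Fin 2) (Fin 2) ℝ) (x : Plane) :
    act M x 1 = M 1 0 * x 0 + M 1 1 * x 1 := by
  simp [act, Matrix.toLpLin_apply]

lemma supp_affine_disc (M : Matrix (Fin 2) (Fin 2) ℝ) (c : Plane) (x : S1) :
    supp ((fun y => act M y + c) '' disc) x = ‖act M.transpose x‖ + inner ℝ (x : Plane) c := by
  have h := isGreatest_inner_disc (act M.transpose x)
  apply IsGreatest.csSup_eq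
  constructor
  · obtain ⟨k, hk, e⟩ := h.1
    refine ⟨_, ⟨k, hk, rfl⟩, ?_⟩
    change inner ℝ (x : Plane) (act M k + c) = _
    rw [inner_add_right, inner_act, ← e]
  · rintro _ ⟨_, ⟨k, hk, rfl⟩, rfl⟩
    change inner ℝ (x : Plane) (act M k + c) ≤ _
    rw [inner_add_right, inner_act]
    have := h.2 ⟨k, hk, rfl⟩
    simp only at this
    linarith

lemma supp_act_disc (M : Matrix (Fin 2) (Fin 2) ℝ) (x : S1) :
    supp (act M '' disc) x = ‖act M.transpose x‖ := by
  have := supp_affine_disc M 0 x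
  simpa using this

lemma supp_act (g : SL(2, ℝ)) : supp (act (g : Matrix (Fin 2) (Fin 2) ℝ) '' K) =
    rhoFun g (supp K) := by
  funext x
  have hpos : 0 < ‖act (g : Matrix (Fin 2) (Fin 2) ℝ).transpose x‖ := norm_pos_iff.mpr
    (act_transpose_ne g (S1.ne_zero x))
  rw [rhoFun]
  unfold supp
  rw [← smul_eq_mul, ← Real.sSup_smul_of_nonneg hpos.le]
  congr 1
  have hi : ∀ k, inner ℝ (x : Plane) (act (g : Matrix (Fin 2) (Fin 2) ℝ) k) =
      ‖act (g : Matrix (Fin 2) (Fin 2) ℝ).transpose x‖ • inner ℝ (circAct g x : Plane) k := by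
    intro k
    rw [inner_act, circAct, inner_smul_left, RCLike.conj_to_real, smul_eq_mul, ← mul_assoc,
      mul_inv_cancel₀ hpos.ne', one_mul]
  ext r
  constructor
  · rintro ⟨_, ⟨k, hk, rfl⟩, rfl⟩
    exact ⟨_, ⟨k, hk, rfl⟩, (hi k).symm⟩
  · rintro ⟨_, ⟨k, hk, rfl⟩, rfl⟩
    exact ⟨_, ⟨k, hk, rfl⟩, hi k⟩

/-- A compact convex set is the intersection of its supporting half-planes. -/
lemma mem_iff_inner_le_supp (hc : IsCompact K) (hcv : Convex ℝ K) (hn : K.Nonempty) (p : Plane) :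
    p ∈ K ↔ ∀ x : S1, inner ℝ (x : Plane) p ≤ supp K x := by
  refine ⟨fun hp x => inner_le_supp hc.isBounded hp x, fun h => ?_⟩
  by_contra hp
  obtain ⟨f, u, hu, hpu⟩ := geometric_hahn_banach_closed_point hcv hc.isClosed hp
  set y : Plane := (InnerProductSpace.toDual ℝ Plane).symm f with hy
  have hf : ∀ z, f z = inner ℝ y z := fun z => by
    rw [hy, InnerProductSpace.toDual_symm_apply]
  have hy0 : y ≠ 0 := by
    intro h0
    obtain ⟨k, hk⟩ := hn
    have h1 := hu k hk
    rw [hf, h0, inner_zero_left] at h1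
    rw [hf, h0, inner_zero_left] at hpu
    linarith
  have hpos : 0 < ‖y‖ := norm_pos_iff.mpr hy0
  let x : S1 := ⟨‖y‖⁻¹ • y, by
    rw [mem_sphere_iff_norm, sub_zero, norm_smul, norm_inv, norm_norm, inv_mul_cancel₀ hpos.ne']⟩
  have hx : ∀ z, inner ℝ (x : Plane) z = ‖y‖⁻¹ * f z := fun z => by
    rw [hf, inner_smul_left, RCLike.conj_to_real]
  have h1 : supp K x ≤ ‖y‖⁻¹ * u := supp_le hn fun k hk => by
    rw [hx]
    exact mul_le_mul_of_nonneg_left (hu k hk).le (by positivity)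
  have h2 := h x
  rw [hx] at h2
  have h3 : ‖y‖⁻¹ * u < ‖y‖⁻¹ * f p := mul_lt_mul_of_pos_left hpu (by positivity)
  linarith

lemma subset_iff_supp_le (hK : Bornology.IsBounded K) (hKn : K.Nonempty) (hc : IsCompact L)
    (hcv : Convex ℝ L) (hn : L.Nonempty) : K ⊆ L ↔ ∀ x, supp K x ≤ supp L x := by
  refine ⟨fun h x => supp_mono hc.isBounded hKn h x, fun h p hp => ?_⟩
  rw [mem_iff_inner_le_supp hc hcv hn]
  exact fun x => (inner_le_supp hK hp x).trans (h x)

/-- Where the support function is differentiable, its derivative is the tangential coordinate of the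
support point. -/
lemma tangential_eq_deriv_supp (hb : Bornology.IsBounded K) {p : Plane} (hp : p ∈ K) {θ h' : ℝ}
    (hd : HasDerivAt (ang (supp K)) h' θ) (he : inner ℝ (circ θ : Plane) p = supp K (circ θ)) :
    - Real.sin θ * p 0 + Real.cos θ * p 1 = h' := by
  have hmin : IsLocalMin (fun t => ang (supp K) t - (Real.cos t * p 0 + Real.sin t * p 1)) θ := by
    refine Filter.Eventually.of_forall fun t => ?_
    have h1 := inner_le_supp hb hp (circ t)
    rw [inner_circ] at h1 he
    simp only [ang]
    linarith
  have := hmin.hasDerivAt_eq_zero (hd.sub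
    (((Real.hasDerivAt_cos θ).mul_const (p 0)).add ((Real.hasDerivAt_sin θ).mul_const (p 1))))
  linarith

end Supp

/-! ### The area of a convex body -/

/-- The point at signed distance `s` from the foot of the perpendicular on the line
`⟨x, circ θ⟩ = h θ`, for `(θ, s)` in the plane. When `h` is a support function, these lines are the
supporting lines of a convex body. -/
def tangentMap (h : ℝ → ℝ) (z : ℝ × ℝ) : ℝ × ℝ :=
  (h z.1 * Real.cos z.1 - z.2 * Real.sin z.1, h z.1 * Real.sin z.1 + z.2 * Real.cos z.1)

/-- The parameters of the half-tangents that leave the body counterclockwise, up to the circle of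
radius `R`; only differentiability points of `h` are kept. -/
def tangentRegion (h : ℝ → ℝ) (R : ℝ) : Set (ℝ × ℝ) :=
  {z | z.1 ∈ Ioc 0 (2 * π) ∧ DifferentiableAt ℝ h z.1 ∧ deriv h z.1 < z.2 ∧
    h z.1 ^ 2 + z.2 ^ 2 < R ^ 2}

/-- A planar set, in `ℝ × ℝ`. -/
def planar (K : Set Plane) : Set (ℝ × ℝ) := {z | !₂[z.1, z.2] ∈ K}

lemma volume_planar (K : Set Plane) : volume (planar K) = volume K := by
  have h1 : MeasurePreserving ((MeasurableEquiv.toLp 2 (Fin 2 → ℝ)).symm.trans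
      (MeasurableEquiv.finTwoArrow (α := ℝ))) volume volume :=
    (volume_preserving_finTwoArrow ℝ).comp
      (EuclideanSpace.volume_preserving_symm_measurableEquiv_toLp (Fin 2))
  have h2 := h1.symm.measure_preimage_equiv K
  rw [← h2]
  congr 1

lemma tangentMap_lipschitz {h : ℝ → ℝ} {C : NNReal} (hC : LipschitzWith C h) {R : NNReal}
    (hR : ∀ t, |h t| ≤ R) :
    LipschitzOnWith (C + 2 * R + 1) (tangentMap h) (univ ×ˢ Icc (-R : ℝ) R) := by
  apply LipschitzOnWith.of_dist_le_mul
  rintro ⟨a, s⟩ ⟨-, hs⟩ ⟨b, t⟩ ⟨-, ht⟩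
  set d := dist (a, s) (b, t) with hd
  have d1 : |a - b| ≤ d := by
    rw [hd, Prod.dist_eq]; exact le_max_left _ _
  have d2 : |s - t| ≤ d := by
    rw [hd, Prod.dist_eq]; exact le_max_right _ _
  have hd0 : 0 ≤ d := dist_nonneg
  have hh : |h a - h b| ≤ C * d :=
    (hC.dist_le_mul a b).trans (mul_le_mul_of_nonneg_left d1 C.2)
  have ht' : |t| ≤ R := abs_le.mpr ht
  have hcos : |Real.cos a - Real.cos b| ≤ d := by
    have := Real.lipschitzWith_cos.dist_le_mul a b
    rw [NNReal.coe_one, one_mul] at this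
    exact this.trans d1
  have hsin : |Real.sin a - Real.sin b| ≤ d := by
    have := Real.lipschitzWith_sin.dist_le_mul a b
    rw [NNReal.coe_one, one_mul] at this
    exact this.trans d1
  have key : ∀ f : ℝ → ℝ, (∀ x, |f x| ≤ 1) → |f a - f b| ≤ d → ∀ u v y : ℝ, |v| ≤ R →
      |u - v| ≤ y → |u * f a - v * f b| ≤ y + R * d := by
    intro f hf hfd u v y hv hy
    have e : u * f a - v * f b = (u - v) * f a + v * (f a - f b) := by ring
    rw [e]
    refine (abs_add_le _ _).trans (add_le_add ?_ ?_)
    · rw [abs_mul]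
      exact (mul_le_of_le_one_right (abs_nonneg _) (hf a)).trans hy
    · rw [abs_mul]
      exact mul_le_mul hv hfd (abs_nonneg _) R.2
  have k1 := key Real.cos Real.abs_cos_le_one hcos (h a) (h b) _ (hR b) hh
  have k2 := key Real.sin Real.abs_sin_le_one hsin (h a) (h b) _ (hR b) hh
  have k3 := key Real.cos Real.abs_cos_le_one hcos s t _ ht' d2
  have k4 := key Real.sin Real.abs_sin_le_one hsin s t _ ht' d2
  rw [abs_le] at k1 k2 k3 k4
  rw [Prod.dist_eq]
  push_cast
  apply max_le
  · rw [Real.dist_eq, abs_le]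
    simp only [tangentMap]
    constructor <;> nlinarith
  · rw [Real.dist_eq, abs_le]
    simp only [tangentMap]
    constructor <;> nlinarith

/-- The derivative of `tangentMap`. -/
def fderivTangentMap (h : ℝ → ℝ) (z : ℝ × ℝ) : ℝ × ℝ →L[ℝ] ℝ × ℝ :=
  (Matrix.toLin (.finTwoProd ℝ) (.finTwoProd ℝ)
    !![deriv h z.1 * Real.cos z.1 - h z.1 * Real.sin z.1 - z.2 * Real.cos z.1, - Real.sin z.1;
      deriv h z.1 * Real.sin z.1 + h z.1 * Real.cos z.1 - z.2 * Real.sin z.1,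
      Real.cos z.1]).toContinuousLinearMap

lemma hasFDerivAt_tangentMap {h : ℝ → ℝ} {z : ℝ × ℝ} (hd : DifferentiableAt ℝ h z.1) :
    HasFDerivAt (tangentMap h) (fderivTangentMap h z) z := by
  unfold fderivTangentMap
  rw [Matrix.toLin_finTwoProd_toContinuousLinearMap]
  have h0 : HasFDerivAt (fun z : ℝ × ℝ => h z.1) (deriv h z.1 • ContinuousLinearMap.fst ℝ ℝ ℝ) z :=
    hd.hasDerivAt.comp_hasFDerivAt z hasFDerivAt_fst
  have hc : HasFDerivAt (fun z : ℝ × ℝ => Real.cos z.1)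
      (-Real.sin z.1 • ContinuousLinearMap.fst ℝ ℝ ℝ) z :=
    (Real.hasDerivAt_cos z.1).comp_hasFDerivAt z hasFDerivAt_fst
  have hs : HasFDerivAt (fun z : ℝ × ℝ => Real.sin z.1)
      (Real.cos z.1 • ContinuousLinearMap.fst ℝ ℝ ℝ) z :=
    (Real.hasDerivAt_sin z.1).comp_hasFDerivAt z hasFDerivAt_fst
  have h1 := (h0.mul hc).sub (hasFDerivAt_snd.mul hs)
  have h2 := (h0.mul hs).add (hasFDerivAt_snd.mul hc)
  refine (h1.prodMk h2).congr_fderiv ?_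
  ext <;> simp <;> ring

lemma det_fderivTangentMap (h : ℝ → ℝ) (z : ℝ × ℝ) :
    (fderivTangentMap h z).det = deriv h z.1 - z.2 := by
  unfold fderivTangentMap
  simp only [LinearMap.det_toContinuousLinearMap, LinearMap.det_toLin, Matrix.det_fin_two_of]
  linear_combination (deriv h z.1 - z.2) * Real.cos_sq_add_sin_sq z.1

lemma measurableSet_tangentRegion {h : ℝ → ℝ} (hc : Continuous h) (R : ℝ) :
    MeasurableSet (tangentRegion h R) := by
  have m1 : MeasurableSet {z : ℝ × ℝ | z.1 ∈ Ioc 0 (2 * π)} := measurable_fst measurableSet_Ioc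
  have m2 : MeasurableSet {z : ℝ × ℝ | DifferentiableAt ℝ h z.1} :=
    measurable_fst (measurableSet_of_differentiableAt ℝ h)
  have m3 : MeasurableSet {z : ℝ × ℝ | deriv h z.1 < z.2} :=
    measurableSet_lt ((measurable_deriv h).comp measurable_fst) measurable_snd
  have m4 : MeasurableSet {z : ℝ × ℝ | h z.1 ^ 2 + z.2 ^ 2 < R ^ 2} :=
    measurableSet_lt (((hc.measurable.comp measurable_fst).pow_const 2).add
      (measurable_snd.pow_const 2)) measurable_const
  exact m1.inter (m2.inter (m3.inter m4))

section Body

variable {K : Set Plane}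

lemma exists_support_point (hc : IsCompact K) (hn : K.Nonempty) {θ : ℝ}
    (hd : DifferentiableAt ℝ (ang (supp K)) θ) :
    ∃ k ∈ K, Real.cos θ * k 0 + Real.sin θ * k 1 = ang (supp K) θ ∧
      - Real.sin θ * k 0 + Real.cos θ * k 1 = deriv (ang (supp K)) θ := by
  obtain ⟨k, hk, e⟩ := exists_inner_eq_supp hc hn (circ θ)
  refine ⟨k, hk, ?_, tangential_eq_deriv_supp hc.isBounded hk hd.hasDerivAt e⟩
  rw [← inner_circ, e]; rfl

/-- A point outside the body lies on only one supporting half-line of given orientation. -/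
lemma injOn_tangentMap (hc : IsCompact K) (hn : K.Nonempty) (hpos : ∀ x, 0 < supp K x) (R : ℝ) :
    InjOn (tangentMap (ang (supp K))) (tangentRegion (ang (supp K)) R) := by
  rintro ⟨a, s⟩ ⟨ha, hda, hsa, -⟩ ⟨b, t⟩ ⟨hb, hdb, htb, -⟩ e
  obtain ⟨k, hk, k1, k2⟩ := exists_support_point hc hn hda
  obtain ⟨l, hl, l1, l2⟩ := exists_support_point hc hn hdb
  simp only [tangentMap, Prod.mk.injEq] at e ha hb hsa htb k1 k2 l1 l2
  obtain ⟨e1, e2⟩ := e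
  have pa := hpos (circ a)
  have pb := hpos (circ b)
  have i1 := inner_le_supp hc.isBounded hk (circ b)
  have i2 := inner_le_supp hc.isBounded hl (circ a)
  rw [inner_circ] at i1 i2
  change 0 < ang (supp K) a at pa
  change 0 < ang (supp K) b at pb
  change _ ≤ ang (supp K) b at i1
  change _ ≤ ang (supp K) a at i2
  set f := ang (supp K)
  have ca := Real.sin_sq_add_cos_sq a
  have cb := Real.sin_sq_add_cos_sq b
  have hk0 : k 0 = Real.cos a * f a - Real.sin a * deriv f a := by
    rw [← k1, ← k2]; linear_combination (- k 0) * ca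
  have hk1 : k 1 = Real.sin a * f a + Real.cos a * deriv f a := by
    rw [← k1, ← k2]; linear_combination (- k 1) * ca
  have hl0 : l 0 = Real.cos b * f b - Real.sin b * deriv f b := by
    rw [← l1, ← l2]; linear_combination (- l 0) * cb
  have hl1 : l 1 = Real.sin b * f b + Real.cos b * deriv f b := by
    rw [← l1, ← l2]; linear_combination (- l 1) * cb
  rw [hk0, hk1] at i1
  rw [hl0, hl1] at i2
  have j1 : 0 ≤ (s - deriv f a) * Real.sin (b - a) := by
    rw [Real.sin_sub]
    have : f b = Real.cos b * (f a * Real.cos a - s * Real.sin a) +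
        Real.sin b * (f a * Real.sin a + s * Real.cos a) := by
      rw [e1, e2]; linear_combination (-f b) * cb
    linarith
  have j2 : 0 ≤ (t - deriv f b) * Real.sin (a - b) := by
    rw [Real.sin_sub]
    have : f a = Real.cos a * (f b * Real.cos b - t * Real.sin b) +
        Real.sin a * (f b * Real.sin b + t * Real.cos b) := by
      rw [← e1, ← e2]; linear_combination (-f a) * ca
    linarith
  have s1 : 0 ≤ Real.sin (b - a) := nonneg_of_mul_nonneg_right j1 (by linarith)
  have s2 : 0 ≤ Real.sin (a - b) := nonneg_of_mul_nonneg_right j2 (by linarith)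
  rw [← neg_sub, Real.sin_neg] at s2
  have s0 : Real.sin (b - a) = 0 := by linarith
  have hcos := Real.sin_sq_add_cos_sq (b - a)
  rw [s0] at hcos
  have hcos' : (Real.cos (b - a) - 1) * (Real.cos (b - a) + 1) = 0 := by linarith
  have hab : b = a := by
    rcases mul_eq_zero.mp hcos' with h | h
    · have := (Real.cos_eq_one_iff_of_lt_of_lt (x := b - a) (by linarith [ha.2, hb.1])
        (by linarith [ha.1, hb.2])).mp (by linarith)
      linarith
    · exfalso
      -- opposite supporting lines cannot meet as the origin is strictly between them
      have hc1 : Real.cos b = - Real.cos a := by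
        rw [show b = (b - a) + a by ring, Real.cos_add, s0, show Real.cos (b - a) = -1 by linarith]
        ring
      have hs1 : Real.sin b = - Real.sin a := by
        rw [show b = (b - a) + a by ring, Real.sin_add, s0, show Real.cos (b - a) = -1 by linarith]
        ring
      rw [hc1, hs1] at e1 e2
      have : f a = - f b := by
        linear_combination Real.cos a * e1 + Real.sin a * e2 + (-f a - f b) * ca
      linarith
  subst hab
  have : s = t := by
    linear_combination (-Real.sin b) * e1 + Real.cos b * e2 + (t - s) * ca
  rw [this]

/-- A point outside the body lies on a supporting half-line: rotate the normal direction from one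
that separates the point from the body until the support line passes through the point. -/
lemma exists_tangent (hc : IsCompact K) (hcv : Convex ℝ K) (hn : K.Nonempty)
    (hpos : ∀ x, 0 < supp K x) {p : Plane} (hp : p ∉ K) :
    ∃ θ ∈ Ioc 0 (2 * π), Real.cos θ * p 0 + Real.sin θ * p 1 = ang (supp K) θ ∧
      (DifferentiableAt ℝ (ang (supp K)) θ →
        deriv (ang (supp K)) θ < - Real.sin θ * p 0 + Real.cos θ * p 1) := by
  obtain ⟨C, hC⟩ := exists_lipschitz_supp hc.isBounded hn
  set f := ang (supp K) with hf
  set g : ℝ → ℝ := fun θ => (Real.cos θ * p 0 + Real.sin θ * p 1) - f θ with hg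
  have hfper : Function.Periodic f (2 * π) := fun θ => by
    simp only [hf, ang, circ_periodic θ]
  have hgper : Function.Periodic g (2 * π) := fun θ => by
    simp only [hg, hfper θ, Real.cos_add_two_pi, Real.sin_add_two_pi]
  have hgc : Continuous g := by
    have := hC.continuous
    fun_prop
  have hpi := Real.pi_pos
  obtain ⟨θ₀, h0⟩ : ∃ θ₀, 0 < g θ₀ := by
    rw [mem_iff_inner_le_supp hc hcv hn] at hp
    push Not at hp
    obtain ⟨x, hx⟩ := hp
    obtain ⟨θ, -, rfl⟩ := circ_surj x
    refine ⟨θ, ?_⟩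
    rw [inner_circ] at hx
    simp only [hg, hf, ang]
    linarith
  have h1 : g (θ₀ - π) ≤ 0 := by
    have p1 : 0 < f (θ₀ - π) := hpos _
    have p2 : 0 < f θ₀ := hpos _
    simp only [hg] at h0 ⊢
    rw [Real.cos_sub_pi, Real.sin_sub_pi]
    linarith
  obtain ⟨a, ha⟩ : ∃ a, IsGreatest {θ | θ ∈ Icc (θ₀ - π) θ₀ ∧ g θ ≤ 0} a := by
    apply IsCompact.exists_isGreatest
    · exact isCompact_Icc.inter_right (isClosed_le hgc continuous_const)
    · exact ⟨_, ⟨le_rfl, by linarith⟩, h1⟩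
  have ha0 : a < θ₀ := lt_of_le_of_ne ha.1.1.2 fun e => by
    have := ha.1.2
    rw [e] at this
    linarith
  have hpos' : ∀ t ∈ Ioc a θ₀, 0 < g t := by
    intro t ht
    by_contra hneg
    have := ha.2 ⟨⟨ha.1.1.1.trans ht.1.le, ht.2⟩, not_lt.mp hneg⟩
    linarith [ht.1]
  have hga : g a = 0 := by
    refine le_antisymm ha.1.2 ?_
    refine ge_of_tendsto (hgc.continuousWithinAt (s := Ioi a) (x := a)).tendsto ?_
    filter_upwards [Ioc_mem_nhdsGT ha0] with t ht using (hpos' t ht).le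
  -- move the direction to the fundamental domain
  obtain ⟨θ, hθ, hθ0, hθp⟩ : ∃ θ ∈ Ioc 0 (2 * π), g θ = 0 ∧ ∃ δ > 0, ∀ t ∈ Ioc 0 δ,
      0 < g (θ + t) := by
    have h2 : (0 : ℝ) < 2 * π := by positivity
    refine ⟨toIocMod h2 0 a, ?_, ?_, θ₀ - a, by linarith, fun t ht => ?_⟩
    · simpa using toIocMod_mem_Ioc h2 0 a
    · rw [← hga, toIocMod]
      exact hgper.sub_zsmul_eq _
    · rw [toIocMod, sub_add_eq_add_sub, hgper.sub_zsmul_eq]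
      exact hpos' _ ⟨by linarith [ht.1], by linarith [ht.2]⟩
  refine ⟨θ, hθ, by simp only [hg] at hθ0; linarith, fun hd => ?_⟩
  have hgd : HasDerivAt g ((- Real.sin θ * p 0 + Real.cos θ * p 1) - deriv f θ) θ :=
    (((Real.hasDerivAt_cos θ).mul_const (p 0)).add ((Real.hasDerivAt_sin θ).mul_const (p 1))).sub
      hd.hasDerivAt
  have hge : 0 ≤ (- Real.sin θ * p 0 + Real.cos θ * p 1) - deriv f θ := by
    refine ge_of_tendsto hgd.tendsto_slope_zero_right ?_
    obtain ⟨δ, hδ, hδp⟩ := hθp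
    filter_upwards [Ioc_mem_nhdsGT hδ] with t ht
    rw [hθ0, sub_zero, smul_eq_mul]
    exact mul_nonneg (inv_nonneg.mpr ht.1.le) (hδp t ht).le
  refine lt_of_le_of_ne (by linarith) fun e => hp ?_
  obtain ⟨k, hk, k1, k2⟩ := exists_support_point hc hn hd
  have hθ1 : Real.cos θ * p 0 + Real.sin θ * p 1 = f θ := by simp only [hg] at hθ0; linarith
  rw [← hf] at k1 k2
  rw [← hθ1] at k1
  rw [e] at k2
  have cs := Real.sin_sq_add_cos_sq θ
  have : p = k := by
    ext i
    fin_cases i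
    · change p 0 = k 0
      linear_combination (-Real.cos θ) * k1 + Real.sin θ * k2 + (k 0 - p 0) * cs
    · change p 1 = k 1
      linear_combination (-Real.sin θ) * k1 - Real.cos θ * k2 + (k 1 - p 1) * cs
  rwa [this]

lemma planar_ball (R : ℝ) (hR : 0 < R) : planar (Metric.ball 0 R) = {z | z.1 ^ 2 + z.2 ^ 2 < R ^ 2} := by
  ext z
  simp only [planar, mem_ofPred_eq, mem_ball_zero_iff]
  rw [← abs_of_pos hR, ← abs_of_nonneg (norm_nonneg !₂[z.1, z.2]), ← sq_lt_sq, norm_sq_plane,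
    abs_of_pos hR]
  simp

/-- The complement of a convex body in a large disc is, up to a null set, swept out by the
half-tangents of the body. -/
lemma volume_ball_diff (hc : IsCompact K) (hcv : Convex ℝ K) (hn : K.Nonempty)
    (hpos : ∀ x, 0 < supp K x) {R : ℝ} (hR : 0 < R) (hKR : K ⊆ Metric.ball 0 R) :
    volume (Metric.ball 0 R \ K) =
      ∫⁻ z in tangentRegion (ang (supp K)) R, ENNReal.ofReal (z.2 - deriv (ang (supp K)) z.1) := by
  obtain ⟨C, hC⟩ := exists_lipschitz_supp hc.isBounded hn
  have h1 := lintegral_abs_det_fderiv_eq_addHaar_image volume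
    (measurableSet_tangentRegion hC.continuous R)
    (fun z hz => (hasFDerivAt_tangentMap (h := ang (supp K)) hz.2.1).hasFDerivWithinAt)
    (injOn_tangentMap hc hn hpos R)
  have h2 : ∫⁻ z in tangentRegion (ang (supp K)) R,
      ENNReal.ofReal |(fderivTangentMap (ang (supp K)) z).det| =
      ∫⁻ z in tangentRegion (ang (supp K)) R, ENNReal.ofReal (z.2 - deriv (ang (supp K)) z.1) := by
    refine setLIntegral_congr_fun (measurableSet_tangentRegion hC.continuous R) fun z hz => ?_
    simp only [det_fderivTangentMap]
    rw [abs_sub_comm, abs_of_pos (by linarith [hz.2.2.1])]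
  rw [← h2, h1, ← volume_planar]
  set f := ang (supp K) with hf
  have hfR : ∀ t, |f t| ≤ (⟨R, hR.le⟩ : NNReal) := fun t => by
    rw [hf, ang, abs_of_pos (hpos _)]
    exact supp_le hn fun k hk => by
      refine (real_inner_le_norm _ _).trans ?_
      rw [norm_circ, one_mul]
      exact (mem_ball_zero_iff.mp (hKR hk)).le
  -- the directions where the support function is not differentiable form a null set, and the
  -- Lipschitz map `tangentMap` keeps it null
  set N : Set (ℝ × ℝ) := {θ | ¬ DifferentiableAt ℝ f θ} ×ˢ Icc (-R) R with hN
  have hN0 : volume (tangentMap f '' N) = 0 := by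
    have hl := (tangentMap_lipschitz hC hfR).mono
      (prod_mono (subset_univ {θ | ¬ DifferentiableAt ℝ f θ}) (Subset.refl (Icc (-R) R)))
    have := hl.hausdorffMeasure_image_le (d := 2) (by norm_num)
    rw [hausdorffMeasure_prod_real] at this
    have hz : volume N = 0 := by
      rw [hN, Measure.volume_eq_prod, Measure.prod_prod,
        ae_iff.mp hC.ae_differentiableAt_real, zero_mul]
    rw [hz, mul_zero] at this
    exact le_antisymm this (zero_le)
  apply le_antisymm
  · have hsub : planar (Metric.ball 0 R \ K) ⊆
        tangentMap f '' tangentRegion f R ∪ tangentMap f '' N := by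
      rintro ⟨x, y⟩ ⟨hxB, hxK⟩
      obtain ⟨θ, hθ, e1, e2⟩ := exists_tangent hc hcv hn hpos hxK
      have hxy : (x, y) ∈ planar (Metric.ball 0 R) := hxB
      rw [planar_ball R hR] at hxy
      simp only [mem_ofPred_eq] at hxy
      simp only [Matrix.cons_val_zero, Matrix.cons_val_one] at e1 e2
      rw [← hf] at e1 e2
      have cs := Real.sin_sq_add_cos_sq θ
      set s := - Real.sin θ * x + Real.cos θ * y with hs
      have hsq : f θ ^ 2 + s ^ 2 = x ^ 2 + y ^ 2 := by
        rw [← e1, hs]; linear_combination (x ^ 2 + y ^ 2) * cs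
      have hF : tangentMap f (θ, s) = (x, y) := by
        simp only [tangentMap, Prod.mk.injEq]
        rw [← e1, hs]
        constructor
        · linear_combination x * cs
        · linear_combination y * cs
      by_cases hd : DifferentiableAt ℝ f θ
      · exact Or.inl ⟨(θ, s), ⟨hθ, hd, e2 hd, by simp only; linarith⟩, hF⟩
      · refine Or.inr ⟨(θ, s), ⟨hd, ?_⟩, hF⟩
        exact abs_le.mp (abs_le_of_sq_le_sq (by nlinarith [sq_nonneg (f θ)]) hR.le)
    calc _ ≤ volume (tangentMap f '' tangentRegion f R ∪ tangentMap f '' N) := measure_mono hsub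
      _ ≤ _ := (measure_union_le _ _).trans (by rw [hN0, add_zero])
  · apply measure_mono
    rintro _ ⟨⟨θ, s⟩, ⟨hθ, hd, hs, hsR⟩, rfl⟩
    simp only at hθ hd hs hsR
    have cs := Real.sin_sq_add_cos_sq θ
    refine ⟨?_, fun hK => ?_⟩
    · have : tangentMap f (θ, s) ∈ planar (Metric.ball 0 R) := by
        rw [planar_ball R hR]
        simp only [tangentMap, mem_ofPred_eq]
        linear_combination hsR + (f θ ^ 2 + s ^ 2) * cs
      exact this
    · have := tangential_eq_deriv_supp hc.isBounded hK hd.hasDerivAt (by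
        rw [inner_circ]
        simp only [tangentMap, Matrix.cons_val_zero, Matrix.cons_val_one]
        change _ = f θ
        linear_combination (f θ) * cs)
      simp only [tangentMap, Matrix.cons_val_zero, Matrix.cons_val_one] at this
      have h3 : s = deriv f θ := by rw [← this]; linear_combination (-s) * cs
      linarith

/-- The primitive of the half-circle. -/
def halfDiscArea (R x : ℝ) : ℝ := ∫ t in (0)..x, √(R ^ 2 - t ^ 2)

lemma hasDerivAt_halfDiscArea (R x : ℝ) : HasDerivAt (halfDiscArea R) √(R ^ 2 - x ^ 2) x := by
  have hc : Continuous fun t : ℝ => √(R ^ 2 - t ^ 2) := by fun_prop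
  exact intervalIntegral.integral_hasDerivAt_right (hc.intervalIntegrable _ _)
    (hc.stronglyMeasurableAtFilter _ _) hc.continuousAt

/-- A total derivative along the circle integrates to zero. -/
lemma integral_sqrt_mul_deriv {f : ℝ → ℝ} {C : NNReal} (hC : LipschitzWith C f)
    (hper : f (2 * π) = f 0) (R : ℝ) (hR : 0 ≤ R) :
    ∫ θ in (0)..(2 * π), √(R ^ 2 - f θ ^ 2) * deriv f θ = 0 := by
  have hG : LipschitzWith R.toNNReal (halfDiscArea R) := by
    refine lipschitzWith_of_nnnorm_deriv_le
      (fun x => (hasDerivAt_halfDiscArea R x).differentiableAt) fun x => ?_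
    rw [(hasDerivAt_halfDiscArea R x).deriv, ← NNReal.coe_le_coe, coe_nnnorm, Real.coe_toNNReal R hR,
      Real.norm_eq_abs, abs_of_nonneg (Real.sqrt_nonneg _)]
    exact Real.sqrt_le_iff.mpr ⟨hR, by nlinarith [sq_nonneg x]⟩
  have hac : AbsolutelyContinuousOnInterval (halfDiscArea R ∘ f) 0 (2 * π) :=
    ((hG.comp hC).lipschitzOnWith (s := uIcc 0 (2 * π))).absolutelyContinuousOnInterval
  have h1 := hac.integral_deriv_eq_sub
  rw [Function.comp_apply, Function.comp_apply, hper, sub_self] at h1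
  refine Eq.trans ?_ h1
  apply intervalIntegral.integral_congr_ae
  filter_upwards [hC.ae_differentiableAt_real] with θ hθ _
  exact ((hasDerivAt_halfDiscArea R (f θ)).comp θ hθ.hasDerivAt).deriv.symm

lemma lintegral_Ioo_sub {a b : ℝ} (hab : a ≤ b) :
    ∫⁻ s in Ioo a b, ENNReal.ofReal (s - a) = ENNReal.ofReal ((b - a) ^ 2 / 2) := by
  rw [← ofReal_integral_eq_lintegral_ofReal]
  · rw [← integral_Ioc_eq_integral_Ioo, ← intervalIntegral.integral_of_le hab,
      intervalIntegral.integral_sub (continuous_id'.intervalIntegrable _ _)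
        intervalIntegrable_const]
    simp only [integral_id, intervalIntegral.integral_const, smul_eq_mul]
    congr 1
    ring
  · exact (Continuous.integrableOn_Icc (by fun_prop)).mono_set Ioo_subset_Icc_self
  · rw [Filter.EventuallyLE, ae_restrict_iff' measurableSet_Ioo]
    exact Filter.Eventually.of_forall fun s hs => sub_nonneg.mpr hs.1.le

lemma lintegral_tangentRegion (hc : IsCompact K) (hn : K.Nonempty) {R : ℝ} (hR : 0 < R)
    (hKR : K ⊆ Metric.ball 0 R) :
    ∫⁻ z in tangentRegion (ang (supp K)) R, ENNReal.ofReal (z.2 - deriv (ang (supp K)) z.1) =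
      ∫⁻ θ in Ioc 0 (2 * π), ENNReal.ofReal
        ((√(R ^ 2 - ang (supp K) θ ^ 2) - deriv (ang (supp K)) θ) ^ 2 / 2) := by
  obtain ⟨C, hC⟩ := exists_lipschitz_supp hc.isBounded hn
  set f := ang (supp K) with hf
  have hm := measurableSet_tangentRegion hC.continuous R
  rw [← lintegral_indicator hm, ← lintegral_indicator measurableSet_Ioc, Measure.volume_eq_prod,
    lintegral_prod]
  · apply lintegral_congr_ae
    filter_upwards [hC.ae_differentiableAt_real] with θ hθ
    by_cases hθI : θ ∈ Ioc 0 (2 * π)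
    · rw [indicator_of_mem hθI]
      obtain ⟨k, hk, k1, k2⟩ := exists_support_point hc hn hθ
      rw [← hf] at k1 k2
      have hlt : f θ ^ 2 + deriv f θ ^ 2 < R ^ 2 := by
        have h1 : ‖k‖ < R := mem_ball_zero_iff.mp (hKR hk)
        have h2 : ‖k‖ ^ 2 < R ^ 2 := by
          have := norm_nonneg k
          nlinarith
        rw [norm_sq_plane] at h2
        rw [← k1, ← k2]
        linear_combination h2 + (k 0 ^ 2 + k 1 ^ 2) * Real.sin_sq_add_cos_sq θ
      have hb : |deriv f θ| < √(R ^ 2 - f θ ^ 2) := by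
        rw [← Real.sqrt_sq_eq_abs]
        exact Real.sqrt_lt_sqrt (sq_nonneg _) (by linarith)
      have hsq : √(R ^ 2 - f θ ^ 2) ^ 2 = R ^ 2 - f θ ^ 2 :=
        Real.sq_sqrt (by nlinarith [sq_nonneg (deriv f θ)])
      set b := √(R ^ 2 - f θ ^ 2)
      rw [abs_lt] at hb
      rw [← lintegral_Ioo_sub hb.2.le, ← lintegral_indicator measurableSet_Ioo]
      congr 1
      ext s
      have : (θ, s) ∈ tangentRegion f R ↔ s ∈ Ioo (deriv f θ) b := by
        constructor
        · rintro ⟨-, -, h3, h4⟩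
          simp only at h3 h4
          refine ⟨h3, ?_⟩
          nlinarith
        · rintro ⟨h3, h4⟩
          refine ⟨hθI, hθ, h3, ?_⟩
          simp only
          nlinarith
      by_cases hs : s ∈ Ioo (deriv f θ) b
      · rw [indicator_of_mem hs, indicator_of_mem (this.mpr hs)]
      · rw [indicator_of_notMem hs, indicator_of_notMem (fun h => hs (this.mp h))]
    · rw [indicator_of_notMem hθI]
      rw [lintegral_eq_zero_iff']
      · exact Filter.Eventually.of_forall fun s => indicator_of_notMem (fun h => hθI h.1) _
      · have : (fun s => (tangentRegion f R).indicator
            (fun z => ENNReal.ofReal (z.2 - deriv f z.1)) (θ, s)) = fun _ => 0 :=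
          funext fun s => indicator_of_notMem (fun h => hθI h.1) _
        rw [this]
        exact aemeasurable_const
  · refine (Measurable.indicator ?_ hm).aemeasurable
    exact (measurable_snd.sub ((measurable_deriv f).comp measurable_fst)).ennreal_ofReal

/-- The area of a convex body that has the origin in its interior, in terms of its support
function. -/
lemma volume_eq_integral_dens (hc : IsCompact K) (hcv : Convex ℝ K) (hn : K.Nonempty)
    (hpos : ∀ x, 0 < supp K x) :
    volume K = ENNReal.ofReal (1 / 2 * ∫ θ in (0)..(2 * π), dens (supp K) (supp K) θ) := by
  obtain ⟨C, hC⟩ := exists_lipschitz_supp hc.isBounded hn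
  obtain ⟨R, hR, hKR⟩ : ∃ R : ℝ, 0 < R ∧ K ⊆ Metric.ball 0 R := by
    obtain ⟨R, hR⟩ := hc.isBounded.exists_norm_le
    refine ⟨max R 0 + 1, by positivity, fun k hk => ?_⟩
    rw [mem_ball_zero_iff]
    exact lt_of_le_of_lt ((hR k hk).trans (le_max_left _ _)) (lt_add_one _)
  have h1 := volume_ball_diff hc hcv hn hpos hR hKR
  rw [lintegral_tangentRegion hc hn hR hKR] at h1
  have hpi : (0 : ℝ) ≤ 2 * π := by positivity
  set f := ang (supp K) with hf
  have hfR : ∀ t, f t ^ 2 ≤ R ^ 2 := fun t => by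
    have h0 : 0 < f t := hpos _
    have : f t ≤ R := supp_le hn fun k hk => by
      refine (real_inner_le_norm _ _).trans ?_
      rw [norm_circ, one_mul]
      exact (mem_ball_zero_iff.mp (hKR hk)).le
    nlinarith
  have hdm : MemLp (deriv f) ⊤ (volume.restrict (Ioc 0 (2 * π))) :=
    MemLp.of_bound (measurable_deriv _).aestronglyMeasurable C
      (Filter.Eventually.of_forall fun θ => norm_deriv_le_of_lipschitz hC)
  have hbc : Continuous fun θ => √(R ^ 2 - f θ ^ 2) := by
    have := hC.continuous
    fun_prop
  have i1 : IntervalIntegrable (fun θ => f θ * f θ) volume 0 (2 * π) :=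
    (hC.continuous.mul hC.continuous).intervalIntegrable _ _
  have i2 : IntervalIntegrable (fun θ => deriv f θ * deriv f θ) volume 0 (2 * π) := by
    rw [intervalIntegrable_iff_integrableOn_Ioc_of_le hpi]
    exact (hdm.mono_exponent le_top (p := 2)).integrable_mul (hdm.mono_exponent le_top (p := 2))
  have i3 : IntervalIntegrable (fun θ => √(R ^ 2 - f θ ^ 2) * deriv f θ) volume 0 (2 * π) := by
    refine IntervalIntegrable.continuousOn_mul ?_ hbc.continuousOn
    rw [intervalIntegrable_iff_integrableOn_Ioc_of_le hpi]
    exact hdm.integrable le_top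
  have i4 : IntervalIntegrable (dens (supp K) (supp K)) volume 0 (2 * π) := i1.sub i2
  have hpt : ∀ θ, (√(R ^ 2 - f θ ^ 2) - deriv f θ) ^ 2 / 2 =
      (R ^ 2 / 2 - 1 / 2 * dens (supp K) (supp K) θ) - √(R ^ 2 - f θ ^ 2) * deriv f θ := by
    intro θ
    have := Real.sq_sqrt (sub_nonneg.mpr (hfR θ))
    simp only [dens, ← hf]
    linear_combination (1 / 2) * this
  have hint : ∫ θ in (0)..(2 * π), (√(R ^ 2 - f θ ^ 2) - deriv f θ) ^ 2 / 2 =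
      π * R ^ 2 - 1 / 2 * ∫ θ in (0)..(2 * π), dens (supp K) (supp K) θ := by
    simp only [hpt]
    rw [intervalIntegral.integral_sub (intervalIntegrable_const.sub (i4.const_mul _)) i3,
      intervalIntegral.integral_sub intervalIntegrable_const (i4.const_mul _),
      integral_sqrt_mul_deriv hC _ R hR.le, intervalIntegral.integral_const,
      intervalIntegral.integral_const_mul, smul_eq_mul]
    · ring
    · have := circ_periodic 0
      rw [zero_add] at this
      simp only [hf, ang, this]
  have hnn : 0 ≤ ∫ θ in (0)..(2 * π), (√(R ^ 2 - f θ ^ 2) - deriv f θ) ^ 2 / 2 :=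
    intervalIntegral.integral_nonneg hpi fun θ _ => by positivity
  have h2 : volume (Metric.ball 0 R \ K) = ENNReal.ofReal
      (∫ θ in (0)..(2 * π), (√(R ^ 2 - f θ ^ 2) - deriv f θ) ^ 2 / 2) := by
    rw [h1, intervalIntegral.integral_of_le hpi, ofReal_integral_eq_lintegral_ofReal]
    · rw [← IntegrableOn, ← intervalIntegrable_iff_integrableOn_Ioc_of_le hpi]
      simp only [hpt]
      exact (intervalIntegrable_const.sub (i4.const_mul _)).sub i3
    · exact Filter.Eventually.of_forall fun θ => by positivity
  have hv : volume (Metric.ball (0 : Plane) R) = ENNReal.ofReal (π * R ^ 2) := by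
    rw [EuclideanSpace.volume_ball_fin_two, ← ENNReal.ofReal_pow hR.le,
      ← NNReal.coe_real_pi, mul_comm (NNReal.pi : ℝ), ENNReal.ofReal_mul (by positivity),
      ENNReal.ofReal_coe_nnreal]
  have h3 := measure_sdiff_add_inter (μ := volume) (Metric.ball (0 : Plane) R)
    hc.isClosed.measurableSet
  rw [inter_eq_right.mpr hKR, h2, hv] at h3
  have hfin : volume K ≠ ⊤ := hc.measure_lt_top.ne
  rw [← ENNReal.ofReal_toReal hfin, ← ENNReal.ofReal_add hnn ENNReal.toReal_nonneg,
    ENNReal.ofReal_eq_ofReal_iff (by positivity) (by positivity)] at h3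
  rw [← ENNReal.ofReal_toReal hfin]
  congr 1
  linarith

end Body

/-! ### Pointwise bounds in terms of the Lorentzian form and of the Sobolev norm -/

lemma A_self_eq (h : H1even) : A h h = 1 / (2 * π) *
    ((∫ θ in (0)..(2 * π), ang h.1 θ ^ 2) - ∫ θ in (0)..(2 * π), deriv (ang h.1) θ ^ 2) := by
  have hi1 : IntervalIntegrable (fun t => ang h.1 t ^ 2) volume 0 (2 * π) := by
    simpa [pow_two] using int_ang_mul h h
  have hi2 : IntervalIntegrable (fun t => deriv (ang h.1) t ^ 2) volume 0 (2 * π) := by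
    simpa [pow_two] using int_deriv_mul h h
  rw [A_apply, ← intervalIntegral.integral_sub hi1 hi2]
  simp only [pow_two]

lemma normH1_nonneg (h : H1even) : 0 ≤ normH1 h := Real.sqrt_nonneg _

lemma normH1_sq (h : H1even) : normH1 h ^ 2 = (∫ θ in (0)..(2 * π), ang h.1 θ ^ 2) +
    ∫ θ in (0)..(2 * π), deriv (ang h.1) θ ^ 2 := by
  have hpi : (0 : ℝ) ≤ 2 * π := by positivity
  rw [normH1, Real.sq_sqrt]
  exact add_nonneg (intervalIntegral.integral_nonneg hpi fun _ _ => sq_nonneg _)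
    (intervalIntegral.integral_nonneg hpi fun _ _ => sq_nonneg _)

lemma normH1_sq_eq_sub (h : H1even) :
    normH1 h ^ 2 = 2 * (∫ θ in (0)..(2 * π), ang h.1 θ ^ 2) - 2 * π * A h h := by
  have := Real.pi_pos
  rw [normH1_sq, A_self_eq]
  field_simp
  ring

/-- On the functions of mean zero, where the form is negative, it controls the values: the mean
square is at most `π² / 12 < 1` times the mean square of the derivative. -/
lemma sq_le_of_A_one_eq_zero (h : H1even) (h0 : A one h = 0) (x : S1) :
    h.1 x ^ 2 ≤ 5 * (-A h h) := by
  rw [A_one] at h0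
  have hpi := Real.pi_pos
  have h10 : π ^ 2 < 10 := by nlinarith [Real.pi_lt_d2, Real.pi_gt_three]
  rw [A_self_eq]
  set E := ∫ θ in (0)..(2 * π), deriv (ang h.1) θ ^ 2 with hE
  have hb : ∀ x, h.1 x ^ 2 ≤ π / 24 * E := by
    intro x
    obtain ⟨θ, hθ, e⟩ := ang_mem h x
    rw [e]
    exact sq_le_of_mean_zero h h0 hθ
  have hE0 : 0 ≤ E := intervalIntegral.integral_nonneg (by positivity) fun _ _ => sq_nonneg _
  have hi1 : IntervalIntegrable (fun t => ang h.1 t ^ 2) volume 0 (2 * π) := by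
    simpa [pow_two] using int_ang_mul h h
  have hL : ∫ θ in (0)..(2 * π), ang h.1 θ ^ 2 ≤ 2 * π * (π / 24 * E) := by
    have := intervalIntegral.integral_mono_on (μ := volume) (a := 0) (b := 2 * π)
      (f := fun t => ang h.1 t ^ 2) (g := fun _ => π / 24 * E) (by positivity) hi1
      intervalIntegrable_const (fun x _ => hb (circ x))
    rw [intervalIntegral.integral_const, smul_eq_mul, sub_zero] at this
    exact this
  refine (hb x).trans ?_
  rw [← sub_nonneg]
  have e : 5 * -(1 / (2 * π) * ((∫ θ in (0)..(2 * π), ang h.1 θ ^ 2) - E)) - π / 24 * E =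
      (5 * (E - ∫ θ in (0)..(2 * π), ang h.1 θ ^ 2) - π ^ 2 / 12 * E) / (2 * π) := by
    field_simp
    ring
  rw [e]
  apply div_nonneg _ (by positivity)
  nlinarith

/-- On the orthogonal of a point of the hyperbolic space, the form controls the values. -/
lemma abs_le_of_orth (y : HInf) (u : H1even) (hu : A y.vec u = 0) (x : S1) :
    |u.1 x| ≤ (3 + |y.fn x|) * √(-A u u) := by
  have hy : A y.vec y.vec = 1 := y.2.1
  have hy0 : A one y.vec ≠ 0 := by
    rw [A_one]; exact y.2.2.ne'
  have hnn : 0 ≤ -A u u := by linarith [(A_orth hy hu).1]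
  set c := A one u / A one y.vec with hc
  have hp : A one (u - c • y.vec) = 0 := by
    simp only [map_sub, map_smul, smul_eq_mul, hc]
    field_simp
    ring
  have he : A (u - c • y.vec) (u - c • y.vec) = A u u + c ^ 2 := by
    simp only [map_sub, map_smul, smul_eq_mul, LinearMap.sub_apply, LinearMap.smul_apply, hy, hu,
      A_comm u y.vec]
    ring
  have hle := A_nonpos hp
  have hb := sq_le_of_A_one_eq_zero _ hp x
  rw [he] at hle hb
  have hs := Real.sq_sqrt hnn
  have hs0 := Real.sqrt_nonneg (-A u u)
  set s := √(-A u u)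
  have hc1 : |c| ≤ s := abs_le_of_sq_le_sq (by linarith) hs0
  have hw : |(u - c • y.vec).1 x| ≤ 3 * s :=
    abs_le_of_sq_le_sq (by nlinarith [sq_nonneg c]) (by positivity)
  have e : u.1 x = (u - c • y.vec).1 x + c * y.fn x := by
    change _ = (u.1 x - c * y.fn x) + c * y.fn x
    ring
  rw [e]
  refine (abs_add_le _ _).trans ?_
  rw [abs_mul, add_mul, mul_comm |y.fn x|]
  exact add_le_add hw (mul_le_mul_of_nonneg_right hc1 (abs_nonneg _))

/-- The Sobolev norm controls the values. -/
lemma abs_le_normH1 (h : H1even) (x : S1) : |h.1 x| ≤ 6 * normH1 h := by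
  have hpi := Real.pi_pos
  set m := A one h with hm
  have hN := normH1_sq h
  have hN0 := normH1_nonneg h
  set N := normH1 h
  have hA := A_self_eq h
  have hm' : ∫ θ in (0)..(2 * π), ang h.1 θ = 2 * π * m := by
    rw [hm, A_one, mean]; field_simp
  set L := ∫ θ in (0)..(2 * π), ang h.1 θ ^ 2
  set E := ∫ θ in (0)..(2 * π), deriv (ang h.1) θ ^ 2 with hE
  have hL0 : 0 ≤ L := intervalIntegral.integral_nonneg (by positivity) fun _ _ => sq_nonneg _
  have hE0 : 0 ≤ E := intervalIntegral.integral_nonneg (by positivity) fun _ _ => sq_nonneg _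
  have hi1 : IntervalIntegrable (fun t => ang h.1 t ^ 2) volume 0 (2 * π) := by
    simpa [pow_two] using int_ang_mul h h
  have hi2 : IntervalIntegrable (ang h.1) volume 0 (2 * π) :=
    h.2.2.1.continuousOn.intervalIntegrable
  have hvar : 0 ≤ L - 2 * m * (2 * π * m) + 2 * π * m ^ 2 := by
    have h1 : 0 ≤ ∫ θ in (0)..(2 * π), (ang h.1 θ - m) ^ 2 :=
      intervalIntegral.integral_nonneg (by positivity) fun _ _ => sq_nonneg _
    have h2 : ∀ θ, (ang h.1 θ - m) ^ 2 = ang h.1 θ ^ 2 - 2 * m * ang h.1 θ + m ^ 2 := fun θ => by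
      ring
    simp only [h2] at h1
    rw [intervalIntegral.integral_add (hi1.sub (hi2.const_mul _)) intervalIntegrable_const,
      intervalIntegral.integral_sub hi1 (hi2.const_mul _), intervalIntegral.integral_const_mul,
      hm', intervalIntegral.integral_const, smul_eq_mul, sub_zero] at h1
    exact h1
  have hmL : m ^ 2 ≤ L := by nlinarith [Real.pi_gt_three, sq_nonneg m]
  have hp : A one (h - m • one) = 0 := by simp [A_one_one, hm]
  have he : A (h - m • one) (h - m • one) = A h h - m ^ 2 := by
    simp only [map_sub, map_smul, smul_eq_mul, LinearMap.sub_apply, LinearMap.smul_apply,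
      A_comm h one, A_one_one, ← hm]
    ring
  have hb := sq_le_of_A_one_eq_zero _ hp x
  rw [he] at hb
  have hAE : -A h h ≤ E := by
    rw [hA]
    have : 1 / (2 * π) ≤ 1 := by
      rw [div_le_one (by positivity)]
      linarith [Real.pi_gt_three]
    have h0 : 0 < 1 / (2 * π) := by positivity
    nlinarith
  have hm1 : |m| ≤ N := abs_le_of_sq_le_sq (by linarith) hN0
  have hw : |(h - m • one).1 x| ≤ 5 * N :=
    abs_le_of_sq_le_sq (by nlinarith) (by positivity)
  have e : h.1 x = (h - m • one).1 x + m := by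
    change _ = (h.1 x - m * 1) + m
    ring
  rw [e]
  refine (abs_add_le _ _).trans ?_
  linarith

/-! ### Symmetric convex bodies -/

lemma det_act (M : Matrix (Fin 2) (Fin 2) ℝ) : LinearMap.det (act M) = M.det := by
  have : act M = Matrix.toLin (PiLp.basisFun 2 ℝ (Fin 2)) (PiLp.basisFun 2 ℝ (Fin 2)) M :=
    congrFun (congrArg _ (Matrix.toLpLin_eq_toLin 2 2)) M
  rw [this, LinearMap.det_toLin]

namespace SymBody

lemma isCompact (K : SymBody) : IsCompact K.set := K.1.isCompact

lemma convex (K : SymBody) : Convex ℝ K.set := K.1.convex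

lemma nonempty (K : SymBody) : K.set.Nonempty := K.1.nonempty

lemma symm (K : SymBody) : ∀ k ∈ K.set, -k ∈ K.set := K.2.1

lemma isBounded (K : SymBody) : Bornology.IsBounded K.set := K.isCompact.isBounded

lemma ext {K L : SymBody} (h : K.set = L.set) : K = L :=
  Subtype.ext (ConvexBody.ext h)

/-- A symmetric convex body, from its set of points. -/
def ofSet (K : Set Plane) (hc : IsCompact K) (hcv : Convex ℝ K) (hs : ∀ k ∈ K, -k ∈ K)
    (hi : (interior K).Nonempty) : SymBody :=
  ⟨⟨K, hcv, hc, hi.mono interior_subset⟩, hs, hi⟩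

lemma supp_pos (K : SymBody) (x : S1) : 0 < supp K.set x := by
  obtain ⟨p, hp⟩ := K.2.2
  rw [mem_interior_iff_mem_nhds, Metric.mem_nhds_iff] at hp
  obtain ⟨r, hr, hb⟩ := hp
  have hx : ∀ y : S1, inner ℝ (y : Plane) p + r / 2 ≤ supp K.set y := by
    intro y
    have hy : ‖(y : Plane)‖ = 1 := by simp
    have hm : p + (r / 2) • (y : Plane) ∈ K.set := by
      apply hb
      rw [mem_ball_iff_norm, add_sub_cancel_left, norm_smul, hy, mul_one, Real.norm_eq_abs,
        abs_of_pos (by linarith)]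
      linarith
    have := inner_le_supp K.isBounded hm y
    rwa [inner_add_right, inner_smul_right, real_inner_self_eq_norm_sq, hy, one_pow, mul_one]
      at this
  have h1 := hx x
  have h2 := hx (-x)
  rw [supp_neg K.symm] at h2
  have h3 : inner ℝ ((-x : S1) : Plane) p = - inner ℝ (x : Plane) p := by simp
  linarith

/-- The support function of a symmetric convex body, in the Sobolev space. -/
def h (K : SymBody) : H1even := suppH1 K.set K.isBounded K.nonempty K.symm

lemma h_apply (K : SymBody) (x : S1) : K.h.1 x = supp K.set x := rfl

lemma subset_iff (K L : SymBody) : K.set ⊆ L.set ↔ ∀ x, K.h.1 x ≤ L.h.1 x :=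
  subset_iff_supp_le K.isBounded K.nonempty L.isCompact L.convex L.nonempty

lemma h_injective : Function.Injective h := by
  intro K L e
  apply ext
  apply Subset.antisymm
  · rw [subset_iff, e]; exact fun _ => le_rfl
  · rw [subset_iff, e]; exact fun _ => le_rfl

lemma volume_pos (K : SymBody) : 0 < volume K.set :=
  Measure.measure_pos_of_nonempty_interior _ K.2.2

/-- The area of a symmetric convex body is `π` times the value of the form on its support
function. -/
lemma volume_eq (K : SymBody) : volume K.set = ENNReal.ofReal (π * A K.h K.h) := by
  rw [volume_eq_integral_dens K.isCompact K.convex K.nonempty K.supp_pos]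
  congr 1
  change _ = π * (1 / (2 * π) * ∫ θ in (0)..(2 * π), dens (supp K.set) (supp K.set) θ)
  have := Real.pi_ne_zero
  field_simp

lemma A_pos (K : SymBody) : 0 < A K.h K.h := by
  have h1 := K.volume_pos
  rw [volume_eq, ENNReal.ofReal_pos] at h1
  exact pos_of_mul_pos_right h1 Real.pi_pos.le

lemma volume_eq_pi_iff (K : SymBody) : volume K.set = ENNReal.ofReal π ↔ A K.h K.h = 1 := by
  have hpi := Real.pi_pos
  rw [volume_eq, ENNReal.ofReal_eq_ofReal_iff (mul_pos hpi K.A_pos).le hpi.le]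
  constructor
  · intro e
    exact mul_left_cancel₀ hpi.ne' (by linarith)
  · intro e
    rw [e, mul_one]

lemma A_mono {K L : SymBody} (hKL : K.set ⊆ L.set) : A K.h K.h ≤ A L.h L.h := by
  have h1 := measure_mono (μ := volume) hKL
  rw [volume_eq, volume_eq, ENNReal.ofReal_le_ofReal_iff (mul_pos Real.pi_pos L.A_pos).le] at h1
  exact le_of_mul_le_mul_left h1 Real.pi_pos

lemma mean_pos (K : SymBody) : 0 < mean K.h := by
  have hpi := Real.pi_pos
  apply mul_pos (by positivity)
  apply intervalIntegral.intervalIntegral_pos_of_pos_on _ (fun θ _ => K.supp_pos (circ θ))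
    (by positivity)
  exact K.h.2.2.1.continuousOn.intervalIntegrable

/-- The Minkowski sum. -/
def add (K L : SymBody) : SymBody :=
  ofSet (K.set + L.set) (K.isCompact.add L.isCompact) (K.convex.add L.convex) (by
    rintro _ ⟨k, hk, l, hl, rfl⟩
    exact ⟨-k, K.symm k hk, -l, L.symm l hl, by simp [add_comm]⟩) (by
    obtain ⟨l, hl⟩ := L.nonempty
    obtain ⟨k, hk⟩ := K.2.2
    refine ⟨k + l, ?_⟩
    exact subset_interior_add_left ⟨k, hk, l, hl, rfl⟩)

lemma h_add (K L : SymBody) : (K.add L).h = K.h + L.h :=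
  Subtype.ext (supp_add K.isBounded K.nonempty L.isBounded L.nonempty)

/-- The dilation by a positive factor. -/
def smul (c : ℝ) (hc : 0 < c) (K : SymBody) : SymBody :=
  ofSet (c • K.set) (K.isCompact.smul c) (K.convex.smul c) (by
    rintro _ ⟨k, hk, rfl⟩
    exact ⟨-k, K.symm k hk, by simp⟩) (by
    rw [interior_smul₀ hc.ne']
    exact K.2.2.smul_set)

lemma set_smul (c : ℝ) (hc : 0 < c) (K : SymBody) : (smul c hc K).set = c • K.set := rfl

lemma h_smul (c : ℝ) (hc : 0 < c) (K : SymBody) : (smul c hc K).h = c • K.h :=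
  Subtype.ext (funext fun x => supp_smul hc.le x)

/-- The image under an invertible linear map, given by its matrix. -/
def image (M : GL (Fin 2) ℝ) (K : SymBody) : SymBody :=
  have hi : ∀ x, act (M : Matrix (Fin 2) (Fin 2) ℝ) (act (↑M⁻¹ : Matrix (Fin 2) (Fin 2) ℝ) x) = x :=
    fun x => by rw [← act_mul, ← Units.val_mul, mul_inv_cancel, Units.val_one, act_one]
  ofSet (act (M : Matrix (Fin 2) (Fin 2) ℝ) '' K.set)
    (K.isCompact.image (LinearMap.continuous_of_finiteDimensional _))
    (K.convex.linear_image _) (by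
    rintro _ ⟨k, hk, rfl⟩
    exact ⟨-k, K.symm k hk, by simp⟩) (by
    have ho : IsOpenMap (act (M : Matrix (Fin 2) (Fin 2) ℝ)) :=
      LinearMap.isOpenMap_of_finiteDimensional _ fun x => ⟨_, hi x⟩
    exact (K.2.2.image _).mono (ho.image_interior_subset _))

lemma set_image (M : GL (Fin 2) ℝ) (K : SymBody) :
    (K.image M).set = act (M : Matrix (Fin 2) (Fin 2) ℝ) '' K.set := rfl

lemma volume_image (M : GL (Fin 2) ℝ) (K : SymBody) : volume (K.image M).set =
    ENNReal.ofReal |(M : Matrix (Fin 2) (Fin 2) ℝ).det| * volume K.set := by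
  rw [set_image, Measure.addHaar_image_linearMap, det_act]

/-- The unit disc. -/
def unitDisc : SymBody :=
  ofSet disc (isCompact_closedBall _ _) (convex_closedBall _ _) (by
    intro k hk
    rw [disc, mem_closedBall_zero_iff] at hk ⊢
    rwa [norm_neg]) (by
    rw [disc, interior_closedBall _ one_ne_zero]
    exact ⟨0, Metric.mem_ball_self one_pos⟩)

lemma h_unitDisc : unitDisc.h = one :=
  Subtype.ext (funext fun x => supp_disc x)

/-- The parallel body at distance `ε`. -/
def parallel (ε : ℝ) (hε : 0 ≤ ε) (K : SymBody) : SymBody :=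
  ofSet (K.set + Metric.closedBall 0 ε) (K.isCompact.add (isCompact_closedBall _ _))
    (K.convex.add (convex_closedBall _ _)) (by
    rintro _ ⟨k, hk, l, hl, rfl⟩
    rw [mem_closedBall_zero_iff] at hl
    exact ⟨-k, K.symm k hk, -l, by rwa [mem_closedBall_zero_iff, norm_neg], by simp [add_comm]⟩)
    (K.2.2.mono (interior_mono fun k hk => ⟨k, hk, 0, Metric.mem_closedBall_self hε, add_zero k⟩))

lemma h_parallel {ε : ℝ} (hε : 0 ≤ ε) (K : SymBody) : (K.parallel ε hε).h = K.h + ε • one := by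
  apply Subtype.ext
  have h1 : Metric.closedBall (0 : Plane) ε = ε • disc := (smul_unitClosedBall_of_nonneg hε).symm
  change supp (K.set + Metric.closedBall 0 ε) = _
  rw [supp_add K.isBounded K.nonempty Metric.isBounded_closedBall
    (Metric.nonempty_closedBall.mpr hε), h1]
  funext x
  change supp K.set x + supp (ε • disc) x = supp K.set x + ε * 1
  rw [supp_smul hε, supp_disc]

/-- The mixed area of two bodies is controlled by a one-sided bound on the support functions. -/
lemma mixed_le {K L : SymBody} {ε : ℝ} (hε : 0 ≤ ε) (hle : ∀ x, L.h.1 x ≤ K.h.1 x + ε) :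
    A (K.h + L.h) (K.h + L.h) ≤ 4 * A K.h K.h + 4 * ε * mean K.h + ε ^ 2 := by
  have h1 : (K.add L).set ⊆ (K.add (K.parallel ε hε)).set := by
    rw [subset_iff]
    intro x
    rw [h_add, h_add, h_parallel hε]
    change K.h.1 x + L.h.1 x ≤ K.h.1 x + (K.h.1 x + ε * 1)
    linarith [hle x]
  have h2 := A_mono h1
  rw [h_add, h_add, h_parallel hε] at h2
  refine h2.trans (le_of_eq ?_)
  simp only [map_add, map_smul, smul_eq_mul, LinearMap.add_apply, LinearMap.smul_apply, A_one_one,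
    A_comm K.h one, ← A_one]
  ring

/-- The area is controlled by a one-sided bound on the support functions. -/
lemma A_le {K L : SymBody} {ε : ℝ} (hε : 0 ≤ ε) (hle : ∀ x, L.h.1 x ≤ K.h.1 x + ε) :
    A L.h L.h ≤ A K.h K.h + 2 * ε * mean K.h + ε ^ 2 := by
  have h1 : L.set ⊆ (K.parallel ε hε).set := by
    rw [subset_iff]
    intro x
    rw [h_parallel hε]
    change L.h.1 x ≤ K.h.1 x + ε * 1
    linarith [hle x]
  have h2 := A_mono h1
  rw [h_parallel hε] at h2
  refine h2.trans (le_of_eq ?_)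
  simp only [map_add, map_smul, smul_eq_mul, LinearMap.add_apply, LinearMap.smul_apply, A_one_one,
    A_comm K.h one, ← A_one]
  ring

end SymBody

/-! ### The hyperbolic and the Hausdorff topology on bodies of area `π` -/

open Filter Topology

lemma A_add (h k : H1even) : A (h + k) (h + k) = A h h + 2 * A h k + A k k := by
  simp only [map_add, LinearMap.add_apply, A_comm k h]
  ring

namespace SymBody

/-- The support function of a body of area `π`, as a point of the hyperbolic space. -/
def point (K : SymBody) (hK : A K.h K.h = 1) : HInf := ⟨K.h, hK, K.mean_pos⟩

lemma point_mem (K : SymBody) (hK : A K.h K.h = 1) : K.point hK ∈ CK :=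
  ⟨K, K.volume_eq_pi_iff.mpr hK, rfl⟩

lemma dist_eq (K L : SymBody) : dist K L = Metric.hausdorffDist K.set L.set := rfl

lemma h_le_add_dist (K L : SymBody) (x : S1) : K.h.1 x ≤ L.h.1 x + dist K L := by
  refine supp_le K.nonempty fun k hk => ?_
  obtain ⟨l, hl, e⟩ := L.isCompact.exists_infDist_eq_dist L.nonempty k
  have h1 := Metric.infDist_le_hausdorffDist_of_mem (t := L.set) hk
    (ConvexBody.hausdorffEDist_ne_top (K := K.1) (L := L.1))
  rw [e] at h1
  have h2 : inner ℝ (x : Plane) (k - l) ≤ dist k l := by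
    refine (real_inner_le_norm _ _).trans ?_
    rw [dist_eq_norm]
    simp
  rw [inner_sub_right] at h2
  have h3 := inner_le_supp L.isBounded hl x
  rw [dist_eq, h_apply]
  linarith

lemma dist_le {K L : SymBody} {ε : ℝ} (hε : 0 ≤ ε) (h : ∀ x, |K.h.1 x - L.h.1 x| ≤ ε) :
    dist K L ≤ ε := by
  have key : ∀ K L : SymBody, (∀ x, |K.h.1 x - L.h.1 x| ≤ ε) →
      ∀ x ∈ K.set, ∃ y ∈ L.set, dist x y ≤ ε := by
    intro K L h k hk
    have hs : K.set ⊆ (L.parallel ε hε).set := by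
      rw [subset_iff]
      intro x
      rw [h_parallel hε]
      change K.h.1 x ≤ L.h.1 x + ε * 1
      linarith [(abs_le.mp (h x)).2]
    obtain ⟨l, hl, b, hb, e⟩ := hs hk
    refine ⟨l, hl, ?_⟩
    simp only at e
    rw [← e, dist_eq_norm, add_sub_cancel_left]
    exact mem_closedBall_zero_iff.mp hb
  refine Metric.hausdorffDist_le_of_mem_dist hε (key K L h) fun l hl => ?_
  exact key L K (fun x => by rw [abs_sub_comm]; exact h x) l hl

lemma mean_mono {K L : SymBody} {ε : ℝ} (hle : ∀ x, L.h.1 x ≤ K.h.1 x + ε) :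
    mean L.h ≤ mean K.h + ε := by
  have hpi := Real.pi_pos
  have h1 : ∫ θ in (0)..(2 * π), ang L.h.1 θ ≤ ∫ θ in (0)..(2 * π), (ang K.h.1 θ + ε) := by
    apply intervalIntegral.integral_mono_on (by positivity)
      L.h.2.2.1.continuousOn.intervalIntegrable
      (K.h.2.2.1.continuousOn.intervalIntegrable.add intervalIntegrable_const)
    exact fun x _ => hle (circ x)
  rw [intervalIntegral.integral_add K.h.2.2.1.continuousOn.intervalIntegrable
    intervalIntegrable_const, intervalIntegral.integral_const, smul_eq_mul, sub_zero] at h1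
  rw [mean, mean]
  have h2 := mul_le_mul_of_nonneg_left h1 (show 0 ≤ 1 / (2 * π) by positivity)
  refine h2.trans (le_of_eq ?_)
  field_simp

/-- The area is continuous for the Hausdorff distance. -/
lemma continuous_A : Continuous fun K : SymBody => A K.h K.h := by
  rw [continuous_iff_continuousAt]
  intro K₀
  set m := mean K₀.h
  set a := A K₀.h K₀.h
  have hd : Tendsto (fun K : SymBody => dist K K₀) (𝓝 K₀) (𝓝 0) := by
    have := (continuous_id.dist (continuous_const (y := K₀))).tendsto K₀
    simpa using this
  have h1 : Tendsto (fun K : SymBody => a - (2 * dist K K₀ * (m + dist K K₀) + dist K K₀ ^ 2))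
      (𝓝 K₀) (𝓝 a) := by
    have := tendsto_const_nhds (x := a) |>.sub
      (((hd.const_mul 2).mul (hd.const_add m)).add (hd.pow 2))
    simpa using this
  have h2 : Tendsto (fun K : SymBody => a + 2 * dist K K₀ * m + dist K K₀ ^ 2)
      (𝓝 K₀) (𝓝 a) := by
    have := ((tendsto_const_nhds (x := a)).add ((hd.const_mul 2).mul_const m)).add (hd.pow 2)
    simpa using this
  refine tendsto_of_tendsto_of_tendsto_of_le_of_le h1 h2 (fun K => ?_) (fun K => ?_)
  · have h3 : ∀ x, K₀.h.1 x ≤ K.h.1 x + dist K K₀ := fun x => by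
      rw [dist_comm]; exact h_le_add_dist K₀ K x
    have h4 := A_le dist_nonneg h3
    have h5 := mean_mono (h_le_add_dist K K₀)
    have h6 : 0 ≤ dist K K₀ := dist_nonneg
    change a - (2 * dist K K₀ * (m + dist K K₀) + dist K K₀ ^ 2) ≤ A K.h K.h
    have h7 := mul_le_mul_of_nonneg_left h5 h6
    linarith
  · exact A_le dist_nonneg (h_le_add_dist K K₀)

/-- The body of area `π` that is homothetic to a given body. -/
def normalize (K : SymBody) : SymBody :=
  smul (√(A K.h K.h))⁻¹ (inv_pos.mpr (Real.sqrt_pos.mpr K.A_pos)) K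

lemma h_normalize (K : SymBody) : K.normalize.h = (√(A K.h K.h))⁻¹ • K.h := h_smul _ _ _

lemma A_normalize (K : SymBody) : A K.normalize.h K.normalize.h = 1 := by
  have hs := Real.sqrt_pos.mpr K.A_pos
  have hs2 := Real.mul_self_sqrt K.A_pos.le
  rw [h_normalize]
  simp only [map_smul, LinearMap.smul_apply, smul_eq_mul]
  set s := √(A K.h K.h)
  rw [← hs2]
  field_simp

/-- The normalized support function, as an element of `C_K`. -/
def toCK (K : SymBody) : CK := ⟨K.normalize.point K.A_normalize, point_mem _ _⟩

lemma vec_toCK (K : SymBody) : K.toCK.1.vec = (√(A K.h K.h))⁻¹ • K.h := h_normalize K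

/-- Convergence for the Hausdorff distance implies convergence in the hyperbolic space: the form of
two support functions is a mixed area, which is monotone. -/
lemma continuous_toCK : Continuous toCK := by
  refine Continuous.subtype_mk ?_ _
  rw [continuous_iff_continuousAt]
  intro K₀
  rw [ContinuousAt, tendsto_iff_dist_tendsto_zero]
  set m := mean K₀.h
  set a := A K₀.h K₀.h with ha
  have ha0 : 0 < a := K₀.A_pos
  have hd : Tendsto (fun K : SymBody => dist K K₀) (𝓝 K₀) (𝓝 0) := by
    have := (continuous_id.dist (continuous_const (y := K₀))).tendsto K₀
    simpa using this
  have hA : Tendsto (fun K : SymBody => A K.h K.h) (𝓝 K₀) (𝓝 a) := continuous_A.tendsto K₀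
  have hb : Tendsto (fun K : SymBody => (√(A K.h K.h))⁻¹ * (√a)⁻¹ *
      ((3 * a - A K.h K.h + 4 * dist K K₀ * m + dist K K₀ ^ 2) / 2)) (𝓝 K₀) (𝓝 1) := by
    have h1 := ((hA.sqrt).inv₀ (Real.sqrt_pos.mpr ha0).ne').mul_const (√a)⁻¹
    have h2 := ((((tendsto_const_nhds (x := 3 * a)).sub hA).add
      ((hd.const_mul 4).mul_const m)).add (hd.pow 2)).div_const 2
    have h3 := h1.mul h2
    have e : (√a)⁻¹ * (√a)⁻¹ * ((3 * a - a + 4 * 0 * m + 0 ^ 2) / 2) = 1 := by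
      rw [← mul_inv, Real.mul_self_sqrt ha0.le]
      field_simp
      ring
    rwa [e] at h3
  have hform : Tendsto (fun K : SymBody => A (K.normalize.point K.A_normalize).vec
      (K₀.normalize.point K₀.A_normalize).vec) (𝓝 K₀) (𝓝[Ici 1] 1) := by
    rw [tendsto_nhdsWithin_iff]
    refine ⟨tendsto_of_tendsto_of_tendsto_of_le_of_le tendsto_const_nhds hb
      (fun K => HInf.one_le _ _) (fun K => ?_), Eventually.of_forall fun K => HInf.one_le _ _⟩
    have h1 := mixed_le dist_nonneg (h_le_add_dist K K₀)
    rw [A_add, ← ha, A_comm] at h1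
    change A K.normalize.h K₀.normalize.h ≤ _
    rw [h_normalize, h_normalize]
    simp only [map_smul, LinearMap.smul_apply, smul_eq_mul]
    rw [← ha, ← mul_assoc]
    have h0 : 0 ≤ (√(A K.h K.h))⁻¹ * (√a)⁻¹ := by positivity
    rw [mul_comm (√a)⁻¹]
    apply mul_le_mul_of_nonneg_left _ h0
    linarith
  have h4 := (Real.continuousOn_arcosh 1 (mem_Ici.mpr le_rfl)).tendsto.comp hform
  rw [Real.arcosh_zero] at h4
  exact h4

end SymBody

namespace CK

/-- The symmetric convex body with a given support function in `C_K`; it is unique by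
`SymBody.h_injective`. -/
def body (h : CK) : SymBody := h.2.choose

lemma h_body (h : CK) : (body h).h = h.1.vec :=
  Subtype.ext h.2.choose_spec.2.symm

lemma A_body (h : CK) : A (body h).h (body h).h = 1 := by
  rw [h_body]; exact h.1.2.1

/-- Convergence in the hyperbolic space implies convergence for the Hausdorff distance. -/
lemma continuous_body : Continuous body := by
  rw [continuous_iff_continuousAt]
  intro h₀
  obtain ⟨M, hM⟩ : ∃ M : ℝ, ∀ x, |h₀.1.fn x| ≤ M :=
    ⟨6 * normH1 h₀.1.vec, fun x => abs_le_normH1 h₀.1.vec x⟩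
  have hM0 : 0 ≤ M := (abs_nonneg _).trans (hM (circ 0))
  rw [ContinuousAt, tendsto_iff_dist_tendsto_zero]
  have hd : Tendsto (fun h : CK => dist h₀.1 h.1) (𝓝 h₀) (𝓝 0) := by
    have := ((continuous_const (y := h₀.1)).dist continuous_subtype_val).tendsto h₀
    simpa using this
  have hb : Tendsto (fun h : CK => (3 + M) * Real.sinh (dist h₀.1 h.1) +
      (Real.cosh (dist h₀.1 h.1) - 1) * M) (𝓝 h₀) (𝓝 0) := by
    have h1 := (Real.continuous_sinh.tendsto 0).comp hd
    have h2 := (Real.continuous_cosh.tendsto 0).comp hd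
    have := (h1.const_mul (3 + M)).add ((h2.sub_const 1).mul_const M)
    simpa using this
  refine squeeze_zero (fun _ => dist_nonneg) (fun h => ?_) hb
  have hc : A h₀.1.vec h.1.vec = Real.cosh (dist h₀.1 h.1) :=
    (Real.cosh_arcosh (HInf.one_le _ _)).symm
  have hs0 : 0 ≤ Real.sinh (dist h₀.1 h.1) := Real.sinh_nonneg_iff.mpr dist_nonneg
  have hc1 := Real.one_le_cosh (dist h₀.1 h.1)
  have hcs := Real.cosh_sq (dist h₀.1 h.1)
  set c := Real.cosh (dist h₀.1 h.1)
  set s := Real.sinh (dist h₀.1 h.1)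
  have h0 : A h₀.1.vec h₀.1.vec = 1 := h₀.1.2.1
  have h1 : A h.1.vec h.1.vec = 1 := h.1.2.1
  refine SymBody.dist_le (by positivity [sub_nonneg.mpr hc1]) fun x => ?_
  have hu : A h₀.1.vec (h.1.vec - c • h₀.1.vec) = 0 := by simp [hc, h0]
  have hA : -A (h.1.vec - c • h₀.1.vec) (h.1.vec - c • h₀.1.vec) = s ^ 2 := by
    simp only [map_sub, map_smul, smul_eq_mul, LinearMap.sub_apply, LinearMap.smul_apply, h0, h1,
      A_comm h.1.vec h₀.1.vec, hc]
    linear_combination hcs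
  have h2 := abs_le_of_orth h₀.1 _ hu x
  rw [hA, Real.sqrt_sq hs0] at h2
  rw [h_body, h_body]
  have e : h.1.vec.1 x - h₀.1.vec.1 x = (h.1.vec - c • h₀.1.vec).1 x + (c - 1) * h₀.1.fn x := by
    change _ = (h.1.vec.1 x - c * h₀.1.vec.1 x) + (c - 1) * h₀.1.vec.1 x
    ring
  rw [e]
  refine (abs_add_le _ _).trans (add_le_add (h2.trans ?_) ?_)
  · exact mul_le_mul_of_nonneg_right (by linarith [hM x]) hs0
  · rw [abs_mul, abs_of_nonneg (sub_nonneg.mpr hc1)]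
    exact mul_le_mul_of_nonneg_left (hM x) (sub_nonneg.mpr hc1)

lemma toCK_body (h : CK) : (body h).toCK = h := by
  apply Subtype.ext
  apply Subtype.ext
  change (body h).toCK.1.vec = h.1.vec
  rw [SymBody.vec_toCK, A_body, h_body]
  simp

end CK

/-! ### The two quotients -/

/-- The action `ρ` on support functions is the action of the matrices on the bodies. -/
lemma SymBody.even_image (g : SL(2, ℝ)) {h k : HInf} {K L : SymBody} (hK : h.fn = supp K.set)
    (hL : k.fn = supp L.set) :
    rho (QuotientGroup.mk g) h.even = k.even ↔
      L.set = act (g : Matrix (Fin 2) (Fin 2) ℝ) '' K.set := by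
  have e1 : (rho (QuotientGroup.mk g) h.even).1 = rhoFun g h.fn := rfl
  have e2 : supp ((K.image (Matrix.SpecialLinearGroup.toGL g)).set) = rhoFun g (supp K.set) :=
    supp_act g
  constructor
  · intro e
    have e3 : (K.image (Matrix.SpecialLinearGroup.toGL g)).h = L.h := by
      apply Subtype.ext
      change supp _ = supp _
      rw [e2, ← hL, ← hK, ← e1, e]
      rfl
    rw [← SymBody.h_injective e3]
    rfl
  · intro e
    apply Subtype.ext
    rw [e1, hK, ← e2]
    change _ = k.fn
    rw [hL, e]
    rfl

/-- A matrix of positive determinant, as an element of the group. -/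
def glPos (M : Matrix (Fin 2) (Fin 2) ℝ) (hM : 0 < M.det) : GL(2, ℝ)⁺ :=
  ⟨Matrix.GeneralLinearGroup.mkOfDetNeZero M hM.ne', hM⟩

lemma act_smul (c : ℝ) (M : Matrix (Fin 2) (Fin 2) ℝ) (x : Plane) :
    act (c • M) x = c • act M x := by
  simp [act]

lemma bm_smul {c : ℝ} (hc : 0 < c) (K : SymBody) : bmSetoid.r K (SymBody.smul c hc K) := by
  refine ⟨glPos (c • 1) (by simp; positivity), ?_⟩
  rw [SymBody.set_smul]
  ext x
  constructor
  · rintro ⟨k, hk, rfl⟩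
    refine ⟨k, hk, ?_⟩
    change act (c • 1) k = c • k
    rw [act_smul, act_one]
  · rintro ⟨k, hk, rfl⟩
    refine ⟨k, hk, ?_⟩
    change c • k = act (c • 1) k
    rw [act_smul, act_one]

/-- Functions of `C_K` in one orbit of `PSL₂(ℝ)` come from linearly equivalent bodies. -/
lemma bm_of_ck {h k : CK} (e : ckSetoid.r h k) : bmSetoid.r (CK.body h) (CK.body k) := by
  obtain ⟨g, hg⟩ := e
  obtain ⟨g, rfl⟩ := QuotientGroup.mk_surjective g
  have hh : h.1.fn = supp (CK.body h).set := h.2.choose_spec.2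
  have hk : k.1.fn = supp (CK.body k).set := k.2.choose_spec.2
  exact ⟨Matrix.SpecialLinearGroup.toGLPos g, (SymBody.even_image g hh hk).mp hg⟩

/-- An automorphism between bodies of equal area has determinant one. -/
lemma ck_of_bm {K L : SymBody} (e : bmSetoid.r K L) : ckSetoid.r K.toCK L.toCK := by
  have h1 : bmSetoid.r K.normalize L.normalize :=
    bmSetoid.trans (bmSetoid.trans (bmSetoid.symm (bm_smul _ K)) e) (bm_smul _ L)
  obtain ⟨g, hg⟩ := h1
  have hdet : 0 < ((g : GL (Fin 2) ℝ) : Matrix (Fin 2) (Fin 2) ℝ).det := g.2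
  have hv : volume L.normalize.set = _ := (congrArg volume hg).trans
    (SymBody.volume_image (g : GL (Fin 2) ℝ) K.normalize)
  rw [L.normalize.volume_eq_pi_iff.mpr L.A_normalize,
    K.normalize.volume_eq_pi_iff.mpr K.A_normalize, ← ENNReal.ofReal_mul (abs_nonneg _),
    ENNReal.ofReal_eq_ofReal_iff Real.pi_pos.le (by positivity), abs_of_pos hdet] at hv
  have h1 : ((g : GL (Fin 2) ℝ) : Matrix (Fin 2) (Fin 2) ℝ).det = 1 :=
    mul_right_cancel₀ Real.pi_ne_zero (by linarith)
  exact ⟨QuotientGroup.mk ⟨_, h1⟩, (SymBody.even_image ⟨_, h1⟩ rfl rfl).mpr hg⟩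

/-- The quotient of `C_K` is homeomorphic to the oriented Banach-Mazur compactum. -/
def quotientHomeomorph : CKQuotient ≃ₜ OrientedBanachMazur where
  toFun := Quotient.map CK.body fun _ _ => bm_of_ck
  invFun := Quotient.map SymBody.toCK fun _ _ => ck_of_bm
  left_inv := by
    intro q
    induction q using Quotient.inductionOn with
    | h h => exact congrArg _ (CK.toCK_body h)
  right_inv := by
    intro q
    induction q using Quotient.inductionOn with
    | h K =>
      have e : CK.body K.toCK = K.normalize := SymBody.h_injective (CK.h_body _)
      apply Quotient.sound
      rw [e]
      exact bmSetoid.symm (bm_smul _ K)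
  continuous_toFun := CK.continuous_body.quotient_map' _
  continuous_invFun := SymBody.continuous_toCK.quotient_map' _

lemma exists_point_of_volume (K : SymBody) (hK : volume K.set = ENNReal.ofReal π) :
    ∃ h : HInf, h.fn = supp K.set :=
  ⟨K.point (K.volume_eq_pi_iff.mp hK), rfl⟩

lemma exists_rho_mem (g : PSL2) (h : HInf) (hh : h ∈ CK) : ∃ k ∈ CK, k.even = rho g h.even := by
  obtain ⟨g, rfl⟩ := QuotientGroup.mk_surjective g
  obtain ⟨K, hK, e⟩ := hh
  have hv := SymBody.volume_image (Matrix.SpecialLinearGroup.toGL g) K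
  rw [Matrix.SpecialLinearGroup.coe_GL_coe_matrix, g.2, abs_one, ENNReal.ofReal_one, one_mul, hK,
    SymBody.volume_eq_pi_iff] at hv
  exact ⟨_, SymBody.point_mem _ hv, ((SymBody.even_image g e rfl).mpr rfl).symm⟩

/-! ### Segments and the boundary points that they define -/

lemma mem_symSegment {v k : Plane} (hk : k ∈ symSegment v) : ∃ t ∈ Icc (-1 : ℝ) 1, k = t • v := by
  obtain ⟨a, b, ha, hb, hab, rfl⟩ := hk
  refine ⟨b - a, ⟨by linarith, by linarith⟩, ?_⟩
  rw [sub_smul, smul_neg]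
  abel

lemma neg_mem_symSegment {v k : Plane} (hk : k ∈ symSegment v) : -k ∈ symSegment v := by
  obtain ⟨a, b, ha, hb, hab, rfl⟩ := hk
  refine ⟨b, a, hb, ha, by linarith, ?_⟩
  simp

lemma isBounded_symSegment (v : Plane) : Bornology.IsBounded (symSegment v) := by
  refine isBounded_iff_forall_norm_le.mpr ⟨‖v‖, fun k hk => ?_⟩
  obtain ⟨t, ht, rfl⟩ := mem_symSegment hk
  rw [norm_smul]
  exact mul_le_of_le_one_left (norm_nonneg _) (abs_le.mpr ht)

lemma supp_symSegment (v : Plane) (x : S1) : supp (symSegment v) x = |inner ℝ (x : Plane) v| := by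
  apply IsGreatest.csSup_eq
  constructor
  · rcases abs_choice (inner ℝ (x : Plane) v) with h | h
    · exact ⟨v, right_mem_segment _ _ _, h.symm⟩
    · exact ⟨-v, left_mem_segment _ _ _, by simp [h]⟩
  · rintro _ ⟨k, hk, rfl⟩
    obtain ⟨t, ht, rfl⟩ := mem_symSegment hk
    change inner ℝ (x : Plane) (t • v) ≤ _
    rw [inner_smul_right]
    refine (le_abs_self _).trans ?_
    rw [abs_mul]
    exact mul_le_of_le_one_left (abs_nonneg _) (abs_le.mpr ht)

/-- The support function of the segment from `-v` to `v`, in the Sobolev space. -/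
def segH (v : Plane) : H1even :=
  suppH1 (symSegment v) (isBounded_symSegment v) ⟨v, right_mem_segment _ _ _⟩
    fun _ => neg_mem_symSegment

lemma segH_apply (v : Plane) (x : S1) : (segH v).1 x = |inner ℝ (x : Plane) v| :=
  supp_symSegment v x

lemma ang_segH_smul_circ (r φ θ : ℝ) :
    ang (segH (r • (circ φ : Plane))).1 θ = |r| * |Real.cos (θ - φ)| := by
  rw [ang, segH_apply, inner_smul_right, abs_mul, inner_circ, circ_zero_apply, circ_one_apply,
    Real.cos_sub]

lemma deriv_periodic {f : ℝ → ℝ} {c : ℝ} (hf : Function.Periodic f c) :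
    Function.Periodic (deriv f) c := by
  intro θ
  rw [← deriv_comp_add_const]
  congr 1
  exact funext hf

lemma integral_two_pi_eq {F : ℝ → ℝ} (hF : Function.Periodic F π)
    (hi : IntervalIntegrable F volume 0 (2 * π)) (x : ℝ) :
    ∫ θ in (0)..(2 * π), F θ = 2 * ∫ θ in x..(x + π), F θ := by
  have hpi := Real.pi_pos
  have e2 := hF.intervalIntegral_add_eq 0 π
  have e3 := hF.intervalIntegral_add_eq 0 x
  have hsplit := intervalIntegral.integral_add_adjacent_intervals (a := 0) (b := π)
    (c := 2 * π) (μ := volume) (f := F)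
    (hi.mono_set (by
      rw [uIcc_of_le (by linarith), uIcc_of_le (by linarith)]
      exact Icc_subset_Icc le_rfl (by linarith)))
    (hi.mono_set (by
      rw [uIcc_of_le (by linarith), uIcc_of_le (by linarith)]
      exact Icc_subset_Icc (by linarith) le_rfl))
  rw [show π + π = 2 * π by ring, zero_add] at e2
  rw [zero_add] at e3
  linarith

/-- The form against the support function of a segment is an evaluation. Indeed the measure
`k + k''` of the support function `k` of a segment consists of two equal masses. -/
lemma A_segH (h : H1even) (r : ℝ) {φ : ℝ} (hφ : φ ∈ Icc (π / 2) (3 * π / 2)) :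
    A h (segH (r • (circ φ : Plane))) = 2 * |r| / π * h.1 (circ (φ + π / 2)) := by
  have hpi := Real.pi_pos
  set k := segH (r • (circ φ : Plane)) with hk
  have hkper := ang_periodic k
  have hhper := ang_periodic h
  have hper : Function.Periodic (dens h.1 k.1) π := fun θ => by
    simp only [dens, hkper θ, hhper θ, deriv_periodic hkper θ, deriv_periodic hhper θ]
  have h1 : A h k = 1 / (2 * π) * ∫ θ in (0)..(2 * π), dens h.1 k.1 θ := rfl
  rw [h1, integral_two_pi_eq hper (int_dens h k) (φ - π / 2)]
  have hle : φ - π / 2 ≤ φ - π / 2 + π := by linarith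
  have hac : AbsolutelyContinuousOnInterval (ang h.1) (φ - π / 2) (φ - π / 2 + π) := by
    refine h.2.2.1.mono ?_
    rw [uIcc_of_le hle, uIcc_of_le (by linarith)]
    exact Icc_subset_Icc (by linarith [hφ.1]) (by linarith [hφ.2])
  have hsd : ∀ θ, HasDerivAt (fun t => |r| * Real.sin (t - φ)) (|r| * Real.cos (θ - φ)) θ :=
    fun θ => by
      have := ((Real.hasDerivAt_sin (θ - φ)).comp θ ((hasDerivAt_id θ).sub_const φ)).const_mul |r|
      simpa using this
  have hcd : ∀ θ, HasDerivAt (fun t => |r| * Real.cos (t - φ)) (-(|r| * Real.sin (θ - φ))) θ :=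
    fun θ => by
      have := ((Real.hasDerivAt_cos (θ - φ)).comp θ ((hasDerivAt_id θ).sub_const φ)).const_mul |r|
      simpa using this
  have hsac : AbsolutelyContinuousOnInterval (fun t => |r| * Real.sin (t - φ))
      (φ - π / 2) (φ - π / 2 + π) := by
    apply ContDiffOn.absolutelyContinuousOnInterval
    exact ContDiff.contDiffOn (by fun_prop)
  have h2 := hac.integral_deriv_mul_eq_sub hsac
  have h3 : ∫ θ in (φ - π / 2)..(φ - π / 2 + π), dens h.1 k.1 θ =
      ∫ θ in (φ - π / 2)..(φ - π / 2 + π), (deriv (ang h.1) θ * (|r| * Real.sin (θ - φ)) +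
        ang h.1 θ * deriv (fun t => |r| * Real.sin (t - φ)) θ) := by
    rw [intervalIntegral.integral_of_le hle, intervalIntegral.integral_of_le hle,
      integral_Ioc_eq_integral_Ioo, integral_Ioc_eq_integral_Ioo]
    refine setIntegral_congr_fun measurableSet_Ioo fun θ hθ => ?_
    have hloc : ∀ t ∈ Ioo (φ - π / 2) (φ - π / 2 + π), ang k.1 t = |r| * Real.cos (t - φ) := by
      intro t ht
      rw [hk, ang_segH_smul_circ, abs_of_nonneg (Real.cos_nonneg_of_neg_pi_div_two_le_of_le
        (by linarith [ht.1]) (by linarith [ht.2]))]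
    have hd : deriv (ang k.1) θ = -(|r| * Real.sin (θ - φ)) := by
      rw [← (hcd θ).deriv]
      apply Filter.EventuallyEq.deriv_eq
      filter_upwards [isOpen_Ioo.mem_nhds hθ] with t ht using hloc t ht
    simp only [dens, hd, hloc θ hθ, (hsd θ).deriv]
    ring
  rw [h3, h2]
  have e1 : φ - π / 2 + π = φ + π / 2 := by ring
  have e2 : ang h.1 (φ - π / 2) = ang h.1 (φ + π / 2) := by
    rw [← hhper (φ - π / 2), e1]
  rw [e2, e1, add_sub_cancel_left, sub_sub_cancel_left, Real.sin_neg, Real.sin_pi_div_two, ang]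
  field_simp
  ring

/-- Polar coordinates; the sign of the radius is not fixed, so that the angle can be taken in an
interval of length `π`. -/
lemma exists_polar (v : Plane) : ∃ r : ℝ, ∃ φ ∈ Icc (π / 2) (3 * π / 2),
    v = r • (circ φ : Plane) ∧ ‖v‖ = |r| := by
  have hpi := Real.pi_pos
  have hmain : ∃ r : ℝ, ∃ φ ∈ Icc (π / 2) (3 * π / 2), v = r • (circ φ : Plane) := by
    rcases eq_or_ne v 0 with rfl | hv
    · exact ⟨0, π, ⟨by linarith, by linarith⟩, by simp⟩
    have hpos : 0 < ‖v‖ := norm_pos_iff.mpr hv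
    obtain ⟨φ, hφ, e⟩ := circ_surj ⟨‖v‖⁻¹ • v, by
      rw [mem_sphere_iff_norm, sub_zero, norm_smul, norm_inv, norm_norm, inv_mul_cancel₀ hpos.ne']⟩
    have e1 : v = ‖v‖ • (circ φ : Plane) := by
      rw [e]
      simp only
      rw [smul_smul, mul_inv_cancel₀ hpos.ne', one_smul]
    rcases le_total (π / 2) φ with h | h
    · exact ⟨‖v‖, φ, ⟨h, by linarith [hφ.2]⟩, e1⟩
    · rcases le_total (-(π / 2)) φ with h' | h'
      · refine ⟨-‖v‖, φ + π, ⟨by linarith, by linarith⟩, ?_⟩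
        rw [circ_add_pi]
        simpa using e1
      · refine ⟨‖v‖, φ + 2 * π, ⟨by linarith [hφ.1], by linarith⟩, ?_⟩
        rwa [circ_periodic]
  obtain ⟨r, φ, hφ, e⟩ := hmain
  refine ⟨r, φ, hφ, e, ?_⟩
  rw [e, norm_smul, norm_circ, mul_one, Real.norm_eq_abs]

lemma A_segH_segH (r s : ℝ) {φ : ℝ} (hφ : φ ∈ Icc (π / 2) (3 * π / 2)) (ψ : ℝ) :
    A (segH (s • (circ ψ : Plane))) (segH (r • (circ φ : Plane))) =
      2 * |r| * |s| / π * |Real.sin (φ - ψ)| := by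
  rw [A_segH _ _ hφ]
  have := ang_segH_smul_circ s ψ (φ + π / 2)
  rw [ang] at this
  rw [this, show φ + π / 2 - ψ = φ - ψ + π / 2 by ring, Real.cos_add_pi_div_two, abs_neg]
  ring

lemma mean_segH (v : Plane) : mean (segH v) = 2 * ‖v‖ / π := by
  obtain ⟨r, φ, hφ, e, hr⟩ := exists_polar v
  rw [hr, ← A_one, e, A_segH _ _ hφ]
  simp [one]

lemma A_segH_self (v : Plane) : A (segH v) (segH v) = 0 := by
  obtain ⟨r, φ, hφ, e, hr⟩ := exists_polar v
  rw [e, A_segH_segH _ _ hφ]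
  simp

lemma segH_ne_zero {v : Plane} (hv : v ≠ 0) : segH v ≠ 0 := by
  intro h
  have h1 := mean_segH v
  rw [h, ← A_one, map_zero] at h1
  have : 0 < 2 * ‖v‖ / π := by
    have := norm_pos_iff.mpr hv
    have := Real.pi_pos
    positivity
  linarith

namespace Boundary

lemma mem_line_iff (ζ : Boundary) (h : H1even) : h ∈ ζ.line ↔ ∃ a : ℝ, a • ζ.1.rep = h := by
  rw [line, Projectivization.submodule_eq, Submodule.mem_span_singleton]

lemma A_of_mem_line {ζ : Boundary} {h : H1even} (hh : h ∈ ζ.line) : A h h = 0 := by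
  obtain ⟨a, rfl⟩ := (mem_line_iff ζ h).mp hh
  simp [ζ.2]

lemma unitRep_of_mem_line {ζ : Boundary} {h : H1even} (hh : h ∈ ζ.line) (h0 : h ≠ 0) :
    ζ.unitRep = (mean h)⁻¹ • h := by
  obtain ⟨a, rfl⟩ := (mem_line_iff ζ h).mp hh
  have ha : a ≠ 0 := fun h => h0 (by rw [h, zero_smul])
  rw [unitRep, ← A_one, ← A_one, map_smul, smul_smul, smul_eq_mul, mul_inv, mul_comm a⁻¹, mul_assoc,
    inv_mul_cancel₀ ha, mul_one]

lemma eq_of_unitRep_eq {ζ η : Boundary} (h : ζ.unitRep = η.unitRep) : ζ = η := by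
  apply dist_eq_zero.mp
  change visualDist ζ η = 0
  rw [visualDist_eq, velocity, velocity, h]
  simp

/-- The boundary point of an isotropic vector. -/
def mk (h : H1even) (h0 : h ≠ 0) (hA : A h h = 0) : Boundary :=
  ⟨Projectivization.mk ℝ h h0, by
    obtain ⟨a, ha⟩ := Projectivization.exists_smul_eq_mk_rep ℝ h h0
    rw [← ha]
    simp only [Units.smul_def, map_smul, LinearMap.smul_apply, hA, smul_zero]⟩

lemma mem_line_mk (h : H1even) (h0 : h ≠ 0) (hA : A h h = 0) : h ∈ (mk h h0 hA).line := by
  rw [line, mk, Projectivization.submodule_mk]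
  exact Submodule.mem_span_singleton_self h

end Boundary

lemma isDirection_iff (ζ : Boundary) (v : Plane) : IsDirection ζ v ↔ v ≠ 0 ∧ segH v ∈ ζ.line := by
  constructor
  · rintro ⟨hv, h, hh, e⟩
    refine ⟨hv, ?_⟩
    have : segH v = h := Subtype.ext e.symm
    rwa [this]
  · rintro ⟨hv, h⟩
    exact ⟨hv, _, h, rfl⟩

lemma existsUnique_isDirection (v : Plane) (hv : v ≠ 0) : ∃! ζ : Boundary, IsDirection ζ v := by
  refine ⟨Boundary.mk (segH v) (segH_ne_zero hv) (A_segH_self v),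
    (isDirection_iff _ _).mpr ⟨hv, Boundary.mem_line_mk _ _ _⟩, fun η hη => ?_⟩
  apply Boundary.eq_of_unitRep_eq
  rw [Boundary.unitRep_of_mem_line ((isDirection_iff _ _).mp hη).2 (segH_ne_zero hv),
    Boundary.unitRep_of_mem_line (Boundary.mem_line_mk _ _ _) (segH_ne_zero hv)]

lemma dist_eq_of_polar {ζ η : Boundary} {r s φ ψ : ℝ}
    (hζ : IsDirection ζ (r • (circ φ : Plane))) (hη : IsDirection η (s • (circ ψ : Plane)))
    (hφ : φ ∈ Icc (π / 2) (3 * π / 2)) :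
    dist ζ η = √π / 2 * √|Real.sin (φ - ψ)| := by
  have hpi := Real.pi_pos
  obtain ⟨hv, hζ⟩ := (isDirection_iff _ _).mp hζ
  obtain ⟨hw, hη⟩ := (isDirection_iff _ _).mp hη
  have hr : 0 < |r| := abs_pos.mpr (left_ne_zero_of_smul hv)
  have hs : 0 < |s| := abs_pos.mpr (left_ne_zero_of_smul hw)
  change Boundary.visualDist ζ η = _
  have e1 : -A (ζ.velocity - η.velocity) (ζ.velocity - η.velocity) = π * |Real.sin (φ - ψ)| := by
    have : ζ.velocity - η.velocity = ζ.unitRep - η.unitRep := by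
      simp [Boundary.velocity]
    rw [this]
    have h2 : A η.unitRep ζ.unitRep = π / 2 * |Real.sin (φ - ψ)| := by
      rw [Boundary.unitRep_of_mem_line hζ (segH_ne_zero hv),
        Boundary.unitRep_of_mem_line hη (segH_ne_zero hw), mean_segH, mean_segH]
      simp only [map_smul, LinearMap.smul_apply, smul_eq_mul, A_segH_segH _ _ hφ, norm_smul,
        norm_circ, Real.norm_eq_abs, mul_one]
      field_simp
    simp only [map_sub, LinearMap.sub_apply, Boundary.A_unitRep, A_comm ζ.unitRep η.unitRep, h2]
    ring
  rw [Boundary.visualDist_eq, e1, Real.sqrt_mul hpi.le]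
  ring

lemma sin_angle_polar {r s : ℝ} (hr : r ≠ 0) (hs : s ≠ 0) (φ ψ : ℝ) :
    Real.sin (InnerProductGeometry.angle (r • (circ φ : Plane)) (s • (circ ψ : Plane))) =
      |Real.sin (φ - ψ)| := by
  have h1 := InnerProductGeometry.cos_angle (r • (circ φ : Plane)) (s • (circ ψ : Plane))
  rw [inner_smul_left, inner_smul_right, norm_smul, norm_smul, norm_circ, norm_circ, inner_circ,
    circ_zero_apply, circ_one_apply, ← Real.cos_sub, RCLike.conj_to_real, mul_one, mul_one,
    Real.norm_eq_abs, Real.norm_eq_abs] at h1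
  have h2 : Real.cos (InnerProductGeometry.angle (r • (circ φ : Plane)) (s • (circ ψ : Plane))) ^ 2
      = Real.cos (φ - ψ) ^ 2 := by
    rw [h1, div_pow, mul_pow |r|, sq_abs, sq_abs]
    field_simp
  rw [← abs_of_nonneg (InnerProductGeometry.sin_angle_nonneg (r • (circ φ : Plane))
    (s • (circ ψ : Plane))), ← sq_eq_sq_iff_abs_eq_abs, Real.sin_sq, Real.sin_sq, h2]

lemma dist_of_isDirection (ζ η : Boundary) (v w : Plane) (hζ : IsDirection ζ v)
    (hη : IsDirection η w) :
    dist ζ η = √π / 2 * √(Real.sin (InnerProductGeometry.angle v w)) := by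
  obtain ⟨r, φ, hφ, rfl, -⟩ := exists_polar v
  obtain ⟨s, ψ, hψ, rfl, -⟩ := exists_polar w
  rw [dist_eq_of_polar hζ hη hφ, sin_angle_polar (left_ne_zero_of_smul hζ.1)
    (left_ne_zero_of_smul hη.1)]

/-! ### The Hausdorff dimension of the set of boundary points of segments -/

/-- The boundary point of the segment of direction `circ φ`. -/
def dirPoint (φ : ℝ) : Boundary :=
  Boundary.mk (segH (circ φ)) (segH_ne_zero (S1.ne_zero _)) (A_segH_self _)

lemma isDirection_dirPoint (φ : ℝ) : IsDirection (dirPoint φ) (circ φ) :=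
  (isDirection_iff _ _).mpr ⟨S1.ne_zero _, Boundary.mem_line_mk _ _ _⟩

lemma dist_dirPoint (φ ψ : ℝ) :
    dist (dirPoint φ) (dirPoint ψ) = √π / 2 * √|Real.sin (φ - ψ)| := by
  rw [dist_of_isDirection _ _ _ _ (isDirection_dirPoint φ) (isDirection_dirPoint ψ)]
  have := sin_angle_polar one_ne_zero one_ne_zero φ ψ
  rw [one_smul, one_smul] at this
  rw [this]

lemma Gam_eq_range : Gam = range dirPoint := by
  ext ζ
  constructor
  · rintro ⟨v, hv⟩
    obtain ⟨r, φ, hφ, rfl, -⟩ := exists_polar v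
    refine ⟨φ, ?_⟩
    apply dist_eq_zero.mp
    have h1 : IsDirection (dirPoint φ) ((1 : ℝ) • (circ φ : Plane)) := by
      rw [one_smul]; exact isDirection_dirPoint φ
    rw [dist_eq_of_polar h1 hv hφ]
    simp
  · rintro ⟨φ, rfl⟩
    exact ⟨_, isDirection_dirPoint φ⟩

/-- The distance is comparable to the square root of the angle, which is what doubles the
dimension. -/
lemma holderWith_dirPoint : HolderWith 1 (1 / 2) dirPoint := by
  intro φ ψ
  rw [edist_dist, edist_dist, ENNReal.ofReal_rpow_of_nonneg dist_nonneg (by positivity),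
    ENNReal.coe_one, one_mul, dist_dirPoint]
  apply ENNReal.ofReal_le_ofReal
  push_cast
  rw [← Real.sqrt_eq_rpow, Real.dist_eq]
  have h1 : √π / 2 ≤ 1 := by
    have : √π ≤ 2 := Real.sqrt_le_iff.mpr ⟨by norm_num, by linarith [Real.pi_lt_four]⟩
    linarith
  calc √π / 2 * √|Real.sin (φ - ψ)| ≤ 1 * √|φ - ψ| := by
        apply mul_le_mul h1 (Real.sqrt_le_sqrt Real.abs_sin_le_abs) (Real.sqrt_nonneg _)
          zero_le_one
    _ = _ := one_mul _

/-- The distance between boundary points of directions at angle less than `π / 2`. -/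
lemma abs_sub_le_dist_sq {φ ψ : ℝ} (h : |φ - ψ| ≤ π / 2) :
    |φ - ψ| ≤ 2 * dist (dirPoint φ) (dirPoint ψ) ^ 2 := by
  have hpi := Real.pi_pos
  rw [dist_dirPoint, mul_pow, div_pow, Real.sq_sqrt hpi.le, Real.sq_sqrt (abs_nonneg _)]
  have h1 := Real.mul_abs_le_abs_sin h
  have h2 : 2 / π * |φ - ψ| * π = 2 * |φ - ψ| := by field_simp
  nlinarith

lemma dimH_Gam : dimH Gam = 2 := by
  rw [Gam_eq_range]
  apply le_antisymm
  · have h1 := holderWith_dirPoint.dimH_range_le (by positivity)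
    rw [Real.dimH_univ] at h1
    refine h1.trans (le_of_eq ?_)
    rw [ENNReal.coe_div two_ne_zero, ENNReal.coe_one, one_div, one_div, inv_inv]
    rfl
  · have hpi := Real.pi_gt_three
    have hinj : InjOn dirPoint (Icc 0 1) := by
      intro φ hφ ψ hψ e
      have h1 : |φ - ψ| ≤ π / 2 :=
        abs_le.mpr ⟨by linarith [hφ.1, hψ.2], by linarith [hφ.2, hψ.1]⟩
      have h2 := abs_sub_le_dist_sq h1
      rw [e, dist_self] at h2
      have h3 := abs_nonneg (φ - ψ)
      have h4 : |φ - ψ| = 0 := by linarith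
      linarith [abs_eq_zero.mp h4]
    set f := Function.invFunOn dirPoint (Icc (0 : ℝ) 1) with hf
    have hfl : ∀ φ ∈ Icc (0 : ℝ) 1, f (dirPoint φ) = φ := fun φ hφ =>
      hinj.leftInvOn_invFunOn hφ
    have hH : HolderOnWith 2 2 f (dirPoint '' Icc 0 1) := by
      rintro _ ⟨φ, hφ, rfl⟩ _ ⟨ψ, hψ, rfl⟩
      rw [hfl φ hφ, hfl ψ hψ]
      have h1 : |φ - ψ| ≤ π / 2 :=
        abs_le.mpr ⟨by linarith [hφ.1, hψ.2], by linarith [hφ.2, hψ.1]⟩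
      have h2 := abs_sub_le_dist_sq h1
      rw [edist_dist, edist_dist, Real.dist_eq, NNReal.coe_ofNat,
        ENNReal.rpow_ofNat, ← ENNReal.ofReal_pow dist_nonneg,
        show ((2 : NNReal) : ENNReal) = ENNReal.ofReal 2 by simp,
        ← ENNReal.ofReal_mul zero_le_two]
      exact ENNReal.ofReal_le_ofReal h2
    have h1 := hH.dimH_image_le (by norm_num)
    have h2 : f '' (dirPoint '' Icc 0 1) = Icc 0 1 := by
      rw [image_image]
      ext x
      constructor
      · rintro ⟨y, hy, rfl⟩
        simpa only [hfl y hy] using hy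
      · exact fun hx => ⟨x, hx, hfl x hx⟩
    rw [h2, Real.dimH_of_nonempty_interior (by rw [interior_Icc]; exact ⟨1 / 2, by norm_num⟩),
      Module.finrank_self, Nat.cast_one, ENNReal.le_div_iff_mul_le (by simp) (by simp), one_mul]
      at h1
    exact h1.trans (dimH_mono (image_subset_range _ _))

/-! ### Ellipses of area `π` and the embedding of the upper half-plane -/

lemma norm_sq_act_transpose (M : Matrix (Fin 2) (Fin 2) ℝ) (x : Plane) :
    ‖act M.transpose x‖ ^ 2 = (M 0 0 ^ 2 + M 0 1 ^ 2) * x 0 ^ 2 +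
      2 * (M 0 0 * M 1 0 + M 0 1 * M 1 1) * (x 0 * x 1) + (M 1 0 ^ 2 + M 1 1 ^ 2) * x 1 ^ 2 := by
  rw [norm_sq_plane, act_apply_zero, act_apply_one]
  simp only [Matrix.transpose_apply]
  ring

/-- The quadratic form `x ↦ |gᵀ x|²` in terms of the point `z = g • i`. -/
def ellipseForm (z : UpperHalfPlane) (x : Plane) : ℝ :=
  (Complex.normSq z * x 0 ^ 2 + 2 * z.re * (x 0 * x 1) + x 1 ^ 2) / z.im

lemma norm_sq_act_SL (g : SL(2, ℝ)) (x : Plane) :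
    ‖act (g : Matrix (Fin 2) (Fin 2) ℝ).transpose x‖ ^ 2 =
      ellipseForm (g • UpperHalfPlane.I) x := by
  have hdet : g 0 0 * g 1 1 - g 0 1 * g 1 0 = 1 := by
    have := g.2
    rwa [Matrix.det_fin_two] at this
  have hD : 0 < g 1 0 ^ 2 + g 1 1 ^ 2 := by
    by_contra h
    have h1 : g 1 0 = 0 := by nlinarith [sq_nonneg (g 1 0), sq_nonneg (g 1 1)]
    have h2 : g 1 1 = 0 := by nlinarith [sq_nonneg (g 1 0), sq_nonneg (g 1 1)]
    rw [h1, h2] at hdet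
    norm_num at hdet
  have hz : ((g • UpperHalfPlane.I : UpperHalfPlane) : ℂ) =
      ⟨(g 0 0 * g 1 0 + g 0 1 * g 1 1) / (g 1 0 ^ 2 + g 1 1 ^ 2),
        1 / (g 1 0 ^ 2 + g 1 1 ^ 2)⟩ := by
    rw [UpperHalfPlane.coe_specialLinearGroup_apply]
    have hne : ((g 1 0 : ℝ) : ℂ) * Complex.I + ((g 1 1 : ℝ) : ℂ) ≠ 0 := by
      intro h
      have h1 := congrArg Complex.normSq h
      rw [add_comm, Complex.normSq_add_mul_I, Complex.normSq_zero] at h1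
      linarith
    simp only [Algebra.algebraMap_self, RingHom.id_apply, UpperHalfPlane.coe_I]
    rw [div_eq_iff hne]
    apply Complex.ext
    · simp only [Complex.add_re, Complex.mul_re, Complex.ofReal_re, Complex.ofReal_im,
        Complex.I_re, Complex.I_im, Complex.add_im, Complex.mul_im]
      field_simp
      linear_combination (-g 1 0) * hdet
    · simp only [Complex.add_re, Complex.mul_re, Complex.ofReal_re, Complex.ofReal_im,
        Complex.I_re, Complex.I_im, Complex.add_im, Complex.mul_im]
      field_simp
      linear_combination (g 1 1) * hdet
  have hre : (g • UpperHalfPlane.I : UpperHalfPlane).re =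
      (g 0 0 * g 1 0 + g 0 1 * g 1 1) / (g 1 0 ^ 2 + g 1 1 ^ 2) := congrArg Complex.re hz
  have him : (g • UpperHalfPlane.I : UpperHalfPlane).im =
      1 / (g 1 0 ^ 2 + g 1 1 ^ 2) := congrArg Complex.im hz
  rw [ellipseForm, hre, him, hz, Complex.normSq_mk, norm_sq_act_transpose]
  field_simp
  linear_combination ((g 0 0 * g 1 1 - g 0 1 * g 1 0 + 1) * x 0 ^ 2) * hdet

/-- A matrix that maps the disc to the ellipse given by a point of the upper half-plane. -/
def ellipseMatrix (z : UpperHalfPlane) : SL(2, ℝ) :=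
  ⟨!![√z.im, z.re / √z.im; 0, 1 / √z.im], by
    have := Real.sqrt_pos.mpr z.im_pos
    rw [Matrix.det_fin_two_of]
    field_simp
    ring⟩

lemma norm_sq_act_ellipseMatrix (z : UpperHalfPlane) (x : Plane) :
    ‖act (ellipseMatrix z : Matrix (Fin 2) (Fin 2) ℝ).transpose x‖ ^ 2 = ellipseForm z x := by
  have h0 := z.im_pos
  have h1 := Real.sq_sqrt h0.le
  have h2 := Real.sqrt_pos.mpr h0
  rw [norm_sq_act_transpose, ellipseForm, Complex.normSq_apply, ellipseMatrix]
  simp only [Matrix.of_apply, Matrix.cons_val_zero, Matrix.cons_val_one, UpperHalfPlane.coe_re,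
    UpperHalfPlane.coe_im, Matrix.cons_val', Matrix.cons_val_fin_one]
  set s := √z.im
  rw [← h1]
  field_simp
  ring

/-- The support function of the ellipse given by a point of the upper half-plane. -/
def ellipsePoint (z : UpperHalfPlane) : HInf :=
  (SymBody.unitDisc.image (Matrix.SpecialLinearGroup.toGL (ellipseMatrix z))).point (by
    have hv := SymBody.volume_image (Matrix.SpecialLinearGroup.toGL (ellipseMatrix z))
      SymBody.unitDisc
    rw [Matrix.SpecialLinearGroup.coe_GL_coe_matrix, (ellipseMatrix z).2, abs_one,
      ENNReal.ofReal_one, one_mul, (SymBody.volume_eq_pi_iff SymBody.unitDisc).mpr (by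
        rw [SymBody.h_unitDisc, A_one_one]), SymBody.volume_eq_pi_iff] at hv
    exact hv)

lemma ellipsePoint_fn (z : UpperHalfPlane) (x : S1) :
    (ellipsePoint z).fn x = √(ellipseForm z x) := by
  rw [← norm_sq_act_ellipseMatrix, Real.sqrt_sq (norm_nonneg _)]
  exact supp_act_disc _ x

lemma ellipsePoint_smul_I (g : SL(2, ℝ)) : (ellipsePoint (g • UpperHalfPlane.I)).fn =
    supp (act (g : Matrix (Fin 2) (Fin 2) ℝ) '' disc) := by
  funext x
  rw [ellipsePoint_fn, ← norm_sq_act_SL, Real.sqrt_sq (norm_nonneg _), supp_act_disc]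

/-! ### Hyperbolic spans and Minkowski sums of ellipses -/

/-- The direction of slope `t`. -/
lemma circ_arctan (t : ℝ) : (circ (Real.arctan t) : Plane) 0 = 1 / √(1 + t ^ 2) ∧
    (circ (Real.arctan t) : Plane) 1 = t / √(1 + t ^ 2) := by
  rw [circ_zero_apply, circ_one_apply, Real.cos_arctan, Real.sin_arctan]
  exact ⟨rfl, rfl⟩

lemma sqrt_form_circ_arctan (a b c t : ℝ) :
    √(a * (circ (Real.arctan t) : Plane) 0 ^ 2 +
      2 * b * ((circ (Real.arctan t) : Plane) 0 * (circ (Real.arctan t) : Plane) 1) +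
      c * (circ (Real.arctan t) : Plane) 1 ^ 2) =
    √(a + 2 * b * t + c * t ^ 2) / √(1 + t ^ 2) := by
  obtain ⟨h0, h1⟩ := circ_arctan t
  have hp : 0 < 1 + t ^ 2 := by positivity
  rw [h0, h1, ← Real.sqrt_div' _ hp.le]
  congr 1
  have hs := Real.sq_sqrt hp.le
  have hs' := Real.sqrt_pos.mpr hp
  rw [← hs]
  simp only [Real.sqrt_sq hs'.le]
  field_simp

/-- Square roots of pairwise nonproportional definite quadratic forms are linearly independent on
the circle. -/
lemma sqrt_form_indep {ι : Type*} [Fintype ι] (a b c : ι → ℝ) (ha : ∀ i, 0 < a i)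
    (hd : ∀ i, 0 < a i * c i - b i ^ 2)
    (hne : ∀ i j, i ≠ j → ¬ ∃ r : ℝ, a i = r * a j ∧ b i = r * b j ∧ c i = r * c j) (m : ι → ℝ)
    (h : ∀ x : S1, ∑ i, m i * √(a i * (x : Plane) 0 ^ 2 +
      2 * b i * ((x : Plane) 0 * (x : Plane) 1) + c i * (x : Plane) 1 ^ 2) = 0) (i : ι) :
    m i = 0 := by
  refine sqrt_quad_indep a b c ha hd hne m (fun t => ?_) i
  have h1 := h (circ (Real.arctan t))
  simp only [sqrt_form_circ_arctan, mul_div_assoc', ← Finset.sum_div] at h1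
  exact (div_eq_zero_iff.mp h1).resolve_right (Real.sqrt_pos.mpr (by positivity)).ne'

lemma ellipseForm_eq (z : UpperHalfPlane) (x : Plane) : ellipseForm z x =
    (Complex.normSq z / z.im) * x 0 ^ 2 + 2 * (z.re / z.im) * (x 0 * x 1) +
      (1 / z.im) * x 1 ^ 2 := by
  rw [ellipseForm]
  ring

lemma ellipseForm_disc (z : UpperHalfPlane) :
    (Complex.normSq z / z.im) * (1 / z.im) - (z.re / z.im) ^ 2 = 1 := by
  have h0 := z.im_pos
  rw [Complex.normSq_apply, UpperHalfPlane.coe_re, UpperHalfPlane.coe_im]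
  field_simp
  ring

/-- Distinct ellipses of area `π` have independent support functions: their quadratic forms have
determinant one, so that proportional forms are equal. -/
lemma linearIndependent_ellipsePoint {n : ℕ} (p : Fin n → HInf) (hp : Function.Injective p)
    (hr : ∀ k, p k ∈ range ellipsePoint) : LinearIndependent ℝ fun k => (p k).vec := by
  choose z hz using hr
  rw [Fintype.linearIndependent_iff]
  intro m hm
  have hfn : ∀ k x, (p k).fn x = √((Complex.normSq (z k) / (z k).im) * (x : Plane) 0 ^ 2 +
      2 * ((z k).re / (z k).im) * ((x : Plane) 0 * (x : Plane) 1) +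
      (1 / (z k).im) * (x : Plane) 1 ^ 2) := fun k x => by
    rw [← hz k, ellipsePoint_fn, ellipseForm_eq]
  refine sqrt_form_indep (fun k => Complex.normSq (z k) / (z k).im) (fun k => (z k).re / (z k).im)
    (fun k => 1 / (z k).im) (fun k => ?_) (fun k => ?_) (fun j k hjk => ?_) m (fun x => ?_)
  · exact div_pos (Complex.normSq_pos.mpr (UpperHalfPlane.ne_zero (z k))) (z k).im_pos
  · rw [ellipseForm_disc]; exact one_pos
  · rintro ⟨r, h1, h2, h3⟩
    have d1 := ellipseForm_disc (z j)
    have d2 := ellipseForm_disc (z k)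
    rw [h1, h2, h3] at d1
    have hr2 : r ^ 2 = 1 := by
      linear_combination d1 - r ^ 2 * d2
    have hr0 : 0 < r := by
      have p1 := one_div_pos.mpr (z j).im_pos
      have p2 := one_div_pos.mpr (z k).im_pos
      rw [h3] at p1
      exact pos_of_mul_pos_left p1 p2.le
    have hr1 : r = 1 := by nlinarith
    rw [hr1, one_mul] at h1 h2 h3
    apply hjk
    apply hp
    apply Subtype.ext
    apply Subtype.ext
    funext x
    change (p j).fn x = (p k).fn x
    rw [hfn, hfn, h1, h2, h3]
  · have := congrFun (congrArg Subtype.val hm) x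
    rw [Submodule.coe_sum, Finset.sum_apply] at this
    rw [show (0 : ℝ) = (0 : H1even).1 x from rfl, ← this]
    refine Finset.sum_congr rfl fun k _ => ?_
    rw [← hfn]
    rfl

/-- The hyperbolic span of linearly independent points is cut out by their linear span, as every
linear subspace through these points contains it. -/
lemma isHyperbolicSubspace_hyperbolicSpan {n : ℕ} (p : Fin (n + 1) → HInf)
    (hp : LinearIndependent ℝ fun k => (p k).vec) :
    IsHyperbolicSubspace n (hyperbolicSpan (range p)) := by
  set W := Submodule.span ℝ (range fun k => (p k).vec) with hW
  have hfd : FiniteDimensional ℝ W := FiniteDimensional.span_of_finite ℝ (finite_range _)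
  have hrank : Module.finrank ℝ W = n + 1 := by
    rw [hW, finrank_span_eq_card hp, Fintype.card_fin]
  have hmem : ∀ k, (p k).vec ∈ W := fun k => Submodule.subset_span ⟨k, rfl⟩
  have hsub : IsHyperbolicSubspace n {x | x.vec ∈ W} := ⟨⟨p 0, hmem 0⟩, W, hfd, hrank, rfl⟩
  have : hyperbolicSpan (range p) = {x | x.vec ∈ W} := by
    apply Subset.antisymm
    · exact sInter_subset_of_mem ⟨by rintro _ ⟨k, rfl⟩; exact hmem k, n, hsub⟩
    · rintro x hx X ⟨hX, m, -, V, -, -, rfl⟩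
      have hle : W ≤ V := by
        rw [hW, Submodule.span_le]
        rintro _ ⟨k, rfl⟩
        exact hX ⟨k, rfl⟩
      exact hle hx
  rw [this]
  exact hsub

lemma isBounded_affine_disc (M : Matrix (Fin 2) (Fin 2) ℝ) (c : Plane) :
    Bornology.IsBounded ((fun y => act M y + c) '' disc) := by
  have hc : Continuous (act M) := LinearMap.continuous_of_finiteDimensional _
  exact ((isCompact_closedBall (0 : Plane) 1).image (hc.add continuous_const)).isBounded

/-- Ellipses whose quadratic forms are proportional are homothetic. -/
lemma homothetic_of_norm_eq {M N : GL (Fin 2) ℝ} {c d : Plane} {s : ℝ} (hs : 0 < s)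
    (h : ∀ x : S1, ‖act (N : Matrix (Fin 2) (Fin 2) ℝ).transpose x‖ =
      s * ‖act (M : Matrix (Fin 2) (Fin 2) ℝ).transpose x‖) :
    Homothetic ((fun x => act (M : Matrix (Fin 2) (Fin 2) ℝ) x + c) '' disc)
      ((fun x => act (N : Matrix (Fin 2) (Fin 2) ℝ) x + d) '' disc) := by
  have e : SymBody.unitDisc.image N = SymBody.smul s hs (SymBody.unitDisc.image M) := by
    apply SymBody.h_injective
    rw [SymBody.h_smul]
    apply Subtype.ext
    funext x
    change supp (act _ '' disc) x = s * supp (act _ '' disc) x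
    rw [supp_act_disc, supp_act_disc, h]
  have e1 : act (N : Matrix (Fin 2) (Fin 2) ℝ) '' disc =
      s • (act (M : Matrix (Fin 2) (Fin 2) ℝ) '' disc) := congrArg SymBody.set e
  refine ⟨s, d - s • c, hs, ?_⟩
  have e2 : (fun x => act (N : Matrix (Fin 2) (Fin 2) ℝ) x + d) '' disc =
      (fun y => y + d) '' (act (N : Matrix (Fin 2) (Fin 2) ℝ) '' disc) := by
    rw [image_image]
  rw [e2, e1, ← image_smul, image_image, image_image, image_image]
  congr 1
  funext x
  rw [smul_add]
  abel

/-- If a sum of ellipses were an ellipse, the even parts of the support functions would give a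
linear relation between square roots of quadratic forms with a nonzero coefficient. -/
lemma sum_ellipses_not_ellipse (n : ℕ) (E : Fin n → Set Plane) (hn : 2 ≤ n)
    (hE : ∀ k, IsEllipse (E k)) (hne : ∀ j k, j ≠ k → ¬ Homothetic (E j) (E k)) :
    ¬ IsEllipse (∑ k, E k) := by
  rintro ⟨N, d, hN⟩
  choose M c hM using hE
  have hdn : disc.Nonempty := ⟨0, Metric.mem_closedBall_self zero_le_one⟩
  have hbd : ∀ k, Bornology.IsBounded (E k) := fun k => by
    rw [hM]; exact isBounded_affine_disc _ _
  have hnn : ∀ k, (E k).Nonempty := fun k => by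
    rw [hM]; exact hdn.image _
  have hsupp : ∀ x : S1, ∑ k, (‖act (M k : Matrix (Fin 2) (Fin 2) ℝ).transpose x‖ +
      inner ℝ (x : Plane) (c k)) =
      ‖act (N : Matrix (Fin 2) (Fin 2) ℝ).transpose x‖ + inner ℝ (x : Plane) d := by
    intro x
    rw [← supp_affine_disc, ← hN, supp_sum _ _ hbd hnn, Finset.sum_apply]
    refine Finset.sum_congr rfl fun k _ => ?_
    rw [hM, supp_affine_disc]
  -- the translations do not contribute to the even parts
  have heven : ∀ x : S1, ∑ k, ‖act (M k : Matrix (Fin 2) (Fin 2) ℝ).transpose x‖ =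
      ‖act (N : Matrix (Fin 2) (Fin 2) ℝ).transpose x‖ := by
    intro x
    have h1 := hsupp x
    have h2 := hsupp (-x)
    have h3 : ((-x : S1) : Plane) = -(x : Plane) := rfl
    simp only [h3, map_neg, norm_neg, inner_neg_left, Finset.sum_add_distrib,
      Finset.sum_neg_distrib] at h1 h2
    linarith
  let qa : GL (Fin 2) ℝ → ℝ := fun P => (P : Matrix (Fin 2) (Fin 2) ℝ) 0 0 ^ 2 +
    (P : Matrix (Fin 2) (Fin 2) ℝ) 0 1 ^ 2
  let qb : GL (Fin 2) ℝ → ℝ := fun P => (P : Matrix (Fin 2) (Fin 2) ℝ) 0 0 *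
    (P : Matrix (Fin 2) (Fin 2) ℝ) 1 0 + (P : Matrix (Fin 2) (Fin 2) ℝ) 0 1 *
    (P : Matrix (Fin 2) (Fin 2) ℝ) 1 1
  let qc : GL (Fin 2) ℝ → ℝ := fun P => (P : Matrix (Fin 2) (Fin 2) ℝ) 1 0 ^ 2 +
    (P : Matrix (Fin 2) (Fin 2) ℝ) 1 1 ^ 2
  have hnorm : ∀ (P : GL (Fin 2) ℝ) (x : S1),
      ‖act (P : Matrix (Fin 2) (Fin 2) ℝ).transpose x‖ = √(qa P * (x : Plane) 0 ^ 2 +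
        2 * qb P * ((x : Plane) 0 * (x : Plane) 1) + qc P * (x : Plane) 1 ^ 2) := fun P x => by
    rw [← norm_sq_act_transpose, Real.sqrt_sq (norm_nonneg _)]
  have hd : ∀ P, 0 < qa P * qc P - qb P ^ 2 := fun P => by
    have h1 : (P : Matrix (Fin 2) (Fin 2) ℝ).det ≠ 0 := (P.isUnit.map Matrix.detMonoidHom).ne_zero
    have h2 : qa P * qc P - qb P ^ 2 = (P : Matrix (Fin 2) (Fin 2) ℝ).det ^ 2 := by
      rw [Matrix.det_fin_two]; ring
    rw [h2]; positivity
  have ha : ∀ P, 0 < qa P := fun P => by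
    have h1 := hd P
    have h2 : 0 ≤ qa P := by positivity
    have h3 : 0 ≤ qc P := by positivity
    by_contra h
    have : qa P = 0 := by linarith
    rw [this] at h1
    nlinarith [sq_nonneg (qb P)]
  have hprop : ∀ P Q : GL (Fin 2) ℝ, ∀ r : ℝ, qa P = r * qa Q → qb P = r * qb Q →
      qc P = r * qc Q → 0 < r ∧ ∀ x : S1, ‖act (P : Matrix (Fin 2) (Fin 2) ℝ).transpose x‖ =
        √r * ‖act (Q : Matrix (Fin 2) (Fin 2) ℝ).transpose x‖ := by
    intro P Q r h1 h2 h3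
    have hr : 0 < r := by
      have p1 := ha P
      rw [h1] at p1
      exact pos_of_mul_pos_left p1 (ha Q).le
    refine ⟨hr, fun x => ?_⟩
    rw [hnorm, hnorm, ← Real.sqrt_mul hr.le, h1, h2, h3]
    congr 1
    ring
  have hMne : ∀ i j, i ≠ j → ¬ ∃ r : ℝ, qa (M i) = r * qa (M j) ∧ qb (M i) = r * qb (M j) ∧
      qc (M i) = r * qc (M j) := by
    rintro i j hij ⟨r, h1, h2, h3⟩
    obtain ⟨hr, h⟩ := hprop _ _ r h1 h2 h3
    apply hne j i hij.symm
    rw [hM j, hM i]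
    exact homothetic_of_norm_eq (Real.sqrt_pos.mpr hr) h
  by_cases hex : ∃ j r, qa N = r * qa (M j) ∧ qb N = r * qb (M j) ∧ qc N = r * qc (M j)
  · obtain ⟨j, r, h1, h2, h3⟩ := hex
    obtain ⟨-, h⟩ := hprop _ _ r h1 h2 h3
    -- some coefficient of the relation is equal to one
    have : Nontrivial (Fin n) := Fin.nontrivial_iff_two_le.mpr hn
    obtain ⟨k, hk⟩ := exists_ne j
    have h4 := sqrt_form_indep (fun i => qa (M i)) (fun i => qb (M i)) (fun i => qc (M i))
      (fun i => ha _) (fun i => hd _) hMne (fun i => 1 - if i = j then √r else 0) (fun x => by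
        simp only [← hnorm, sub_mul, Finset.sum_sub_distrib, one_mul, ite_mul, zero_mul,
          Finset.sum_ite_eq', Finset.mem_univ, if_true, heven, h]
        ring) k
    simp [hk] at h4
  · -- the relation would be between pairwise independent forms
    let P : Option (Fin n) → GL (Fin 2) ℝ := fun o => o.elim N M
    have h4 := sqrt_form_indep (fun o => qa (P o)) (fun o => qb (P o)) (fun o => qc (P o))
      (fun o => ha _) (fun o => hd _) (fun i j hij => by
        rintro ⟨r, h1, h2, h3⟩
        have hsymm : ∀ Q : GL (Fin 2) ℝ, ∀ Q' : GL (Fin 2) ℝ, qa Q = r * qa Q' →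
            qb Q = r * qb Q' → qc Q = r * qc Q' →
            qa Q' = r⁻¹ * qa Q ∧ qb Q' = r⁻¹ * qb Q ∧ qc Q' = r⁻¹ * qc Q := by
          intro Q Q' h1 h2 h3
          have hr := (hprop _ _ r h1 h2 h3).1
          rw [h1, h2, h3]
          refine ⟨?_, ?_, ?_⟩ <;> field_simp
        rcases i with _ | i <;> rcases j with _ | j
        · exact hij rfl
        · exact hex ⟨j, r, h1, h2, h3⟩
        · exact hex ⟨i, r⁻¹, hsymm _ _ h1 h2 h3⟩
        · exact hMne i j (fun h => hij (congrArg some h)) ⟨r, h1, h2, h3⟩)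
      (fun o => o.elim (-1) fun _ => 1) (fun x => by
        rw [Fintype.sum_option]
        simp only [P, ← hnorm, Option.elim, one_mul, heven]
        ring) none
    norm_num at h4

/-! ### The limit set -/

/-- Multiples of the support functions of ellipses of area `π` converge to those of segments: an
ellipse around the segment that gets thinner is rescaled to area `π`. -/
lemma exists_near_segH {v : Plane} (hv : v ≠ 0) {ε : ℝ} (hε : 0 < ε) :
    ∃ (z : UpperHalfPlane) (c : ℝ), normH1 (c • (ellipsePoint z).vec - segH v) < ε := by
  have hpi := Real.pi_pos
  have hvp : 0 < ‖v‖ := norm_pos_iff.mpr hv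
  have hvsq := norm_sq_plane v
  set R := ‖v‖
  obtain ⟨δ, hδ, hδ1, hδε⟩ : ∃ δ : ℝ, 0 < δ ∧ δ ≤ 1 ∧ δ * (21 * R ^ 2) < ε ^ 2 := by
    refine ⟨min 1 (ε ^ 2 / (21 * R ^ 2 + 1)), by positivity, min_le_left _ _, ?_⟩
    have h1 : min 1 (ε ^ 2 / (21 * R ^ 2 + 1)) * (21 * R ^ 2) ≤
        ε ^ 2 / (21 * R ^ 2 + 1) * (21 * R ^ 2) :=
      mul_le_mul_of_nonneg_right (min_le_right _ _) (by positivity)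
    refine lt_of_le_of_lt h1 ?_
    rw [div_mul_eq_mul_div, div_lt_iff₀ (by positivity)]
    nlinarith [pow_pos hε 2]
  have hsδ := Real.sqrt_pos.mpr hδ
  have hsδ2 := Real.sq_sqrt hδ.le
  set c := √δ * R with hc
  have hcp : 0 < c := by positivity
  have hc2 : c ^ 2 = δ * R ^ 2 := by rw [hc, mul_pow, hsδ2]
  -- the ellipse `c g D` has the half-axes `v` and `δ` times `v` rotated by a quarter turn
  let g : SL(2, ℝ) := ⟨!![v 0 / c, -(δ * v 1) / c; v 1 / c, δ * v 0 / c], by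
    rw [Matrix.det_fin_two_of]
    field_simp
    rw [hc2, hvsq]
    ring⟩
  refine ⟨g • UpperHalfPlane.I, c, ?_⟩
  set y := ellipsePoint (g • UpperHalfPlane.I) with hy
  set u : H1even := c • y.vec - segH v with hu
  have hval : ∀ x : S1, c * y.fn x = √(inner ℝ (x : Plane) v ^ 2 +
      (δ * ((x : Plane) 1 * v 0 - (x : Plane) 0 * v 1)) ^ 2) := by
    intro x
    rw [hy, ellipsePoint_fn, ← norm_sq_act_SL, ← Real.sqrt_sq hcp.le,
      ← Real.sqrt_mul (sq_nonneg c), norm_sq_act_transpose, inner_plane]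
    congr 1
    simp only [g, Matrix.of_apply, Matrix.cons_val_zero, Matrix.cons_val_one, Matrix.cons_val',
      Matrix.cons_val_fin_one]
    field_simp
    ring
  have hw : ∀ x : S1, |δ * ((x : Plane) 1 * v 0 - (x : Plane) 0 * v 1)| ≤ δ * R := by
    intro x
    have hx : (x : Plane) 0 ^ 2 + (x : Plane) 1 ^ 2 = 1 := by
      rw [← norm_sq_plane]; simp
    rw [abs_mul, abs_of_pos hδ]
    apply mul_le_mul_of_nonneg_left _ hδ.le
    apply abs_le_of_sq_le_sq _ hvp.le
    rw [hvsq]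
    nlinarith [sq_nonneg (x.1 0 * v 0 + x.1 1 * v 1)]
  have hlow : ∀ x : S1, |inner ℝ (x : Plane) v| ≤ c * y.fn x := by
    intro x
    rw [hval, ← Real.sqrt_sq_eq_abs]
    exact Real.sqrt_le_sqrt (by linarith [sq_nonneg (δ * ((x : Plane) 1 * v 0 - (x : Plane) 0 * v 1))])
  have hup : ∀ x : S1, c * y.fn x ≤ |inner ℝ (x : Plane) v| + δ * R := by
    intro x
    rw [hval]
    apply Real.sqrt_le_iff.mpr
    refine ⟨by positivity, ?_⟩
    have h1 := sq_le_sq' (by linarith [abs_nonneg (δ * ((x : Plane) 1 * v 0 - (x : Plane) 0 * v 1)), hw x]) (hw x)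
    rw [sq_abs] at h1
    have h2 := sq_abs (inner ℝ (x : Plane) v)
    have h3 := mul_nonneg (abs_nonneg (inner ℝ (x : Plane) v)) (mul_pos hδ hvp).le
    nlinarith
  have hux : ∀ x : S1, u.1 x ^ 2 ≤ (δ * R) ^ 2 := by
    intro x
    have e : u.1 x = c * y.fn x - |inner ℝ (x : Plane) v| := by
      rw [← segH_apply]; rfl
    rw [e]
    apply sq_le_sq'
    · linarith [hlow x, mul_pos hδ hvp]
    · linarith [hup x]
  have hint : ∫ θ in (0)..(2 * π), ang u.1 θ ^ 2 ≤ 2 * π * (δ * R) ^ 2 := by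
    have hi1 : IntervalIntegrable (fun t => ang u.1 t ^ 2) volume 0 (2 * π) := by
      simpa [pow_two] using int_ang_mul u u
    have := intervalIntegral.integral_mono_on (μ := volume) (a := 0) (b := 2 * π)
      (f := fun t => ang u.1 t ^ 2) (g := fun _ => (δ * R) ^ 2) (by positivity) hi1
      intervalIntegrable_const (fun x _ => hux (circ x))
    rw [intervalIntegral.integral_const, smul_eq_mul, sub_zero] at this
    exact this
  -- the form against the segment is an evaluation in the direction of the short half-axis
  have hAyv : c * A y.vec (segH v) ≤ 2 * R / π * (δ * R) := by
    obtain ⟨r, φ, hφ, e, hr⟩ := exists_polar v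
    have h1 := A_segH y.vec r hφ
    rw [← e, ← hr] at h1
    rw [h1]
    have h2 := hup (circ (φ + π / 2))
    have h3 : inner ℝ (circ (φ + π / 2) : Plane) v = 0 := by
      rw [e, inner_smul_right, inner_circ, circ_zero_apply, circ_one_apply, Real.cos_add_pi_div_two,
        Real.sin_add_pi_div_two]
      ring
    rw [h3, abs_zero, zero_add] at h2
    have h4 : 0 ≤ 2 * R / π := by positivity
    calc c * (2 * R / π * y.vec.1 (circ (φ + π / 2)))
        = 2 * R / π * (c * y.fn (circ (φ + π / 2))) := by
          change c * (2 * R / π * y.fn (circ (φ + π / 2))) = _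
          ring
      _ ≤ _ := mul_le_mul_of_nonneg_left h2 h4
  have hA : A u u = c ^ 2 - 2 * (c * A y.vec (segH v)) := by
    have h1 : A y.vec y.vec = 1 := y.2.1
    simp only [hu, map_sub, map_smul, LinearMap.sub_apply, LinearMap.smul_apply, smul_eq_mul, h1,
      A_segH_self, A_comm (segH v) y.vec]
    ring
  -- the form and the mean square determine the Sobolev norm
  have hsq : normH1 u ^ 2 < ε ^ 2 := by
    rw [normH1_sq_eq_sub, hA]
    have h1 : 2 * π * (2 * (2 * R / π * (δ * R))) = 8 * R ^ 2 * δ := by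
      field_simp
      ring
    have h2 : 2 * π * (2 * (c * A y.vec (segH v))) ≤ 8 * R ^ 2 * δ := by
      rw [← h1]
      have : (0 : ℝ) ≤ 2 * π := by positivity
      exact mul_le_mul_of_nonneg_left (by linarith) this
    have h3 : 0 ≤ 2 * π * c ^ 2 := by positivity
    have h4 : 2 * (2 * π * (δ * R) ^ 2) ≤ 13 * R ^ 2 * δ := by
      have h5 : δ ^ 2 ≤ δ := by nlinarith
      have h6 : 0 ≤ R ^ 2 := sq_nonneg R
      have h7 : 4 * π ≤ 13 := by linarith [Real.pi_lt_d2]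
      calc 2 * (2 * π * (δ * R) ^ 2) = (4 * π) * (R ^ 2 * δ ^ 2) := by ring
        _ ≤ 13 * (R ^ 2 * δ) := by
          apply mul_le_mul h7 (mul_le_mul_of_nonneg_left h5 h6) (by positivity) (by norm_num)
        _ = _ := by ring
    linarith
  exact lt_of_pow_lt_pow_left₀ 2 hε.le hsq

/-- The square of a limit of multiples of support functions of ellipses is a positive semidefinite
quadratic form, and such a limit does not change sign. -/
lemma sq_of_limit {k : H1even}
    (h : ∀ ε > 0, ∃ x ∈ range ellipsePoint, ∃ c : ℝ, normH1 (c • x.vec - k) < ε) :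
    (∃ a b c : ℝ, 0 ≤ a ∧ 0 ≤ c ∧ 0 ≤ a * c - b ^ 2 ∧ ∀ x : S1, k.1 x ^ 2 =
      a * (x : Plane) 0 ^ 2 + 2 * b * ((x : Plane) 0 * (x : Plane) 1) + c * (x : Plane) 1 ^ 2) ∧
    ∀ x y : S1, 0 ≤ k.1 x * k.1 y := by
  have h1 : ∀ n : ℕ, ∃ (z : UpperHalfPlane) (c : ℝ),
      normH1 (c • (ellipsePoint z).vec - k) < 1 / ((n : ℝ) + 1) := fun n => by
    obtain ⟨_, ⟨z, rfl⟩, c, hc⟩ := h (1 / ((n : ℝ) + 1)) (by positivity)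
    exact ⟨z, c, hc⟩
  choose z c hzc using h1
  have hlim : ∀ x : S1, Tendsto (fun n => c n * (ellipsePoint (z n)).fn x) atTop (𝓝 (k.1 x)) := by
    intro x
    rw [tendsto_iff_dist_tendsto_zero]
    have h2 : Tendsto (fun n : ℕ => 6 * (1 / ((n : ℝ) + 1))) atTop (𝓝 0) := by
      have := (tendsto_one_div_add_atTop_nhds_zero_nat (𝕜 := ℝ)).const_mul 6
      simpa using this
    refine squeeze_zero (fun _ => dist_nonneg) (fun n => ?_) h2
    rw [Real.dist_eq]
    refine (abs_le_normH1 (c n • (ellipsePoint (z n)).vec - k) x).trans ?_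
    exact mul_le_mul_of_nonneg_left (hzc n).le (by norm_num)
  have hsq : ∀ x : S1, Tendsto (fun n => c n ^ 2 * ellipseForm (z n) x) atTop
      (𝓝 (k.1 x ^ 2)) := by
    intro x
    refine ((hlim x).pow 2).congr fun n => ?_
    rw [ellipsePoint_fn, mul_pow, Real.sq_sqrt]
    rw [← norm_sq_act_ellipseMatrix]
    positivity
  constructor
  · -- the coefficients of a quadratic form are combinations of its values at three points, hence
    -- they converge
    set A' : ℕ → ℝ := fun n => c n ^ 2 * (Complex.normSq (z n) / (z n).im) with hA'
    set B' : ℕ → ℝ := fun n => c n ^ 2 * ((z n).re / (z n).im) with hB'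
    set C' : ℕ → ℝ := fun n => c n ^ 2 * (1 / (z n).im) with hC'
    have hform : ∀ (x : S1) n, c n ^ 2 * ellipseForm (z n) x = A' n * (x : Plane) 0 ^ 2 +
        2 * B' n * ((x : Plane) 0 * (x : Plane) 1) + C' n * (x : Plane) 1 ^ 2 := fun x n => by
      rw [ellipseForm_eq]; ring
    have hA : Tendsto A' atTop (𝓝 (k.1 (circ 0) ^ 2)) := by
      refine (hsq (circ 0)).congr fun n => ?_
      rw [hform, circ_zero_apply, circ_one_apply]
      simp
    have hC : Tendsto C' atTop (𝓝 (k.1 (circ (π / 2)) ^ 2)) := by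
      refine (hsq (circ (π / 2))).congr fun n => ?_
      rw [hform, circ_zero_apply, circ_one_apply]
      simp
    have hB : Tendsto B' atTop (𝓝 (k.1 (circ (π / 4)) ^ 2 -
        (k.1 (circ 0) ^ 2 + k.1 (circ (π / 2)) ^ 2) / 2)) := by
      refine ((hsq (circ (π / 4))).sub ((hA.add hC).div_const 2)).congr fun n => ?_
      rw [hform, circ_zero_apply, circ_one_apply, Real.cos_pi_div_four, Real.sin_pi_div_four]
      have h2 : (√2 / 2) ^ 2 = 1 / 2 := by
        rw [div_pow, Real.sq_sqrt zero_le_two]; norm_num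
      linear_combination (A' n + 2 * B' n + C' n) * h2
    refine ⟨k.1 (circ 0) ^ 2, k.1 (circ (π / 4)) ^ 2 -
      (k.1 (circ 0) ^ 2 + k.1 (circ (π / 2)) ^ 2) / 2, k.1 (circ (π / 2)) ^ 2,
      sq_nonneg _, sq_nonneg _, ?_, fun x => ?_⟩
    · refine ge_of_tendsto ((hA.mul hC).sub (hB.pow 2)) (Eventually.of_forall fun n => ?_)
      have e : A' n * C' n - B' n ^ 2 = (c n ^ 2) ^ 2 := by
        have := ellipseForm_disc (z n)
        simp only [hA', hB', hC']
        linear_combination (c n ^ 2) ^ 2 * this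
      rw [e]
      positivity
    · refine tendsto_nhds_unique (hsq x) ?_
      have := ((hA.mul_const ((x : Plane) 0 ^ 2)).add
        ((hB.const_mul 2).mul_const ((x : Plane) 0 * (x : Plane) 1))).add
        (hC.mul_const ((x : Plane) 1 ^ 2))
      exact this.congr fun n => (hform x n).symm
  · intro x y
    refine ge_of_tendsto ((hlim x).mul (hlim y)) (Eventually.of_forall fun n => ?_)
    rw [ellipsePoint_fn, ellipsePoint_fn]
    have : c n * √(ellipseForm (z n) x) * (c n * √(ellipseForm (z n) y)) =
        c n ^ 2 * (√(ellipseForm (z n) x) * √(ellipseForm (z n) y)) := by ring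
    rw [this]
    positivity

/-- A function of constant sign is determined up to sign by its square. -/
lemma exists_sign {k : H1even} (hs : ∀ x y : S1, 0 ≤ k.1 x * k.1 y) :
    ∃ σ : ℝ, σ ^ 2 = 1 ∧ ∀ f : H1even, (∀ x, 0 ≤ f.1 x) → (∀ x, k.1 x ^ 2 = f.1 x ^ 2) →
      f = σ • k := by
  have key : ∃ σ : ℝ, σ ^ 2 = 1 ∧ ∀ x, 0 ≤ σ * k.1 x := by
    by_cases h : ∃ x, k.1 x < 0
    · obtain ⟨x, hx⟩ := h
      exact ⟨-1, by norm_num, fun y => by nlinarith [hs x y]⟩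
    · push Not at h
      exact ⟨1, by norm_num, fun y => by rw [one_mul]; exact h y⟩
  obtain ⟨σ, hσ, hk⟩ := key
  refine ⟨σ, hσ, fun f hf hfk => ?_⟩
  apply Subtype.ext
  funext x
  change f.1 x = σ * k.1 x
  rw [← abs_of_nonneg (hf x), ← abs_of_nonneg (hk x), ← sq_eq_sq_iff_abs_eq_abs, mul_pow, hσ,
    one_mul, hfk x]

/-- An isotropic limit of multiples of support functions of ellipses has a degenerate quadratic
form as its square, so that it is the support function of a segment up to sign. -/
lemma limitSet_ellipsePoint : limitSet (range ellipsePoint) = Gam := by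
  ext ζ
  constructor
  · rintro ⟨k, hk, hk0, hlim⟩
    obtain ⟨⟨a, b, c, ha, hc, hd, hq⟩, hs⟩ := sq_of_limit hlim
    obtain ⟨σ, hσ, hsign⟩ := exists_sign hs
    have hA := Boundary.A_of_mem_line hk
    have hd0 : a * c - b ^ 2 = 0 := by
      -- otherwise the limit is a multiple of the support function of an ellipse
      by_contra hne
      have hdp : 0 < a * c - b ^ 2 := lt_of_le_of_ne hd (Ne.symm hne)
      have hcp : 0 < c := by
        by_contra h
        have : c = 0 := by linarith
        rw [this] at hdp
        nlinarith [sq_nonneg b]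
      have hs := Real.sqrt_pos.mpr hdp
      have hs2 := Real.sq_sqrt hdp.le
      set s := √(a * c - b ^ 2)
      have hss := Real.sq_sqrt hs.le
      have hssp := Real.sqrt_pos.mpr hs
      let z : UpperHalfPlane := ⟨⟨b / c, s / c⟩, div_pos hs hcp⟩
      have hz : ∀ x : S1, s * ellipseForm z x = k.1 x ^ 2 := by
        intro x
        have h1 : z.re = b / c := rfl
        have h2 : z.im = s / c := rfl
        rw [hq, ellipseForm, Complex.normSq_apply, UpperHalfPlane.coe_re, UpperHalfPlane.coe_im,
          h1, h2]
        have h3 : a = (b ^ 2 + s ^ 2) / c := by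
          rw [hs2]; field_simp; ring
        rw [h3]
        field_simp
      have h4 := hsign (√s • (ellipsePoint z).vec) (fun x => by
        change 0 ≤ √s * (ellipsePoint z).fn x
        rw [ellipsePoint_fn]
        positivity) (fun x => by
        change _ = (√s * (ellipsePoint z).fn x) ^ 2
        rw [ellipsePoint_fn, mul_pow, hss, Real.sq_sqrt, hz]
        rw [← norm_sq_act_ellipseMatrix]
        positivity)
      have h5 := congrArg (fun f => A f f) h4
      have h6 : A (ellipsePoint z).vec (ellipsePoint z).vec = 1 := (ellipsePoint z).2.1
      simp only [map_smul, LinearMap.smul_apply, smul_eq_mul, hA, h6] at h5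
      nlinarith
    -- a semidefinite form of determinant zero is the square of a linear form
    obtain ⟨w0, w1, h0, h1, h2⟩ : ∃ w0 w1 : ℝ, w0 ^ 2 = a ∧ w0 * w1 = b ∧ w1 ^ 2 = c := by
      have hb : √a * √c = |b| := by
        rw [← Real.sqrt_mul ha, ← Real.sqrt_sq_eq_abs]
        congr 1
        linarith
      rcases le_total 0 b with h | h
      · exact ⟨√a, √c, Real.sq_sqrt ha, by rw [hb, abs_of_nonneg h], Real.sq_sqrt hc⟩
      · refine ⟨√a, -√c, Real.sq_sqrt ha, by rw [mul_neg, hb, abs_of_nonpos h, neg_neg], ?_⟩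
        rw [neg_sq, Real.sq_sqrt hc]
    set w : Plane := !₂[w0, w1] with hw
    have hkw : segH w = σ • k := by
      refine hsign _ (fun x => ?_) fun x => ?_
      · rw [segH_apply]; exact abs_nonneg _
      · rw [segH_apply, sq_abs, inner_plane, hq, ← h0, ← h1, ← h2]
        simp only [hw, Matrix.cons_val_zero, Matrix.cons_val_one]
        ring
    refine ⟨w, (isDirection_iff _ _).mpr ⟨fun hw0 => ?_, ?_⟩⟩
    · have hz : segH w = 0 := by
        apply Subtype.ext
        funext x
        rw [segH_apply, hw0]
        simp
      rw [hz] at hkw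
      rcases smul_eq_zero.mp hkw.symm with h | h
      · rw [h] at hσ; norm_num at hσ
      · exact hk0 h
    · rw [hkw]
      exact ζ.line.smul_mem σ hk
  · rintro ⟨v, hv⟩
    obtain ⟨hv0, hv⟩ := (isDirection_iff _ _).mp hv
    refine ⟨segH v, hv, segH_ne_zero hv0, fun ε hε => ?_⟩
    obtain ⟨z, c, h⟩ := exists_near_segH hv0 hε
    exact ⟨_, ⟨z, rfl⟩, c, h⟩

end ConvexHyp

end

open ConvexHyp

theorem theorem1p2 :
    ∃ ι : UpperHalfPlane → HInf,
      -- `ι` sends `g • i` to the support function of the ellipse `g D`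
      (∀ g : SL(2, ℝ), (ι (g • UpperHalfPlane.I)).fn =
        supp (act (g : Matrix (Fin 2) (Fin 2) ℝ) '' disc)) ∧
      -- hyperbolic spans, and Minkowski sums of ellipses
      (∀ (n : ℕ) (p : Fin (n + 1) → HInf), Function.Injective p → (∀ k, p k ∈ range ι) →
        IsHyperbolicSubspace n (hyperbolicSpan (range p))) ∧
      (∀ (n : ℕ) (E : Fin n → Set Plane), 2 ≤ n → (∀ k, IsEllipse (E k)) →
        (∀ j k, j ≠ k → ¬ Homothetic (E j) (E k)) → ¬ IsEllipse (∑ k, E k)) ∧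
      -- the limit set and its visual distance
      (∀ v : Plane, v ≠ 0 → ∃! ζ : Boundary, IsDirection ζ v) ∧
      limitSet (range ι) = Gam ∧
      (∀ (ζ η : Boundary) (v w : Plane), IsDirection ζ v → IsDirection η w →
        dist ζ η = √π / 2 * √(Real.sin (InnerProductGeometry.angle v w))) ∧
      dimH Gam = 2 ∧
      -- the quotient of `C_K`
      (∀ K : SymBody, volume K.set = ENNReal.ofReal π → ∃ h : HInf, h.fn = supp K.set) ∧
      (∀ (g : PSL2), ∀ h ∈ CK, ∃ k ∈ CK, k.even = rho g h.even) ∧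
      Nonempty (CKQuotient ≃ₜ OrientedBanachMazur) := by
  exact ⟨ellipsePoint, ellipsePoint_smul_I,
    fun n p hp hr => isHyperbolicSubspace_hyperbolicSpan p (linearIndependent_ellipsePoint p hp hr),
    sum_ellipses_not_ellipse, existsUnique_isDirection, limitSet_ellipsePoint,
    dist_of_isDirection, dimH_Gam, exists_point_of_volume, exists_rho_mem,
    ⟨quotientHomeomorph⟩⟩
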